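/- Let $\Omega\subset\mathbb R^2$ be an unbounded domain (open, connected) whose boundary $\partial\Omega$ is a smooth Jordan curve, and let $\boldsymbol n$ be the unit normal on $\partial\Omega$ pointing into $\Omega$, away from the region enclosed by $\partial\Omega$. Let $\Phi>0$, and let $U$ be a function that is twice continuously differentiable on $\Omega\cup\partial\Omega$ (up to the boundary), harmonic in $\Omega$, equal to a constant $\varphi_0$ on $\partial\Omega$, with total flux $$-\oint_{\partial\Omega}\boldsymbol n\cdot\nabla U\,\mathrm ds=\Phi ,$$ and with the asymptotic behavior $U(\boldsymbol r)\sim-\frac{\Phi}{2\pi}\log\frac{2\pi|\boldsymbol r|}{L_{\partial\Omega}}$ (the ratio tends to $1$) as $|\boldsymbol r|\to\infty$, where $L_{\partial\Omega}$ is the length of $\partial\Omega$. For $\varphi\le\varphi_0$ let $\Sigma_\varphi=\{\boldsymbol r\in\Omega\cup\partial\Omega: U(\boldsymbol r)=\varphi\}$ be the equipotential curve, $L_{\Sigma_\varphi}$ its length (one-dimensional Hausdorff measure), $E=|\nabla U|$, let $\kappa$ be the signed curvature of the equipotential curves with respect to the normal $-\nabla U/|\nabla U|$ (positive for circles with their outward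 normal), and let $$\mathscr H(\varphi)=\oint_{\Sigma_\varphi}\frac{E}{\Phi}\log\frac{E\,L_{\Sigma_\varphi}}{\Phi}\,\mathrm ds .$$ Then $0<L_{\Sigma_\varphi}<\infty$ for all $\varphi\le\varphi_0$, and the circumference $L_{\Sigma_\varphi}$ is logarithmically convex in $\varphi$, i.e. $\varphi\mapsto\log L_{\Sigma_\varphi}$ is convex on $(-\infty,\varphi_0]$. Moreover the integral defining $\mathscr H(\varphi)$ converges absolutely, $\log L_{\Sigma_\varphi}$ and $\mathscr H$ are twice continuously differentiable on $(-\infty,\varphi_0]$ (with one-sided derivatives at $\varphi_0$), and for every $\varphi\le\varphi_0$ $$\mathscr H''(\varphi)=\frac{\mathrm d^2}{\mathrm d\varphi^2}\log L_{\Sigma_\varphi}\ge0,$$ with equality if and only if $E$ and $\kappa$ are both constant on $\Sigma_\varphi$. -/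

import Mathlib

open scoped ContDiff Topology MeasureTheory

noncomputable section

/-- `γ` is a smooth, regular, `1`-periodic parametrization of the boundary of `Ω`, which it traverses
once.  It is oriented so that the normal `-i γ'` points into `Ω`, away from the region enclosed by
the curve (counterclockwise, when `Ω` is the exterior of the curve). -/
structure IsSmoothJordanBoundary (Ω : Set ℂ) (γ : ℝ → ℂ) : Prop where
  smooth : ContDiff ℝ ∞ γ
  periodic : Function.Periodic γ 1
  injOn : Set.InjOn γ (Set.Ico 0 1)
  regular : ∀ t, deriv γ t ≠ 0
  range_eq : Set.range γ = frontier Ω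
  normal : ∀ t, ∀ᶠ ε : ℝ in 𝓝[>] 0,
    γ t + ε * (-Complex.I * deriv γ t) ∈ Ω ∧ γ t - ε * (-Complex.I * deriv γ t) ∉ closure Ω

/-- Length (one-dimensional Hausdorff measure) of a curve in the plane. -/
def curveLength (S : Set ℂ) : ℝ := (μH[1] S).toReal

/-- The two-dimensional exterior Dirichlet problem with total flux `Φ` and boundary value `φ₀`.
The plane is identified with `ℂ`. Only the values of `U` on `closure Ω` matter. -/
structure IsExteriorDirichlet (Ω : Set ℂ) (γ : ℝ → ℂ) (U : ℂ → ℝ) (Φ φ₀ : ℝ) : Prop where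
  isOpen : IsOpen Ω
  isConnected : IsConnected Ω
  unbounded : ¬ Bornology.IsBounded Ω
  boundary : IsSmoothJordanBoundary Ω γ
  regular : ContDiffOn ℝ 2 U (closure Ω)
  harmonic : InnerProductSpace.HarmonicOnNhd U Ω
  boundaryValue : ∀ z ∈ frontier Ω, U z = φ₀
  flux_pos : 0 < Φ
  /-- `-∮ n · ∇U ds = Φ`, where `n ds = -i γ'(t) dt`. -/
  flux : -∫ t in (0 : ℝ)..1,
    fderivWithin ℝ U (closure Ω) (γ t) (-Complex.I * deriv γ t) = Φ
  asymptotics : Asymptotics.IsEquivalent (Filter.cocompact ℂ ⊓ Filter.principal Ω) U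
    fun z => -(Φ / (2 * Real.pi)) *
      Real.log (2 * Real.pi * ‖z‖ / curveLength (frontier Ω))

/-- The equipotential curve `Σ_φ`. -/
def levelCurve (Ω : Set ℂ) (U : ℂ → ℝ) (φ : ℝ) : Set ℂ := {z ∈ closure Ω | U z = φ}

/-- The circumference `L` of `Σ_φ`. -/
def levelLength (Ω : Set ℂ) (U : ℂ → ℝ) (φ : ℝ) : ℝ := curveLength (levelCurve Ω U φ)

/-- `E = |∇U|` on `closure Ω` (one-sided derivatives on the boundary). -/
def fieldStrength (Ω : Set ℂ) (U : ℂ → ℝ) (z : ℂ) : ℝ := ‖gradientWithin U (closure Ω) z‖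

/-- The outward unit normal `n = -∇U / |∇U|` of the level curves. -/
def levelNormal (Ω : Set ℂ) (U : ℂ → ℝ) (z : ℂ) : ℂ :=
  -((fieldStrength Ω U z)⁻¹ • gradientWithin U (closure Ω) z)

/-- The signed curvature `κ = T · ∂n/∂s` of the level curve through `z`, where `T = i n` is the
unit tangent and `∂/∂s` the derivative in the direction of `T`; it is `+1` on the unit circle with
its outward normal. -/
def levelCurvature (Ω : Set ℂ) (U : ℂ → ℝ) (z : ℂ) : ℝ :=
  inner ℝ (Complex.I * levelNormal Ω U z)
    (fderivWithin ℝ (levelNormal Ω U) (closure Ω) z (Complex.I * levelNormal Ω U z))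

/-- The integrand `(E/Φ) log (E L / Φ)` of the entropy. -/
def entropyDensity (Ω : Set ℂ) (U : ℂ → ℝ) (Φ φ : ℝ) (z : ℂ) : ℝ :=
  fieldStrength Ω U z / Φ * Real.log (fieldStrength Ω U z * levelLength Ω U φ / Φ)

/-- The entropy `H(φ)`: the integral of `(E/Φ) log (E L / Φ)` over `Σ_φ` by arc length. -/
def levelEntropy (Ω : Set ℂ) (U : ℂ → ℝ) (Φ φ : ℝ) : ℝ :=
  ∫ z in levelCurve Ω U φ, entropyDensity Ω U Φ φ z ∂μH[1]

end

/-! ### The maximum principle for harmonic functions in the plane -/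

/-! Put `c = Φ / 2π`. The theorem becomes a computation in isothermal coordinates. If `V` is a
(multivalued) harmonic conjugate of `U`, then `f = exp (-(U - φ₀ + iV) / c)` is a conformal map of
`Ω` onto the exterior of the unit disc. Its inverse in logarithmic coordinates `s = t + iθ` is a
`2πi`-periodic map `G` with `U (G s) = φ₀ - c t` and `G' = -c / F(G)`, where `F = U_x - i U_y`. The
level curve at `φ₀ - c t` is the image of one vertical period, `E = c / |G'|`, and `E ds = c dθ`.
Hence `L(t) = ∫ |G'| dθ` and `H = log L - log 2π - (1/2π) ∫ log |G'| dθ`.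

The function `log |G'|` is harmonic and periodic in `θ`, so its integral over a period is affine in
`t`; therefore `H` and `log L` have the same second derivative. With `q = G'' / G'`, differentiation
and one integration by parts in `θ` give `L' = ∫ |G'| Re q` and `L'' = ∫ |G'| |q|²`. So `(log L)''`
is the mean of `|q - m|²` with respect to the weight `|G'|`, where `m` is the weighted mean of `Re
q` (`weighted_variance`). It vanishes only if `q` is a real constant. Since `Im q` is minus the
tangential derivative of `log |G'|` and `Re q = κ |G'|`, this means that `E` and `κ` are constant
(`constant_iff`).

The work lies in constructing `G` up to the boundary.

Single-valuedness: on a sublevel set `{U < a}` with `a < φ₀`, cutting `F` off by a function of `U`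
and applying the Cauchy–Pompeiu formula writes `F` as a Cauchy transform of a compactly supported
density (`exists_hasBddPrimitive`). All poles can be moved to the single point `γ 0`: having a
bounded primitive is locally constant in the pole, and the maximum principle excludes a nonempty
open set of bad poles (`hasBddPrimitive_pole`). So `F - A / (z - γ 0)` has a bounded primitive, and
the asymptotics force `A = -c` (`exists_log_decomposition`).

Bijectivity: the resulting `f` is injective near infinity, and proper because `|f|` is a function of
`U`. The set of values taken twice, with multiplicity, is open and closed in the exterior of the
disc and misses large values, so it is empty (`injOn_and_surjOn_of_proper`).

Boundary: Hopf's lemma (`normal_deriv_neg`) keeps `F` away from zero, so `G` is Lipschitz near the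
imaginary axis and extends to it. Its first two derivatives are expressions in `F` and `F'`, which
are continuous on the closure because `U` is `C²` there. Injectivity on the axis follows from
uniqueness for an ODE that both `γ` and the reparametrized boundary values of `G` solve
(`exp_eq_of_boundary_eq`). -/

theorem InnerProductSpace.HarmonicAt.eventually_eq_of_isLocalMax {u : ℂ → ℝ} {x : ℂ}
    (hu : InnerProductSpace.HarmonicAt u x) (hm : IsLocalMax u x) : ∀ᶠ z in 𝓝 x, u z = u x := by
  obtain ⟨R, hR, hball⟩ := Metric.eventually_nhds_iff_ball.1 hu.eventually
  obtain ⟨f, hf, hfu⟩ :=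
    InnerProductSpace.HarmonicOnNhd.exists_analyticOnNhd_ball_re_eq (fun z hz => hball z hz)
  have hB : Metric.ball x R ∈ 𝓝 x := Metric.ball_mem_nhds x hR
  have hx : x ∈ Metric.ball x R := Metric.mem_ball_self hR
  -- With `u = Re f` locally, `‖exp f‖ = exp u`, so the maximum modulus principle applies to `exp
  -- f`.
  have h1 : ∀ᶠ z in 𝓝 x, DifferentiableAt ℂ (fun z => Complex.exp (f z)) z := by
    filter_upwards [hB] with z hz using (hf z hz).differentiableAt.cexp
  have h2 : IsLocalMax (norm ∘ fun z => Complex.exp (f z)) x := by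
    filter_upwards [hB, hm] with z hz hz'
    simp only [Function.comp, Complex.norm_exp]
    have e1 := hfu hz
    have e2 := hfu hx
    simp only at e1 e2
    rw [e1, e2]
    exact Real.exp_le_exp.2 hz'
  filter_upwards [Complex.eventually_eq_of_isLocalMax_norm h1 h2, hB] with z hz hzB
  have e1 := hfu hzB
  have e2 := hfu hx
  simp only at e1 e2
  have := congrArg norm hz
  simp only [Complex.norm_exp, e1, e2] at this
  exact Real.exp_injective this

/-- The weak maximum principle on bounded open sets. -/
theorem InnerProductSpace.HarmonicOnNhd.le_of_forall_frontier_le {u : ℂ → ℝ} {V : Set ℂ} {M : ℝ}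
    (hV : IsOpen V) (hb : Bornology.IsBounded V) (hu : InnerProductSpace.HarmonicOnNhd u V)
    (hc : ContinuousOn u (closure V)) (hM : ∀ z ∈ frontier V, u z ≤ M) :
    ∀ z ∈ closure V, u z ≤ M := by
  intro z hz
  have hK : IsCompact (closure V) := hb.isCompact_closure
  obtain ⟨x, hx, hmax⟩ := hK.exists_isMaxOn ⟨z, hz⟩ hc
  refine (hmax hz).trans ?_
  by_contra! hlt
  -- If the maximum exceeded `M`, its set of maximum points would avoid the frontier. It would then
  -- be open by the local statement as well as compact, hence all of the plane.
  set S : Set ℂ := {y ∈ closure V | u y = u x} with hS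
  have hSV : S ⊆ V := by
    rintro y ⟨hy, hyx⟩
    by_contra hyV
    have : y ∈ frontier V := ⟨hy, by rwa [hV.interior_eq]⟩
    have := hM y this
    linarith
  have hSclosed : IsClosed S := hc.preimage_isClosed_of_isClosed isClosed_closure isClosed_singleton
  have hSopen : IsOpen S := by
    rw [isOpen_iff_mem_nhds]
    intro y hy
    have hyV := hSV hy
    have hlm : IsLocalMax u y := by
      filter_upwards [hV.mem_nhds hyV] with w hw
      exact (hmax (subset_closure hw)).trans_eq hy.2.symm
    filter_upwards [(hu y hyV).eventually_eq_of_isLocalMax hlm, hV.mem_nhds hyV] with w hw hwV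
    exact ⟨subset_closure hwV, hw.trans hy.2⟩
  have huniv : S = Set.univ := IsClopen.eq_univ ⟨hSclosed, hSopen⟩ ⟨x, hx, rfl⟩
  have : IsCompact (Set.univ : Set ℂ) := huniv ▸ hK.of_isClosed_subset hSclosed (fun y hy => hy.1)
  exact noncompact_univ ℂ this

/-- The exterior of a disc is connected. -/
theorem Complex.isPreconnected_setOf_lt_norm {R : ℝ} (hR : 0 < R) :
    IsPreconnected {z : ℂ | R < ‖z‖} := by
  have h : {z : ℂ | R < ‖z‖} = Complex.exp '' {s : ℂ | Real.log R < s.re} := by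
    ext z
    constructor
    · intro hz
      have hz0 : z ≠ 0 := by rintro rfl; simp at hz; linarith
      refine ⟨Complex.log z, ?_, Complex.exp_log hz0⟩
      simpa [Complex.log_re] using Real.log_lt_log hR hz
    · rintro ⟨s, hs, rfl⟩
      simp only [Set.mem_ofPred_eq, Complex.norm_exp] at *
      rwa [← Real.log_lt_iff_lt_exp hR]
  rw [h]
  exact ((convex_halfSpace_re_gt _).isPreconnected).image _ Complex.continuous_exp.continuousOn

/-! ### Hausdorff measure of a regular curve -/

open MeasureTheory in
-- Being within slope `ε` of a linear map makes `g` Lipschitz with constant `‖v‖ + ε`.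
theorem hausdorffMeasure_image_le_of_near_linear {g : ℝ → ℂ} {s : Set ℝ} {v : ℂ} {ε : ℝ}
    (hε : 0 ≤ ε) (h : ∀ x ∈ s, ∀ y ∈ s, ‖g x - g y - (x - y : ℝ) • v‖ ≤ ε * |x - y|) :
    μH[1] (g '' s) ≤ ENNReal.ofReal (‖v‖ + ε) * volume s := by
  have hL : LipschitzOnWith (Real.toNNReal (‖v‖ + ε)) g s := by
    refine LipschitzOnWith.of_dist_le_mul fun x hx y hy => ?_
    rw [Real.coe_toNNReal _ (by positivity), dist_eq_norm, Real.dist_eq]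
    have h1 := h x hx y hy
    calc ‖g x - g y‖ = ‖(g x - g y - (x - y : ℝ) • v) + (x - y : ℝ) • v‖ := by congr 1; ring
      _ ≤ ε * |x - y| + |x - y| * ‖v‖ := by
        refine (norm_add_le _ _).trans (add_le_add h1 ?_)
        rw [norm_smul, Real.norm_eq_abs]
      _ = _ := by ring
  have := hL.hausdorffMeasure_image_le (d := 1) zero_le_one
  rw [ENNReal.rpow_one, hausdorffMeasure_real] at this
  exact this

open MeasureTheory in
-- Dually, `g` expands distances by at least `‖v‖ - ε`, so its inverse is Lipschitz; nothing is to
-- be proved when this number is not positive.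
theorem le_hausdorffMeasure_image_of_near_linear {g : ℝ → ℂ} {s : Set ℝ} {v : ℂ} {ε : ℝ}
    (h : ∀ x ∈ s, ∀ y ∈ s, ‖g x - g y - (x - y : ℝ) • v‖ ≤ ε * |x - y|) :
    ENNReal.ofReal (‖v‖ - ε) * volume s ≤ μH[1] (g '' s) := by
  rcases le_or_gt (‖v‖ - ε) 0 with h0 | h0
  · simp [ENNReal.ofReal_of_nonpos h0]
  have hlow : ∀ x ∈ s, ∀ y ∈ s, (‖v‖ - ε) * |x - y| ≤ ‖g x - g y‖ := by
    intro x hx y hy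
    have h1 := h x hx y hy
    have h2 : ‖(x - y : ℝ) • v‖ ≤ ‖g x - g y‖ + ‖g x - g y - (x - y : ℝ) • v‖ := by
      calc ‖(x - y : ℝ) • v‖ = ‖(g x - g y) - (g x - g y - (x - y : ℝ) • v)‖ := by congr 1; ring
        _ ≤ _ := norm_sub_le _ _
    rw [norm_smul, Real.norm_eq_abs] at h2
    nlinarith
  have hA : AntilipschitzWith (Real.toNNReal (‖v‖ - ε)⁻¹) (s.domRestrict g) := by
    refine AntilipschitzWith.of_le_mul_dist fun x y => ?_
    rw [Real.coe_toNNReal _ (by positivity), Subtype.dist_eq, Real.dist_eq, dist_eq_norm]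
    have := hlow x x.2 y y.2
    rw [inv_mul_eq_div, le_div_iff₀ h0]
    simpa [mul_comm, Set.domRestrict] using this
  have h2 := hA.le_hausdorffMeasure_image (d := 1) zero_le_one Set.univ
  rw [ENNReal.rpow_one, Set.image_univ, Set.range_domRestrict,
    ← (isometry_subtype_coe (s := s)).hausdorffMeasure_image (Or.inl zero_le_one), Set.image_univ,
    Subtype.range_coe, hausdorffMeasure_real] at h2
  calc ENNReal.ofReal (‖v‖ - ε) * volume s
      ≤ ENNReal.ofReal (‖v‖ - ε) * ((Real.toNNReal (‖v‖ - ε)⁻¹ : NNReal) * μH[1] (g '' s)) := by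
        gcongr
    _ = μH[1] (g '' s) := by
      rw [← mul_assoc, ← ENNReal.ofReal, ← ENNReal.ofReal_mul h0.le, mul_inv_cancel₀ h0.ne',
        ENNReal.ofReal_one, one_mul]

section
open MeasureTheory

/-- By the mean value inequality `g` is `ε`-close to linear with slope `v = g' y`. One `ε` is lost
in this linearization and another in replacing `‖g' x‖` by `‖v‖`, whence `2 * ε`. -/
theorem hausdorffMeasure_image_near_lintegral {g g' : ℝ → ℂ} (hg : ∀ x, HasDerivAt g (g' x) x)
    {T I : Set ℝ} (hT : MeasurableSet T) (hTI : T ⊆ I) (hI : Convex ℝ I)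
    {ε : ℝ} (hε : 0 ≤ ε) (h : ∀ x ∈ I, ∀ y ∈ I, ‖g' x - g' y‖ ≤ ε) :
    μH[1] (g '' T) ≤ (∫⁻ x in T, ‖g' x‖ₑ) + ENNReal.ofReal (2 * ε) * volume T ∧
      (∫⁻ x in T, ‖g' x‖ₑ) ≤ μH[1] (g '' T) + ENNReal.ofReal (2 * ε) * volume T := by
  rcases T.eq_empty_or_nonempty with rfl | ⟨y, hy⟩
  · simp
  set v := g' y with hv
  have hnear : ∀ x ∈ T, ∀ z ∈ T, ‖g x - g z - (x - z : ℝ) • v‖ ≤ ε * |x - z| := by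
    intro x hx z hz
    have hd : ∀ t ∈ I, HasDerivWithinAt (fun t => g t - (t : ℝ) • v) (g' t - v) I t := by
      intro t _
      have h1 : HasDerivAt (fun t : ℝ => t • v) ((1 : ℝ) • v) t := (hasDerivAt_id t).smul_const v
      rw [one_smul] at h1
      exact ((hg t).sub h1).hasDerivWithinAt
    have := hI.norm_image_sub_le_of_norm_hasDerivWithin_le hd (fun t ht => h t ht y (hTI hy))
      (hTI hz) (hTI hx)
    rw [Real.norm_eq_abs] at this
    have e : g x - g z - (x - z) • v = g x - x • v - (g z - z • v) := by rw [sub_smul]; ring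
    rwa [e]
  have hup := hausdorffMeasure_image_le_of_near_linear hε hnear
  have hlow := le_hausdorffMeasure_image_of_near_linear hnear
  have hb : ∀ x ∈ T, |‖g' x‖ - ‖v‖| ≤ ε := fun x hx =>
    (abs_norm_sub_norm_le _ _).trans (h x (hTI hx) y (hTI hy))
  constructor
  · refine hup.trans ?_
    calc ENNReal.ofReal (‖v‖ + ε) * volume T = ∫⁻ _ in T, ENNReal.ofReal (‖v‖ + ε) := by
          rw [setLIntegral_const]
      _ ≤ ∫⁻ x in T, (‖g' x‖ₑ + ENNReal.ofReal (2 * ε)) := by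
          refine setLIntegral_mono' hT fun x hx => ?_
          rw [← ofReal_norm, ← ENNReal.ofReal_add (norm_nonneg _) (by positivity)]
          refine ENNReal.ofReal_le_ofReal ?_
          have := abs_le.1 (hb x hx)
          linarith
      _ = _ := by
          rw [lintegral_add_right _ measurable_const, setLIntegral_const]
  · calc (∫⁻ x in T, ‖g' x‖ₑ) ≤ ∫⁻ _ in T, (ENNReal.ofReal (‖v‖ - ε) + ENNReal.ofReal (2 * ε)) := by
          refine setLIntegral_mono' hT fun x hx => ?_
          rw [← ofReal_norm]
          have := abs_le.1 (hb x hx)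
          refine le_trans ?_ ENNReal.ofReal_add_le
          refine ENNReal.ofReal_le_ofReal ?_
          linarith
      _ = ENNReal.ofReal (‖v‖ - ε) * volume T + ENNReal.ofReal (2 * ε) * volume T := by
          rw [setLIntegral_const, add_mul]
      _ ≤ _ := by gcongr

/-- The one-dimensional Hausdorff measure of a piece of an injective `C¹` curve. -/
theorem hausdorffMeasure_image_eq_lintegral {g g' : ℝ → ℂ} (hg : ∀ x, HasDerivAt g (g' x) x)
    (hg' : Continuous g') {a b : ℝ} (hinj : Set.InjOn g (Set.Ico a b)) {A : Set ℝ}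
    (hA : MeasurableSet A) (hAI : A ⊆ Set.Ico a b) :
    μH[1] (g '' A) = ∫⁻ x in A, ‖g' x‖ₑ := by
  have hgc : Continuous g := continuous_iff_continuousAt.2 fun x => (hg x).continuousAt
  have hvol : volume A ≠ ⊤ := ((measure_mono hAI).trans_lt (by simp)).ne
  have key : ∀ ε : ℝ, 0 < ε →
      μH[1] (g '' A) ≤ (∫⁻ x in A, ‖g' x‖ₑ) + ENNReal.ofReal (2 * ε) * volume A ∧
      (∫⁻ x in A, ‖g' x‖ₑ) ≤ μH[1] (g '' A) + ENNReal.ofReal (2 * ε) * volume A := by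
    intro ε hε
    have huc : UniformContinuousOn g' (Set.Icc a b) :=
      isCompact_Icc.uniformContinuousOn_of_continuous hg'.continuousOn
    obtain ⟨δ, hδ, hδ'⟩ := Metric.uniformContinuousOn_iff.1 huc ε hε
    -- Cells of length `δ / 2`, so that `g'` oscillates by at most `ε` on each. The cell errors add
    -- up to `2 * ε * volume A`, which vanishes as `ε → 0`.
    set J : ℤ → Set ℝ := fun k => Set.Ico ((k : ℝ) * (δ / 2)) (((k : ℝ) + 1) * (δ / 2)) with hJ
    have hJdisj : Pairwise (Function.onFun Disjoint J) := by
      intro k l hkl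
      have h2 := Set.pairwise_disjoint_Ico_add_zsmul (0 : ℝ) (δ / 2) hkl
      simpa [hJ, Function.onFun, zsmul_eq_mul] using h2
    have hJun : ⋃ k, J k = Set.univ := by
      have h2 := iUnion_Ico_add_zsmul (show 0 < δ / 2 by linarith) (0 : ℝ)
      simpa [hJ, zsmul_eq_mul] using h2
    have hAk : ∀ k, MeasurableSet (A ∩ J k) := fun k => hA.inter measurableSet_Ico
    have hAu : A = ⋃ k, A ∩ J k := by rw [← Set.inter_iUnion, hJun, Set.inter_univ]
    have hAd : Pairwise (Function.onFun Disjoint fun k => A ∩ J k) := fun k l hkl =>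
      (hJdisj hkl).mono Set.inter_subset_right Set.inter_subset_right
    have hloc := fun k => hausdorffMeasure_image_near_lintegral hg (hAk k)
      (Set.inter_subset_inter (hAI.trans Set.Ico_subset_Icc_self) subset_rfl)
      ((convex_Icc a b).inter (convex_Ico _ _)) hε.le (by
        intro x hx y hy
        have h1 : dist x y < δ := by
          rw [Real.dist_eq, abs_lt]
          have hx2 := hx.2
          have hy2 := hy.2
          simp only [hJ, Set.mem_Ico] at hx2 hy2
          constructor <;> linarith
        have := hδ' x hx.1 y hy.1 h1
        rw [dist_eq_norm] at this
        exact this.le)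
    have hmu : μH[1] (g '' A) = ∑' k, μH[1] (g '' (A ∩ J k)) := by
      conv_lhs => rw [hAu, Set.image_iUnion]
      refine measure_iUnion ?_ fun k => ?_
      · intro k l hkl
        refine Set.disjoint_image_image ?_
        intro x hx y hy hxy
        have := hinj (hAI hx.1) (hAI hy.1) hxy
        subst this
        exact Set.disjoint_left.1 (hAd hkl) hx hy
      · exact (hAk k).image_of_continuousOn_injOn hgc.continuousOn
          (hinj.mono (Set.inter_subset_left.trans hAI))
    have h_int : (∫⁻ x in A, ‖g' x‖ₑ) = ∑' k, ∫⁻ x in A ∩ J k, ‖g' x‖ₑ := by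
      conv_lhs => rw [hAu]
      exact lintegral_iUnion hAk hAd _
    have hvolA : ENNReal.ofReal (2 * ε) * volume A
        = ∑' k, ENNReal.ofReal (2 * ε) * volume (A ∩ J k) := by
      conv_lhs => rw [hAu]
      rw [measure_iUnion hAd hAk, ENNReal.tsum_mul_left]
    rw [hmu, h_int, hvolA, ← ENNReal.tsum_add, ← ENNReal.tsum_add]
    exact ⟨ENNReal.tsum_le_tsum fun k => (hloc k).1, ENNReal.tsum_le_tsum fun k => (hloc k).2⟩
  have hlim : Filter.Tendsto (fun ε : ℝ => ENNReal.ofReal (2 * ε) * volume A) (𝓝[>] 0) (𝓝 0) := by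
    have h1 : Filter.Tendsto (fun ε : ℝ => ENNReal.ofReal (2 * ε)) (𝓝[>] 0) (𝓝 0) := by
      have : Continuous fun ε : ℝ => ENNReal.ofReal (2 * ε) :=
        ENNReal.continuous_ofReal.comp (by fun_prop)
      simpa using (this.tendsto 0).mono_left nhdsWithin_le_nhds
    rw [← zero_mul (volume A)]
    exact ENNReal.Tendsto.mul_const h1 (Or.inr hvol)
  refine le_antisymm ?_ ?_
  · refine ge_of_tendsto (x := 𝓝[>] (0 : ℝ)) (by rw [← add_zero (∫⁻ x in A, ‖g' x‖ₑ)]; exact hlim.const_add _) ?_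
    filter_upwards [self_mem_nhdsWithin] with ε hε using (key ε hε).1
  · refine ge_of_tendsto (x := 𝓝[>] (0 : ℝ)) (by rw [← add_zero (μH[1] (g '' A))]; exact hlim.const_add _) ?_
    filter_upwards [self_mem_nhdsWithin] with ε hε using (key ε hε).2

/-- Arc length on an injective `C¹` curve is the push-forward of `‖g'‖ dx`. -/
theorem hausdorffMeasure_restrict_image_eq_map {g g' : ℝ → ℂ} (hg : ∀ x, HasDerivAt g (g' x) x)
    (hg' : Continuous g') {a b : ℝ} (hinj : Set.InjOn g (Set.Ico a b)) :
    (μH[1] : Measure ℂ).restrict (g '' Set.Ico a b) =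
      ((volume.restrict (Set.Ico a b)).withDensity fun x => ‖g' x‖ₑ).map g := by
  have hgc : Continuous g := continuous_iff_continuousAt.2 fun x => (hg x).continuousAt
  ext B hB
  rw [Measure.restrict_apply hB, Measure.map_apply hgc.measurable hB,
    withDensity_apply _ (hgc.measurable hB), Measure.restrict_restrict (hgc.measurable hB),
    ← hausdorffMeasure_image_eq_lintegral hg hg' hinj ((hgc.measurable hB).inter measurableSet_Ico)
      Set.inter_subset_right, Set.inter_comm B, Set.inter_comm (g ⁻¹' B), Set.image_inter_preimage]

/-- Only `f ∘ g` is known to be continuous, not `f`. Changing variables through the measurable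
embedding that `g` induces on the half-open interval avoids any measurability requirement on `f`. -/
theorem integral_image_hausdorffMeasure {g g' : ℝ → ℂ} (hg : ∀ x, HasDerivAt g (g' x) x)
    (hg' : Continuous g') {a b : ℝ} (hab : a ≤ b) (hinj : Set.InjOn g (Set.Ico a b))
    {f : ℂ → ℝ} (hf : Continuous fun x => f (g x)) :
    IntegrableOn f (g '' Set.Ico a b) μH[1] ∧
      ∫ z in g '' Set.Ico a b, f z ∂μH[1] = ∫ x in a..b, ‖g' x‖ * f (g x) := by
  have hgc : Continuous g := continuous_iff_continuousAt.2 fun x => (hg x).continuousAt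
  have hemb : MeasurableEmbedding ((Set.Ico a b).domRestrict g) :=
    hgc.continuousOn.measurableEmbedding measurableSet_Ico hinj
  have hmap : (μH[1] : Measure ℂ).restrict (g '' Set.Ico a b) =
      ((((volume.restrict (Set.Ico a b)).withDensity fun x => ‖g' x‖ₑ).comap
        (Subtype.val : Set.Ico a b → ℝ))).map ((Set.Ico a b).domRestrict g) := by
    rw [hausdorffMeasure_restrict_image_eq_map hg hg' hinj]
    have : ((Set.Ico a b).domRestrict g) = g ∘ Subtype.val := rfl
    rw [this, ← Measure.map_map hgc.measurable measurable_subtype_coe,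
      (MeasurableEmbedding.subtype_coe measurableSet_Ico).map_comap, Subtype.range_coe]
    congr 1
    rw [restrict_withDensity measurableSet_Ico, Measure.restrict_restrict measurableSet_Ico,
      Set.inter_self]
  have hden : ((volume.restrict (Set.Ico a b)).withDensity fun x => ‖g' x‖ₑ) =
      (((volume.restrict (Set.Ico a b)).withDensity fun x => ‖g' x‖ₑ)).restrict (Set.Ico a b) := by
    rw [restrict_withDensity measurableSet_Ico, Measure.restrict_restrict measurableSet_Ico,
      Set.inter_self]
  have hmn : Measurable fun x => ‖g' x‖₊ := hg'.nnnorm.measurable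
  have h_int : Integrable (fun x => ‖g' x‖₊ • f (g x)) (volume.restrict (Set.Ico a b)) := by
    have hc : Continuous fun x => ‖g' x‖₊ • f (g x) := by
      simp only [NNReal.smul_def, coe_nnnorm]
      exact hg'.norm.smul hf
    exact (hc.integrableOn_Icc (a := a) (b := b)).mono_set Set.Ico_subset_Icc_self
  constructor
  · rw [IntegrableOn, hmap, hemb.integrable_map_iff]
    change Integrable ((f ∘ g) ∘ Subtype.val) _
    rw [← (MeasurableEmbedding.subtype_coe measurableSet_Ico).integrable_map_iff,
      (MeasurableEmbedding.subtype_coe measurableSet_Ico).map_comap, Subtype.range_coe, ← hden]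
    exact (integrable_withDensity_iff_integrable_smul hmn).2 h_int
  · rw [hmap, hemb.integral_map]
    change ∫ x : Set.Ico a b, (f ∘ g) x ∂_ = _
    rw [integral_subtype_comap measurableSet_Ico, ← hden]
    refine (integral_withDensity_eq_integral_smul hmn _).trans ?_
    rw [intervalIntegral.integral_of_le hab, ← integral_Ico_eq_integral_Ioc]
    rfl

end

/-! ### Circle integrals and the Cauchy–Pompeiu formula. -/

section
open MeasureTheory

/-- Differentiation under the integral sign for a jointly continuous derivative. -/
theorem hasDerivAt_intervalIntegral_of_continuousOn {E : Type*} [NormedAddCommGroup E]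
    [NormedSpace ℝ E] {F F' : ℝ → ℝ → E} {s : Set ℝ} (hs : IsOpen s)
    (hF : ∀ x ∈ s, ∀ θ, HasDerivAt (fun x => F x θ) (F' x θ) x)
    (hFc : ∀ x ∈ s, Continuous (F x))
    (hF' : ContinuousOn (Function.uncurry F') (s ×ˢ Set.univ)) {a b x₀ : ℝ} (hx₀ : x₀ ∈ s) :
    HasDerivAt (fun x => ∫ θ in a..b, F x θ) (∫ θ in a..b, F' x₀ θ) x₀ := by
  obtain ⟨r, hr, hrs⟩ := Metric.nhds_basis_closedBall.mem_iff.1 (hs.mem_nhds hx₀)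
  have hK : IsCompact (Metric.closedBall x₀ r ×ˢ Set.uIcc a b) :=
    (isCompact_closedBall _ _).prod isCompact_uIcc
  obtain ⟨C, hC⟩ := hK.exists_bound_of_continuousOn
    (hF'.mono (Set.prod_mono hrs (Set.subset_univ _)))
  have hF'c : Continuous (F' x₀) := by
    rw [← continuousOn_univ]
    exact hF'.comp (f := fun θ : ℝ => (x₀, θ)) (by fun_prop) fun θ _ => ⟨hx₀, trivial⟩
  refine (intervalIntegral.hasDerivAt_integral_of_dominated_loc_of_deriv_le
    (Metric.closedBall_mem_nhds x₀ hr) (bound := fun _ => C) (F := F) (F' := F') ?_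
    ((hFc x₀ hx₀).intervalIntegrable _ _) hF'c.aestronglyMeasurable ?_
    intervalIntegrable_const ?_).2
  · filter_upwards [hs.mem_nhds hx₀] with x hx using (hFc x hx).aestronglyMeasurable
  · refine Filter.Eventually.of_forall fun t ht x hx => hC (x, t) ⟨hx, Set.uIoc_subset_uIcc ht⟩
  · exact Filter.Eventually.of_forall fun t _ x hx => hF x (hrs hx) t

/-- The Cauchy–Riemann operator `∂/∂z̄`. -/
noncomputable def dbar (f : ℂ → ℂ) (z : ℂ) : ℂ :=
  (fderiv ℝ f z 1 + Complex.I * fderiv ℝ f z Complex.I) / 2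

/-- Write the real derivative as `v ↦ α v + β v̄`. The combination cancels the complex-linear part
and doubles the antilinear one, and `β` is `dbar f z`. -/
theorem fderiv_apply_add_I_mul (f : ℂ → ℂ) (z v : ℂ) :
    fderiv ℝ f z v + Complex.I * fderiv ℝ f z (Complex.I * v) =
      2 * (starRingEnd ℂ v) * dbar f z := by
  have h : ∀ w : ℂ, fderiv ℝ f z w = w.re * fderiv ℝ f z 1 + w.im * fderiv ℝ f z Complex.I := by
    intro w
    have e : w = w.re • (1 : ℂ) + w.im • Complex.I := by simp [Complex.re_add_im]
    conv_lhs => rw [e]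
    rw [map_add, map_smul, map_smul, Complex.real_smul, Complex.real_smul]
  rw [h v, h (Complex.I * v), dbar]
  have : (starRingEnd ℂ) v = v.re - v.im * Complex.I := by
    apply Complex.ext <;> simp
  rw [this]
  simp only [Complex.mul_re, Complex.I_re, Complex.I_im, Complex.mul_im]
  push_cast
  linear_combination ((v.im : ℂ) * fderiv ℝ f z Complex.I) * Complex.I_sq

theorem continuous_dbar {f : ℂ → ℂ} (hf : ContDiff ℝ 1 f) : Continuous (dbar f) := by
  have := hf.continuous_fderiv one_ne_zero
  unfold dbar
  fun_prop

/-- The radial derivative plus `i / r` times the angular derivative is `2 exp (-iθ) ∂f/∂z̄`, and the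
angular derivative integrates to zero around the circle. -/
theorem hasDerivAt_circle_integral {f : ℂ → ℂ} (hf : ContDiff ℝ 1 f) (z : ℂ) {r : ℝ} (hr : r ≠ 0) :
    HasDerivAt (fun r : ℝ => ∫ θ in (-Real.pi)..Real.pi, f (z + r * Complex.exp (θ * Complex.I)))
      (2 * ∫ θ in (-Real.pi)..Real.pi,
        Complex.exp (-(θ * Complex.I)) * dbar f (z + r * Complex.exp (θ * Complex.I))) r := by
  have hfd : Continuous (fderiv ℝ f) := hf.continuous_fderiv one_ne_zero
  have hdiff : Differentiable ℝ f := hf.differentiable one_ne_zero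
  have h1 := hasDerivAt_intervalIntegral_of_continuousOn (a := -Real.pi) (b := Real.pi) (x₀ := r)
    (F := fun r θ => f (z + r * Complex.exp (θ * Complex.I)))
    (F' := fun r θ => fderiv ℝ f (z + r * Complex.exp (θ * Complex.I)) (Complex.exp (θ * Complex.I)))
    isOpen_univ (by
      intro x _ θ
      have h2 : HasDerivAt (fun x : ℝ => z + x * Complex.exp (θ * Complex.I))
          (Complex.exp (θ * Complex.I)) x := by
        simpa using ((Complex.ofRealCLM.hasDerivAt (x := x)).mul_const
          (Complex.exp (θ * Complex.I))).const_add z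
      exact (hdiff _).hasFDerivAt.comp_hasDerivAt x h2)
    (by intro x _; have := hf.continuous; fun_prop)
    (by
      apply Continuous.continuousOn
      simp only [Function.uncurry_def]
      fun_prop) (Set.mem_univ r)
  have h3 : ∫ θ in (-Real.pi)..Real.pi, fderiv ℝ f (z + r * Complex.exp (θ * Complex.I))
      (Complex.I * (r * Complex.exp (θ * Complex.I))) = 0 := by
    have h4 : ∀ θ : ℝ, HasDerivAt (fun θ : ℝ => f (z + r * Complex.exp (θ * Complex.I)))
        (fderiv ℝ f (z + r * Complex.exp (θ * Complex.I))
          (Complex.I * (r * Complex.exp (θ * Complex.I)))) θ := by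
      intro θ
      have h2 : HasDerivAt (fun θ : ℝ => z + r * Complex.exp (θ * Complex.I))
          (Complex.I * (r * Complex.exp (θ * Complex.I))) θ := by
        have := ((((Complex.ofRealCLM.hasDerivAt (x := θ)).mul_const Complex.I).cexp).const_mul
          (r : ℂ)).const_add z
        refine this.congr_deriv ?_
        simp only [Complex.ofRealCLM_apply, Complex.ofReal_one]
        ring
      exact (hdiff _).hasFDerivAt.comp_hasDerivAt θ h2
    rw [intervalIntegral.integral_eq_sub_of_hasDerivAt (fun θ _ => h4 θ)]
    · simp
    · apply Continuous.intervalIntegrable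
      fun_prop
  refine h1.congr_deriv ?_
  symm
  have h5 : ∀ θ : ℝ, 2 * (Complex.exp (-(θ * Complex.I)) *
      dbar f (z + r * Complex.exp (θ * Complex.I))) =
      fderiv ℝ f (z + r * Complex.exp (θ * Complex.I)) (Complex.exp (θ * Complex.I)) +
      (Complex.I / r) * fderiv ℝ f (z + r * Complex.exp (θ * Complex.I))
      (Complex.I * (r * Complex.exp (θ * Complex.I))) := by
    intro θ
    have h6 := fderiv_apply_add_I_mul f (z + r * Complex.exp (θ * Complex.I))
      (Complex.exp (θ * Complex.I))
    have h7 : (starRingEnd ℂ) (Complex.exp (θ * Complex.I)) = Complex.exp (-(θ * Complex.I)) := by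
      rw [← Complex.exp_conj]; simp
    rw [h7] at h6
    have h8 : fderiv ℝ f (z + r * Complex.exp (θ * Complex.I))
        (Complex.I * (r * Complex.exp (θ * Complex.I))) =
        r * fderiv ℝ f (z + r * Complex.exp (θ * Complex.I))
        (Complex.I * Complex.exp (θ * Complex.I)) := by
      rw [show Complex.I * (r * Complex.exp (θ * Complex.I)) =
        r • (Complex.I * Complex.exp (θ * Complex.I)) by rw [Complex.real_smul]; ring, map_smul,
        Complex.real_smul]
    rw [← mul_assoc, ← h6, h8]
    have : (r : ℂ) ≠ 0 := by exact_mod_cast hr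
    field_simp
  rw [← intervalIntegral.integral_const_mul]
  simp only [h5]
  rw [intervalIntegral.integral_add, intervalIntegral.integral_const_mul, h3, mul_zero, add_zero]
  · apply Continuous.intervalIntegrable
    fun_prop
  · apply Continuous.intervalIntegrable
    fun_prop

theorem tendsto_circle_integral_zero {f : ℂ → ℂ}
    (hlim : Filter.Tendsto f (Filter.cocompact ℂ) (𝓝 0)) (z : ℂ) :
    Filter.Tendsto (fun r : ℝ => ∫ θ in (-Real.pi)..Real.pi,
      f (z + r * Complex.exp (θ * Complex.I))) Filter.atTop (𝓝 0) := by
  rw [NormedAddGroup.tendsto_nhds_zero]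
  intro ε hε
  have hpi := Real.pi_pos
  have h1 : ∀ᶠ w in Filter.cocompact ℂ, ‖f w‖ < ε / (4 * Real.pi) :=
    NormedAddGroup.tendsto_nhds_zero.1 hlim _ (by positivity)
  rw [← Metric.cobounded_eq_cocompact] at h1
  obtain ⟨R, -, hR⟩ := (Metric.hasBasis_cobounded_compl_closedBall (0 : ℂ)).eventually_iff.1 h1
  filter_upwards [Filter.eventually_gt_atTop (R + ‖z‖), Filter.eventually_gt_atTop 0] with r hr hr0
  have h2 : ∀ θ ∈ Set.uIoc (-Real.pi) Real.pi,
      ‖f (z + r * Complex.exp (θ * Complex.I))‖ ≤ ε / (4 * Real.pi) := by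
    intro θ _
    refine (hR ?_).le
    rw [Set.mem_compl_iff, mem_closedBall_zero_iff, not_le]
    have h3 : ‖(r : ℂ) * Complex.exp (θ * Complex.I)‖ = r := by
      rw [norm_mul, Complex.norm_exp_ofReal_mul_I, mul_one, Complex.norm_real, Real.norm_eq_abs,
        abs_of_pos hr0]
    have h4 := norm_sub_le (z + r * Complex.exp (θ * Complex.I)) z
    rw [add_sub_cancel_left, h3] at h4
    linarith
  refine (intervalIntegral.norm_integral_le_of_norm_le_const h2).trans_lt ?_
  rw [show Real.pi - -Real.pi = 2 * Real.pi by ring, abs_of_pos (by positivity)]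
  have : ε / (4 * Real.pi) * (2 * Real.pi) = ε / 2 := by field_simp; norm_num
  linarith

/-- The Cauchy–Pompeiu formula for functions vanishing at infinity. -/
theorem eq_integral_dbar_div {f : ℂ → ℂ} (hf : ContDiff ℝ 1 f) (hs : HasCompactSupport (dbar f))
    (hlim : Filter.Tendsto f (Filter.cocompact ℂ) (𝓝 0)) (z : ℂ) :
    ∫ w, dbar f w / (z - w) = Real.pi * f z := by
  set K : ℝ × ℝ → ℂ := fun p => Complex.exp (-(p.2 * Complex.I)) *
    dbar f (z + p.1 * Complex.exp (p.2 * Complex.I)) with hK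
  have hKc : Continuous K := by
    have := continuous_dbar hf
    fun_prop
  obtain ⟨R, hR⟩ := hs.isCompact.isBounded.subset_closedBall z
  have hK0 : ∀ r θ : ℝ, R < r → K (r, θ) = 0 := by
    intro r θ hr
    have : z + r * Complex.exp (θ * Complex.I) ∉ tsupport (dbar f) := by
      intro h
      have := hR h
      rw [Metric.mem_closedBall, dist_eq_norm, add_sub_cancel_left, norm_mul,
        Complex.norm_exp_ofReal_mul_I, mul_one, Complex.norm_real, Real.norm_eq_abs] at this
      exact absurd ((le_abs_self r).trans this) (not_le.2 hr)
    simp [hK, image_eq_zero_of_notMem_tsupport this]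
  have h1 : ∫ w, dbar f w / (z - w) = -∫ w, dbar f (z + w) / w := by
    rw [← integral_add_left_eq_self _ z, ← integral_neg]
    congr 1
    ext w
    rw [sub_add_cancel_left, div_neg]
  -- The polar Jacobian `r` cancels the modulus of `1 / w`, leaving the continuous integrand `K`,
  -- which vanishes for large `r`.
  have h2 : ∫ w, dbar f (z + w) / w = ∫ p in polarCoord.target, K p := by
    rw [← Complex.integral_comp_polarCoord_symm]
    refine setIntegral_congr_fun polarCoord.open_target.measurableSet fun p hp => ?_
    have hp1 : (0 : ℝ) < p.1 := hp.1
    have hp0 : (p.1 : ℂ) ≠ 0 := by exact_mod_cast hp1.ne'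
    have e : Complex.polarCoord.symm p = p.1 * Complex.exp (p.2 * Complex.I) := by
      rw [Complex.polarCoord_symm_apply, Complex.exp_mul_I]; push_cast; rfl
    simp only [e, hK, Complex.real_smul, Complex.exp_neg]
    have := Complex.exp_ne_zero (p.2 * Complex.I)
    field_simp
  have hKint : IntegrableOn K (Set.Ioi 0 ×ˢ Set.Ioo (-Real.pi) Real.pi) (volume.prod volume) := by
    have hc : IntegrableOn K (Set.Icc 0 R ×ˢ Set.Icc (-Real.pi) Real.pi) (volume.prod volume) :=
      hKc.continuousOn.integrableOn_compact (isCompact_Icc.prod isCompact_Icc)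
    refine hc.of_forall_sdiff_eq_zero (measurableSet_Ioi.prod measurableSet_Ioo) ?_
    rintro ⟨r, θ⟩ ⟨⟨hr, hθ⟩, hn⟩
    refine hK0 r θ ?_
    by_contra! hrR
    exact hn ⟨⟨le_of_lt hr, hrR⟩, Set.Ioo_subset_Icc_self hθ⟩
  have h3 : ∫ p in polarCoord.target, K p =
      ∫ r in Set.Ioi (0 : ℝ), ∫ θ in (-Real.pi)..Real.pi, K (r, θ) := by
    rw [polarCoord_target, Measure.volume_eq_prod, setIntegral_prod _ hKint]
    refine setIntegral_congr_fun measurableSet_Ioi fun r _ => ?_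
    rw [intervalIntegral.integral_of_le (by linarith [Real.pi_pos]), integral_Ioc_eq_integral_Ioo]
  have hKr : IntegrableOn (fun r => ∫ θ in (-Real.pi)..Real.pi, K (r, θ)) (Set.Ioi 0) := by
    have hc : Continuous (fun r => ∫ θ in (-Real.pi)..Real.pi, K (r, θ)) :=
      intervalIntegral.continuous_parametric_intervalIntegral_of_continuous' hKc _ _
    refine (hc.integrableOn_Icc (a := 0) (b := R)).of_forall_sdiff_eq_zero measurableSet_Ioi ?_
    rintro r ⟨hr, hn⟩
    have : R < r := by
      by_contra! h
      exact hn ⟨le_of_lt hr, h⟩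
    simp [hK0 r _ this]
  -- The radial integrand is the derivative of the circle integral of `f`, which runs from `2π f z`
  -- at radius `0` to `0` at infinity.
  have h4 := integral_Ioi_of_hasDerivAt_of_tendsto (a := 0)
    (f := fun r : ℝ => ∫ θ in (-Real.pi)..Real.pi, f (z + r * Complex.exp (θ * Complex.I)))
    (f' := fun r => 2 * ∫ θ in (-Real.pi)..Real.pi, K (r, θ)) (m := 0)
    (by
      apply Continuous.continuousWithinAt
      apply intervalIntegral.continuous_parametric_intervalIntegral_of_continuous'
      have := hf.continuous
      simp only [Function.uncurry_def]
      fun_prop)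
    (fun r hr => hasDerivAt_circle_integral hf z (ne_of_gt hr))
    (hKr.const_mul 2)
    (tendsto_circle_integral_zero hlim z)
  rw [integral_const_mul] at h4
  rw [h1, h2, h3]
  simp only [Complex.ofReal_zero, zero_mul, add_zero, intervalIntegral.integral_const,
    Complex.real_smul] at h4
  push_cast at h4
  linear_combination (-1 / 2 : ℂ) * h4

end

/-! ### Bounded holomorphic primitives of Cauchy transforms. -/

section
open MeasureTheory

/-- `g` has a bounded holomorphic primitive on `D`. -/
def HasBddPrimitive (g : ℂ → ℂ) (D : Set ℂ) : Prop :=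
  ∃ l : ℂ → ℂ, (∀ z ∈ D, HasDerivAt l (g z) z) ∧ ∃ C, ∀ z ∈ D, ‖l z‖ ≤ C

theorem HasBddPrimitive.zero (D : Set ℂ) : HasBddPrimitive (fun _ => 0) D :=
  ⟨fun _ => 0, fun z _ => hasDerivAt_const z 0, 0, by simp⟩

theorem HasBddPrimitive.add {g₁ g₂ : ℂ → ℂ} {D : Set ℂ} (h₁ : HasBddPrimitive g₁ D)
    (h₂ : HasBddPrimitive g₂ D) : HasBddPrimitive (fun z => g₁ z + g₂ z) D := by
  obtain ⟨l₁, hl₁, C₁, hC₁⟩ := h₁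
  obtain ⟨l₂, hl₂, C₂, hC₂⟩ := h₂
  exact ⟨fun z => l₁ z + l₂ z, fun z hz => (hl₁ z hz).add (hl₂ z hz), C₁ + C₂,
    fun z hz => (norm_add_le _ _).trans (add_le_add (hC₁ z hz) (hC₂ z hz))⟩

theorem HasBddPrimitive.const_mul {g : ℂ → ℂ} {D : Set ℂ} (h : HasBddPrimitive g D) (c : ℂ) :
    HasBddPrimitive (fun z => c * g z) D := by
  obtain ⟨l, hl, C, hC⟩ := h
  refine ⟨fun z => c * l z, fun z hz => (hl z hz).const_mul c, ‖c‖ * C, fun z hz => ?_⟩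
  rw [norm_mul]
  exact mul_le_mul_of_nonneg_left (hC z hz) (norm_nonneg _)

theorem HasBddPrimitive.congr {g₁ g₂ : ℂ → ℂ} {D : Set ℂ} (h : HasBddPrimitive g₁ D)
    (e : ∀ z ∈ D, g₁ z = g₂ z) : HasBddPrimitive g₂ D := by
  obtain ⟨l, hl, hC⟩ := h
  exact ⟨l, fun z hz => e z hz ▸ hl z hz, hC⟩

/-- The holomorphic function `log ((z - w) / (z - w'))` for `w` close to `w'`. -/
theorem hasDerivAt_log_one_sub_div {z w w' : ℂ} (h : 2 * ‖w - w'‖ ≤ ‖z - w'‖) (hz : z ≠ w') :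
    HasDerivAt (fun z => Complex.log (1 - (w - w') / (z - w'))) (1 / (z - w) - 1 / (z - w')) z ∧
      ‖Complex.log (1 - (w - w') / (z - w'))‖ ≤ 1 := by
  have h0 : z - w' ≠ 0 := sub_ne_zero.2 hz
  have hpos : 0 < ‖z - w'‖ := norm_pos_iff.2 h0
  -- This keeps the argument of the logarithm in a disc of radius `1/2` about `1`, where the
  -- principal branch is holomorphic and bounded.
  have hhalf : ‖-((w - w') / (z - w'))‖ ≤ 1 / 2 := by
    rw [norm_neg, norm_div, div_le_iff₀ hpos]; linarith
  have hzw : z - w ≠ 0 := by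
    intro e
    have : z - w' = w - w' := by rw [sub_eq_zero.1 e]
    rw [this] at h hpos
    linarith
  constructor
  · have hslit : 1 - (w - w') / (z - w') ∈ Complex.slitPlane := by
      rw [sub_eq_add_neg]
      exact Complex.mem_slitPlane_of_norm_lt_one (hhalf.trans_lt (by norm_num))
    have h1 : HasDerivAt (fun z => 1 - (w - w') / (z - w')) ((w - w') / (z - w') ^ 2) z := by
      have := (((hasDerivAt_const z (w - w')).div ((hasDerivAt_id z).sub_const w') h0)).const_sub 1
      refine this.congr_deriv ?_
      simp only [id]
      field_simp
      ring
    refine (h1.clog hslit).congr_deriv ?_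
    have : 1 - (w - w') / (z - w') = (z - w) / (z - w') := by field_simp; ring
    rw [this]
    field_simp
    ring
  · have := Complex.norm_log_one_add_half_le_self hhalf
    rw [← sub_eq_add_neg] at this
    linarith

theorem hasBddPrimitive_pole_sub_pole {D : Set ℂ} {w w' : ℂ} {δ : ℝ} (hδ : 0 < δ)
    (hD : ∀ z ∈ D, δ ≤ ‖z - w'‖) (h : 2 * ‖w - w'‖ ≤ δ) :
    HasBddPrimitive (fun z => 1 / (z - w) - 1 / (z - w')) D := by
  have key := fun z hz => hasDerivAt_log_one_sub_div (w := w) (h.trans (hD z hz)) (by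
    rintro rfl
    have := hD z hz
    simp at this
    linarith)
  exact ⟨_, fun z hz => (key z hz).1, 1, fun z hz => (key z hz).2⟩

theorem integrableOn_div_sub {ρ : ℂ → ℂ} (hρ : Integrable ρ) {T : Set ℂ} (hT : MeasurableSet T)
    {z : ℂ} {ε : ℝ} (hε : 0 < ε) (h : ∀ w ∈ T, ε ≤ ‖z - w‖) :
    IntegrableOn (fun w => ρ w / (z - w)) T := by
  refine (hρ.norm.restrict.mul_const ε⁻¹).mono'
    (hρ.aemeasurable.restrict.div (by fun_prop)).aestronglyMeasurable
    ((ae_restrict_iff' hT).2 (Filter.Eventually.of_forall fun w hw => ?_))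
  rw [norm_div, div_eq_mul_inv]
  exact mul_le_mul_of_nonneg_left (inv_anti₀ hε (h w hw)) (norm_nonneg _)

/-- The logarithms of `hasDerivAt_log_one_sub_div` are at most `1` in modulus, so they can be
integrated against `ρ` and differentiated under the integral; the primitive is bounded by the mass
of `ρ` on `T`. -/
theorem hasBddPrimitive_setIntegral_small {D : Set ℂ} (hDo : IsOpen D) {ρ : ℂ → ℂ}
    (hρ : Integrable ρ) {w' : ℂ} {δ : ℝ} (hδ : 0 < δ) (hD : ∀ z ∈ D, δ ≤ ‖z - w'‖)
    {T : Set ℂ} (hT : MeasurableSet T) (hTδ : ∀ w ∈ T, 2 * ‖w - w'‖ ≤ δ) :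
    HasBddPrimitive (fun z => (∫ w in T, ρ w / (z - w)) - (∫ w in T, ρ w) / (z - w')) D := by
  have key := fun z (hz : z ∈ D) w (hw : w ∈ T) =>
    hasDerivAt_log_one_sub_div (w := w) (z := z) (w' := w') ((hTδ w hw).trans (hD z hz)) (by
      rintro rfl
      have := hD z hz
      simp at this
      linarith)
  have hzw : ∀ z ∈ D, ∀ w ∈ T, δ / 2 ≤ ‖z - w‖ := by
    intro z hz w hw
    have h1 := hD z hz
    have h2 := hTδ w hw
    have h3 : ‖z - w'‖ ≤ ‖z - w‖ + ‖w - w'‖ := norm_sub_le_norm_sub_add_norm_sub z w w'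
    linarith
  have hmeas : ∀ z, AEStronglyMeasurable
      (fun w => ρ w * Complex.log (1 - (w - w') / (z - w'))) (volume.restrict T) := by
    intro z
    refine hρ.aestronglyMeasurable.restrict.mul (Measurable.aestronglyMeasurable ?_)
    exact Complex.measurable_log.comp (by fun_prop)
  have h_int : ∀ z ∈ D, Integrable (fun w => ρ w * Complex.log (1 - (w - w') / (z - w')))
      (volume.restrict T) := by
    intro z hz
    refine hρ.norm.restrict.mono' (hmeas z) ?_
    refine (ae_restrict_iff' hT).2 (Filter.Eventually.of_forall fun w hw => ?_)
    rw [norm_mul]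
    exact mul_le_of_le_one_right (norm_nonneg _) (key z hz w hw).2
  refine ⟨fun z => ∫ w in T, ρ w * Complex.log (1 - (w - w') / (z - w')), fun z hz => ?_,
    ∫ w in T, ‖ρ w‖, fun z hz => ?_⟩
  · have h1 := (hasDerivAt_integral_of_dominated_loc_of_deriv_le (μ := volume.restrict T)
      (F := fun z w => ρ w * Complex.log (1 - (w - w') / (z - w')))
      (F' := fun z w => ρ w * (1 / (z - w) - 1 / (z - w')))
      (bound := fun w => ‖ρ w‖ * (2 / δ + 1 / δ)) (hDo.mem_nhds hz)
      (Filter.Eventually.of_forall hmeas) (h_int z hz)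
      (hρ.aestronglyMeasurable.restrict.mul (Measurable.aestronglyMeasurable (by fun_prop)))
      ((ae_restrict_iff' hT).2 (Filter.Eventually.of_forall fun w hw x hx => by
        rw [norm_mul]
        refine mul_le_mul_of_nonneg_left ((norm_sub_le _ _).trans (add_le_add ?_ ?_))
          (norm_nonneg _)
        · rw [norm_div, norm_one, div_le_div_iff₀ (by have := hzw x hx w hw; linarith) hδ]
          have := hzw x hx w hw
          linarith
        · rw [norm_div, norm_one]
          exact one_div_le_one_div_of_le hδ (hD x hx)))
      (hρ.norm.restrict.mul_const _)
      ((ae_restrict_iff' hT).2 (Filter.Eventually.of_forall fun w hw x hx =>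
        (key x hx w hw).1.const_mul (ρ w))))
    refine h1.2.congr_deriv ?_
    have hi1 : Integrable (fun w => ρ w / (z - w)) (volume.restrict T) := by
      exact integrableOn_div_sub hρ hT (by linarith) (hzw z hz)
    simp only
    rw [← integral_div, ← integral_sub hi1 (hρ.restrict.div_const _)]
    congr 1
    ext w
    ring
  · refine (norm_integral_le_integral_norm _).trans
      (setIntegral_mono_on (h_int z hz).norm hρ.norm.restrict hT fun w hw => ?_)
    rw [norm_mul]
    exact mul_le_of_le_one_right (norm_nonneg _) (key z hz w hw).2

/-- A Cauchy transform has a primitive, up to a single pole, as soon as the differences of the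
poles involved have primitives. -/
theorem hasBddPrimitive_cauchyTransform {D : Set ℂ} (hDo : IsOpen D) {ρ : ℂ → ℂ}
    (hρ : Integrable ρ) {S : Set ℂ} (hS : IsCompact S) (hρS : ∀ w ∉ S, ρ w = 0) {w₀ : ℂ}
    (hdist : ∀ w ∈ S, ∃ δ > 0, ∀ z ∈ D, δ ≤ ‖z - w‖)
    (hpole : ∀ w ∈ S, HasBddPrimitive (fun z => 1 / (z - w) - 1 / (z - w₀)) D) :
    HasBddPrimitive (fun z => (∫ w, ρ w / (z - w)) - (∫ w, ρ w) / (z - w₀)) D := by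
  -- Induction over a compact set. Quantifying over every measurable `T` inside the open
  -- neighbourhood lets a union be cut into the disjoint pieces `T ∩ O₁` and `T \ O₁`.
  let p : Set ℂ → Prop := fun O => ∃ O', IsOpen O' ∧ O ⊆ O' ∧ ∀ T, MeasurableSet T → T ⊆ O' →
    HasBddPrimitive (fun z => (∫ w in T, ρ w / (z - w)) - (∫ w in T, ρ w) / (z - w₀)) D ∧
    ∀ z ∈ D, IntegrableOn (fun w => ρ w / (z - w)) T
  have hp : p S := by
    refine hS.induction_on (p := p) ?_ ?_ ?_ ?_
    · refine ⟨∅, isOpen_empty, subset_rfl, fun T _ hT => ?_⟩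
      rw [Set.subset_empty_iff.1 hT]
      simpa using HasBddPrimitive.zero D
    · rintro s t hst ⟨O, hO, htO, h⟩
      exact ⟨O, hO, hst.trans htO, h⟩
    · rintro s t ⟨O₁, hO₁, hs, h₁⟩ ⟨O₂, hO₂, ht, h₂⟩
      refine ⟨O₁ ∪ O₂, hO₁.union hO₂, Set.union_subset_union hs ht, fun T hT hTO => ?_⟩
      have hT₁ := h₁ (T ∩ O₁) (hT.inter hO₁.measurableSet) Set.inter_subset_right
      have hT₂ := h₂ (T \ O₁) (hT.diff hO₁.measurableSet) (fun w hw =>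
        (hTO hw.1).resolve_left hw.2)
      have hun : T = (T ∩ O₁) ∪ (T \ O₁) := (Set.inter_union_sdiff T O₁).symm
      have hdis : Disjoint (T ∩ O₁) (T \ O₁) :=
        Set.disjoint_left.2 fun w hw hw' => hw'.2 hw.2
      have hm : MeasurableSet (T \ O₁) := hT.diff hO₁.measurableSet
      refine ⟨(hT₁.1.add hT₂.1).congr fun z hz => ?_, fun z hz => ?_⟩
      · conv_rhs => rw [hun, setIntegral_union hdis hm (hT₁.2 z hz) (hT₂.2 z hz),
          setIntegral_union hdis hm hρ.integrableOn hρ.integrableOn]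
        ring
      · rw [hun]
        exact (hT₁.2 z hz).union (hT₂.2 z hz)
    · intro w hw
      obtain ⟨δ, hδ, hD⟩ := hdist w hw
      have hball : ∀ v ∈ Metric.ball w (δ / 2), 2 * ‖v - w‖ ≤ δ := by
        intro v hv
        rw [Metric.mem_ball, dist_eq_norm] at hv
        linarith
      refine ⟨Metric.ball w (δ / 2), mem_nhdsWithin_of_mem_nhds (Metric.ball_mem_nhds _ (by linarith)),
        Metric.ball w (δ / 2), Metric.isOpen_ball, subset_rfl, fun T hT hTO => ⟨?_, ?_⟩⟩
      · have h1 := hasBddPrimitive_setIntegral_small hDo hρ hδ hD hT fun v hv => hball v (hTO hv)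
        refine (h1.add ((hpole w hw).const_mul (∫ w in T, ρ w))).congr fun z _ => ?_
        ring
      · intro z hz
        refine integrableOn_div_sub hρ hT (show 0 < δ / 2 by linarith) fun v hv => ?_
        have h1 := hD z hz
        have h2 := hball v (hTO hv)
        have h3 : ‖z - w‖ ≤ ‖z - v‖ + ‖v - w‖ := norm_sub_le_norm_sub_add_norm_sub z v w
        linarith
  obtain ⟨O, hO, hSO, h⟩ := hp
  refine (h S hS.measurableSet hSO).1.congr fun z _ => ?_
  rw [setIntegral_eq_integral_of_forall_compl_eq_zero fun w hw => by rw [hρS w hw, zero_div],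
    setIntegral_eq_integral_of_forall_compl_eq_zero hρS]

end

/-! ### Geometry of the boundary curve. -/

namespace IsSmoothJordanBoundary

variable {Ω : Set ℂ} {γ : ℝ → ℂ}

theorem hasDerivAt (h : IsSmoothJordanBoundary Ω γ) (t : ℝ) : HasDerivAt γ (deriv γ t) t :=
  ((h.smooth.differentiable (by simp)) t).hasDerivAt

theorem continuous_deriv (h : IsSmoothJordanBoundary Ω γ) : Continuous (deriv γ) :=
  h.smooth.continuous_deriv (by simp)

theorem periodic_deriv (h : IsSmoothJordanBoundary Ω γ) : Function.Periodic (deriv γ) 1 := by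
  intro t
  rw [← deriv_comp_add_const]
  congr 1
  ext s
  exact h.periodic s

theorem isCompact_frontier (h : IsSmoothJordanBoundary Ω γ) : IsCompact (frontier Ω) := by
  rw [← h.range_eq]
  exact h.periodic.compact_of_continuous one_ne_zero h.smooth.continuous

theorem mem_frontier (h : IsSmoothJordanBoundary Ω γ) (t : ℝ) : γ t ∈ frontier Ω :=
  h.range_eq ▸ Set.mem_range_self t

theorem exists_int_of_eq (h : IsSmoothJordanBoundary Ω γ) {x y : ℝ} (hxy : γ x = γ y) :
    ∃ k : ℤ, x - y = k := by
  have hf : ∀ x : ℝ, γ (Int.fract x) = γ x := by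
    intro x
    have := h.periodic.sub_zsmul_eq (x := x) ⌊x⌋
    rwa [zsmul_eq_mul, mul_one] at this
  have : Int.fract x = Int.fract y := by
    refine h.injOn ⟨Int.fract_nonneg x, Int.fract_lt_one x⟩
      ⟨Int.fract_nonneg y, Int.fract_lt_one y⟩ ?_
    rw [hf, hf, hxy]
  exact Int.fract_eq_fract.1 this

/-- The chord–arc property. -/
theorem exists_chord_arc (h : IsSmoothJordanBoundary Ω γ) :
    ∃ c > 0, ∀ t v : ℝ, |v| ≤ 1 / 2 → c * |v| ≤ ‖γ (t + v) - γ t‖ := by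
  -- `D` is the difference quotient of `γ`, extended continuously by `γ'` at `v = 0`. Injectivity
  -- and regularity make it nonzero for `|v| ≤ 1/2`, and compactness of one period bounds it below.
  set D : ℝ → ℝ → ℂ := fun t v => ∫ u in (0 : ℝ)..1, deriv γ (t + u * v) with hD
  have hγ' := h.continuous_deriv
  have hDc : Continuous fun p : ℝ × ℝ => D p.1 p.2 :=
    intervalIntegral.continuous_parametric_intervalIntegral_of_continuous'
      (f := fun (p : ℝ × ℝ) u => deriv γ (p.1 + u * p.2))
      (by simp only [Function.uncurry_def]; fun_prop) _ _
  have hDeq : ∀ t v, v • D t v = γ (t + v) - γ t := by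
    intro t v
    have h1 : ∀ u ∈ Set.uIcc (0 : ℝ) 1,
        HasDerivAt (fun u : ℝ => γ (t + u * v)) (v • deriv γ (t + u * v)) u := by
      intro u _
      have h2 : HasDerivAt (fun u : ℝ => t + u * v) v u := by
        simpa using ((hasDerivAt_id u).mul_const v).const_add t
      exact (h.hasDerivAt (t + u * v)).scomp u h2
    have h3 := intervalIntegral.integral_eq_sub_of_hasDerivAt h1
      (Continuous.intervalIntegrable (by fun_prop) _ _)
    rw [intervalIntegral.integral_smul] at h3
    simpa using h3
  have hD0 : ∀ t v, |v| ≤ 1 / 2 → D t v ≠ 0 := by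
    intro t v hv h0
    rcases eq_or_ne v 0 with rfl | hv0
    · refine h.regular t ?_
      simpa [hD] using h0
    · have h1 := hDeq t v
      rw [h0, smul_zero] at h1
      obtain ⟨k, hk⟩ := h.exists_int_of_eq (sub_eq_zero.1 h1.symm)
      rw [add_sub_cancel_left] at hk
      rw [hk] at hv hv0
      have hk0 : k ≠ 0 := by rintro rfl; simp at hv0
      have : (1 : ℝ) ≤ |(k : ℝ)| := by exact_mod_cast Int.one_le_abs hk0
      linarith
  have hcomp : IsCompact (Set.Icc (0 : ℝ) 1 ×ˢ Set.Icc (-(1 / 2) : ℝ) (1 / 2)) :=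
    isCompact_Icc.prod isCompact_Icc
  obtain ⟨p, hp, hmin⟩ := hcomp.exists_isMinOn ⟨(0, 0), by norm_num⟩ hDc.norm.continuousOn
  refine ⟨‖D p.1 p.2‖, norm_pos_iff.2 (hD0 _ _ (abs_le.2 hp.2)), fun t v hv => ?_⟩
  have hper : ∀ s, γ (s + ⌊t⌋) = γ s := by
    intro s
    simpa using (h.periodic.zsmul ⌊t⌋) s
  have e : γ (t + v) - γ t = γ (Int.fract t + v) - γ (Int.fract t) := by
    rw [← hper (Int.fract t + v), ← hper (Int.fract t), Int.fract]
    congr 2 <;> ring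
  rw [e, ← hDeq, norm_smul, Real.norm_eq_abs, mul_comm]
  refine mul_le_mul_of_nonneg_left ?_ (abs_nonneg v)
  exact hmin (a := (Int.fract t, v))
    ⟨⟨Int.fract_nonneg t, (Int.fract_lt_one t).le⟩, abs_le.1 hv⟩

theorem exists_quadratic_bound (h : IsSmoothJordanBoundary Ω γ) :
    ∃ C > 0, ∀ t v : ℝ, ‖γ (t + v) - γ t - v • deriv γ t‖ ≤ C * v ^ 2 := by
  have h2 : ContDiff ℝ 1 (deriv γ) := by
    have : ContDiff ℝ (1 + 1) γ := h.smooth.of_le (by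
      rw [one_add_one_eq_two]; exact WithTop.coe_le_coe.2 le_top)
    exact (contDiff_succ_iff_deriv.1 this).2.2
  have hper : Function.Periodic (deriv (deriv γ)) 1 := by
    intro t
    rw [← deriv_comp_add_const]
    congr 1
    ext s
    exact h.periodic_deriv s
  obtain ⟨C, hC⟩ := isBounded_iff_forall_norm_le.1
    (hper.isBounded_of_continuous one_ne_zero (h2.continuous_deriv le_rfl))
  have hC0 : 0 ≤ C := (norm_nonneg _).trans (hC _ (Set.mem_range_self 0))
  have hlip : ∀ x y : ℝ, ‖deriv γ y - deriv γ x‖ ≤ C * |y - x| := by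
    intro x y
    exact convex_univ.norm_image_sub_le_of_norm_hasDerivWithin_le (f := deriv γ)
      (fun z _ => ((h2.differentiable one_ne_zero) z).hasDerivAt.hasDerivWithinAt)
      (fun z _ => hC _ (Set.mem_range_self z)) trivial trivial
  refine ⟨C + 1, by linarith, fun t v => ?_⟩
  have h3 := (convex_uIcc 0 v).norm_image_sub_le_of_norm_hasDerivWithin_le
    (f := fun u : ℝ => γ (t + u) - u • deriv γ t) (f' := fun u => deriv γ (t + u) - deriv γ t)
    (C := C * |v|) (x := 0) (y := v)
    (fun u _ => by
      have h4 : HasDerivAt (fun u : ℝ => γ (t + u)) (deriv γ (t + u)) u :=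
        (h.hasDerivAt (t + u)).comp_const_add t u
      have h5 : HasDerivAt (fun u : ℝ => u • deriv γ t) (deriv γ t) u := by
        simpa using (hasDerivAt_id u).smul_const (deriv γ t)
      exact (h4.sub h5).hasDerivWithinAt)
    (fun u hu => by
      refine (hlip t (t + u)).trans ?_
      rw [add_sub_cancel_left]
      refine mul_le_mul_of_nonneg_left ?_ hC0
      have := Set.abs_sub_left_of_mem_uIcc hu
      simpa using this)
    Set.left_mem_uIcc Set.right_mem_uIcc
  have e : γ (t + v) - v • deriv γ t - (γ (t + 0) - (0 : ℝ) • deriv γ t) =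
      γ (t + v) - γ t - v • deriv γ t := by simp; ring
  simp only [e] at h3
  refine h3.trans ?_
  rw [sub_zero, Real.norm_eq_abs, mul_assoc, abs_mul_abs_self]
  nlinarith [sq_nonneg v]

/-- Interior tangent discs: `Ω` contains a closed disc touching its boundary only at `γ t`. -/
theorem exists_tangent_disc (h : IsSmoothJordanBoundary Ω γ) (ho : IsOpen Ω) (t : ℝ) :
    ∃ r : ℝ, 0 < r ∧ Metric.closedBall (γ t + r * (-Complex.I * deriv γ t)) (r * ‖deriv γ t‖) \ {γ t} ⊆ Ω := by
  obtain ⟨c, hc, hca⟩ := h.exists_chord_arc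
  obtain ⟨C, hC, hq⟩ := h.exists_quadratic_bound
  set N : ℂ := -Complex.I * deriv γ t with hN
  have hNn : ‖N‖ = ‖deriv γ t‖ := by simp [hN]
  have hN0 : 0 < ‖N‖ := by rw [hNn]; exact norm_pos_iff.2 (h.regular t)
  -- With `d` a chord from `γ t`, `‖d - rN‖² = ‖d‖² - 2r⟨d, N⟩ + r²‖N‖²`. Here `‖d‖² ≥ c² v²`, while
  -- `⟨d, N⟩ ≤ C ‖N‖ v²` because `N` is orthogonal to `γ'`; so this choice of `r` keeps the rest of
  -- the curve off the disc.
  obtain ⟨r, hr, hrc⟩ : ∃ r > 0, 2 * r * (C * ‖N‖) < c ^ 2 := by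
    refine ⟨c ^ 2 / (4 * (C * ‖N‖)), by positivity, ?_⟩
    have : 2 * (c ^ 2 / (4 * (C * ‖N‖))) * (C * ‖N‖) = c ^ 2 / 2 := by
      field_simp; norm_num
    rw [this]
    have : 0 < c ^ 2 := by positivity
    linarith
  refine ⟨r, hr, ?_⟩
  rw [← hNn]
  have hfar : ∀ w ∈ frontier Ω, w ≠ γ t → r * ‖N‖ < ‖w - (γ t + r * N)‖ := by
    intro w hw hwt
    rw [← h.range_eq] at hw
    obtain ⟨s, rfl⟩ := hw
    set v : ℝ := (s - t) - round (s - t) with hv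
    have hv2 : |v| ≤ 1 / 2 := abs_sub_round (s - t)
    have hs : γ s = γ (t + v) := by
      have := h.periodic.sub_zsmul_eq (x := s) (round (s - t))
      rw [← this]
      congr 1
      simp [hv]
      ring
    have hv0 : v ≠ 0 := by
      intro h0
      rw [hs, h0, add_zero] at hwt
      exact hwt rfl
    rw [hs]
    set d := γ (t + v) - γ t with hd
    have h1 : c * |v| ≤ ‖d‖ := hca t v hv2
    have h2 : inner ℝ d N ≤ C * v ^ 2 * ‖N‖ := by
      have h3 : inner ℝ (v • deriv γ t) N = 0 := by
        rw [hN, real_inner_smul_left, Complex.inner]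
        simp
        right
        ring
      have h4 : inner ℝ d N = inner ℝ (d - v • deriv γ t) N := by
        rw [inner_sub_left d (v • deriv γ t) N, h3, sub_zero]
      rw [h4]
      exact (real_inner_le_norm _ _).trans (mul_le_mul_of_nonneg_right (hq t v) (norm_nonneg _))
    have e : γ (t + v) - (γ t + r * N) = d - r • N := by
      rw [hd, Complex.real_smul]; ring
    rw [e]
    refine lt_of_pow_lt_pow_left₀ 2 (norm_nonneg _) ?_
    rw [norm_sub_sq_real, inner_smul_right, norm_smul, Real.norm_eq_abs, abs_of_pos hr]
    have h5 : c ^ 2 * v ^ 2 ≤ ‖d‖ ^ 2 := by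
      rw [← sq_abs v, ← mul_pow]
      exact pow_le_pow_left₀ (by positivity) h1 2
    have h6 : 0 < v ^ 2 := by positivity
    nlinarith [mul_pos h6 (sub_pos.2 hrc), mul_le_mul_of_nonneg_left h2 hr.le]
  have hnt : γ t ∉ Metric.ball (γ t + r * N) (r * ‖N‖) := by
    rw [Metric.mem_ball, dist_eq_norm, sub_add_cancel_left, norm_neg, norm_mul, Complex.norm_real,
      Real.norm_eq_abs, abs_of_pos hr]
    exact lt_irrefl _
  have hconv : Convex ℝ (Metric.closedBall (γ t + r * N) (r * ‖N‖)) := convex_closedBall _ _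
  -- The closed disc without `γ t` lies between the open disc and its closure. Being connected,
  -- missing the frontier and meeting `Ω` along the normal, it lies in `Ω`.
  have hpre : IsPreconnected (Metric.closedBall (γ t + r * N) (r * ‖N‖) \ {γ t}) := by
    refine IsPreconnected.subset_closure (s := Metric.ball (γ t + r * N) (r * ‖N‖))
      (convex_ball _ _).isPreconnected ?_ ?_
    · intro w hw
      exact ⟨Metric.ball_subset_closedBall hw, fun hwt => hnt (hwt ▸ hw)⟩
    · rw [closure_ball _ (by positivity)]
      exact Set.sdiff_subset
  have hdisj : ∀ w ∈ Metric.closedBall (γ t + r * N) (r * ‖N‖) \ {γ t}, w ∉ frontier Ω := by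
    rintro w ⟨hw, hwt⟩ hwf
    have := hfar w hwf hwt
    rw [Metric.mem_closedBall, dist_eq_norm] at hw
    linarith
  obtain ⟨ε, ⟨hε1, -⟩, hε2⟩ := ((h.normal t).and (Ioo_mem_nhdsGT (show (0 : ℝ) < r from hr))).exists
  have hmem : γ t + ε * N ∈ Metric.closedBall (γ t + r * N) (r * ‖N‖) \ {γ t} := by
    constructor
    · rw [Metric.mem_closedBall, dist_eq_norm]
      have : γ t + ε * N - (γ t + r * N) = ((ε - r : ℝ) : ℂ) * N := by push_cast; ring
      rw [this, norm_mul, Complex.norm_real, Real.norm_eq_abs, abs_of_neg (by linarith [hε2.2])]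
      nlinarith [hε2.1]
    · simp only [Set.mem_singleton_iff, add_eq_left, mul_eq_zero, not_or]
      exact ⟨by exact_mod_cast hε2.1.ne', norm_pos_iff.1 hN0⟩
  refine hpre.subset_of_closure_inter_subset ho ⟨_, hmem, hε1⟩ ?_
  rintro x ⟨hx1, hx2⟩
  by_contra hx
  exact hdisj x hx2 ⟨hx1, by rwa [ho.interior_eq]⟩

/-- At a boundary point, the tangent disc is a convex subset of the closure with nonempty interior,
which is enough to determine derivatives. -/
theorem uniqueDiffOn_closure (h : IsSmoothJordanBoundary Ω γ) (ho : IsOpen Ω) :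
    UniqueDiffOn ℝ (closure Ω) := by
  intro z hz
  by_cases hzΩ : z ∈ Ω
  · exact (ho.uniqueDiffWithinAt hzΩ).mono subset_closure
  · have hzf : z ∈ frontier Ω := ⟨hz, by rwa [ho.interior_eq]⟩
    rw [← h.range_eq] at hzf
    obtain ⟨t, rfl⟩ := hzf
    obtain ⟨r, hr, hball⟩ := h.exists_tangent_disc ho t
    have hpos : 0 < r * ‖deriv γ t‖ := mul_pos hr (norm_pos_iff.2 (h.regular t))
    have hmem : γ t ∈ Metric.closedBall (γ t + r * (-Complex.I * deriv γ t)) (r * ‖deriv γ t‖) := by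
      rw [Metric.mem_closedBall, dist_eq_norm, sub_add_cancel_left]
      simp [abs_of_pos hr]
    have h1 := uniqueDiffOn_convex (convex_closedBall _ _)
      ⟨_, Metric.ball_subset_interior_closedBall (Metric.mem_ball_self hpos)⟩ (γ t) hmem
    refine h1.mono fun w hw => ?_
    by_cases e : w = γ t
    · rw [e]; exact hz
    · exact subset_closure (hball ⟨hw, e⟩)

end IsSmoothJordanBoundary

theorem hausdorffMeasure_image_Ico {g g' : ℝ → ℂ} (hg : ∀ x, HasDerivAt g (g' x) x)
    (hg' : Continuous g') {a b : ℝ} (hab : a ≤ b) (hinj : Set.InjOn g (Set.Ico a b)) :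
    μH[1] (g '' Set.Ico a b) = ENNReal.ofReal (∫ x in a..b, ‖g' x‖) := by
  rw [hausdorffMeasure_image_eq_lintegral hg hg' hinj measurableSet_Ico subset_rfl,
    intervalIntegral.integral_of_le hab, ← MeasureTheory.integral_Ico_eq_integral_Ioc]
  refine (MeasureTheory.ofReal_integral_norm_eq_lintegral_enorm ?_).symm
  exact (hg'.integrableOn_Icc (a := a) (b := b)).mono_set Set.Ico_subset_Icc_self

theorem IsSmoothJordanBoundary.curveLength_pos {Ω : Set ℂ} {γ : ℝ → ℂ}
    (h : IsSmoothJordanBoundary Ω γ) : 0 < curveLength (frontier Ω) := by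
  have h1 : frontier Ω = γ '' Set.Ico 0 1 := by
    rw [← h.range_eq]
    refine Set.Subset.antisymm ?_ (Set.image_subset_range _ _)
    rintro _ ⟨x, rfl⟩
    obtain ⟨y, hy, hxy⟩ := h.periodic.exists_mem_Ico₀ one_pos x
    exact ⟨y, hy, hxy.symm⟩
  have h2 : 0 < ∫ t in (0 : ℝ)..1, ‖deriv γ t‖ :=
    intervalIntegral.intervalIntegral_pos_of_pos
      (h.continuous_deriv.norm.intervalIntegrable _ _)
      (fun t => norm_pos_iff.2 (h.regular t)) one_pos
  rw [curveLength, h1, hausdorffMeasure_image_Ico h.hasDerivAt h.continuous_deriv zero_le_one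
    h.injOn, ENNReal.toReal_ofReal h2.le]
  exact h2

/-! ### Behaviour at infinity and topology of the sublevel sets. -/

namespace IsExteriorDirichlet

variable {Ω : Set ℂ} {γ : ℝ → ℂ} {U : ℂ → ℝ} {Φ φ₀ : ℝ}

/-- The exterior of a large disc is connected and misses the compact frontier, and it meets `Ω`
because `Ω` is unbounded. -/
theorem exists_exterior (h : IsExteriorDirichlet Ω γ U Φ φ₀) :
    ∃ R > 0, ∀ z : ℂ, R < ‖z‖ → z ∈ Ω := by
  obtain ⟨R, hR0, hR⟩ := h.boundary.isCompact_frontier.isBounded.exists_pos_norm_le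
  refine ⟨R, hR0, ?_⟩
  obtain ⟨z, hz, hzR⟩ : ∃ z ∈ Ω, R < ‖z‖ := by
    by_contra! hcon
    exact h.unbounded (isBounded_iff_forall_norm_le.2 ⟨R, hcon⟩)
  refine (Complex.isPreconnected_setOf_lt_norm hR0).subset_of_closure_inter_subset h.isOpen
    ⟨z, hzR, hz⟩ ?_
  rintro w ⟨hw, hwR⟩
  by_contra hwΩ
  have := hR w ⟨hw, by rwa [h.isOpen.interior_eq]⟩
  exact absurd hwR (not_lt.2 this)

theorem cocompact_le (h : IsExteriorDirichlet Ω γ U Φ φ₀) :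
    Filter.cocompact ℂ ≤ Filter.principal Ω := by
  obtain ⟨R, -, hR⟩ := h.exists_exterior
  rw [Filter.le_principal_iff]
  filter_upwards [(tendsto_norm_cocompact_atTop (E := ℂ)).eventually (Filter.eventually_gt_atTop R)]
    with z hz using hR z hz

theorem isEquivalent (h : IsExteriorDirichlet Ω γ U Φ φ₀) :
    Asymptotics.IsEquivalent (Filter.cocompact ℂ) U fun z => -(Φ / (2 * Real.pi)) *
      Real.log (2 * Real.pi * ‖z‖ / curveLength (frontier Ω)) := by
  have := h.asymptotics
  rwa [inf_eq_left.2 h.cocompact_le] at this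

theorem tendsto_log_atTop (h : IsExteriorDirichlet Ω γ U Φ φ₀) :
    Filter.Tendsto (fun z : ℂ => Real.log (2 * Real.pi * ‖z‖ / curveLength (frontier Ω)))
      (Filter.cocompact ℂ) Filter.atTop := by
  have hL := h.boundary.curveLength_pos
  refine Real.tendsto_log_atTop.comp ?_
  refine Filter.Tendsto.atTop_div_const hL ?_
  exact Filter.Tendsto.const_mul_atTop (by positivity) (tendsto_norm_cocompact_atTop)

theorem tendsto_atBot (h : IsExteriorDirichlet Ω γ U Φ φ₀) :
    Filter.Tendsto U (Filter.cocompact ℂ) Filter.atBot := by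
  refine h.isEquivalent.symm.tendsto_atBot ?_
  have hΦ := h.flux_pos
  have := Real.pi_pos
  exact Filter.Tendsto.const_mul_atTop_of_neg (by simp; positivity) h.tendsto_log_atTop

theorem continuousOn (h : IsExteriorDirichlet Ω γ U Φ φ₀) : ContinuousOn U (closure Ω) :=
  h.regular.continuousOn

theorem isCompact_superlevel (h : IsExteriorDirichlet Ω γ U Φ φ₀) (a : ℝ) :
    IsCompact {z ∈ closure Ω | a ≤ U z} := by
  have hcl : IsClosed {z ∈ closure Ω | a ≤ U z} :=
    h.continuousOn.preimage_isClosed_of_isClosed isClosed_closure isClosed_Ici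
  obtain ⟨K, hK, hKU⟩ := Filter.mem_cocompact.1
    (h.tendsto_atBot.eventually (Filter.eventually_lt_atBot a))
  refine hK.of_isClosed_subset hcl fun z hz => ?_
  by_contra hzK
  exact absurd (hKU hzK) (not_lt.2 hz.2)

theorem mem_frontier_of_notMem (h : IsExteriorDirichlet Ω γ U Φ φ₀) {z : ℂ} (hz : z ∈ closure Ω)
    (hzΩ : z ∉ Ω) : z ∈ frontier Ω := ⟨hz, by rwa [h.isOpen.interior_eq]⟩

theorem lt_boundaryValue (h : IsExteriorDirichlet Ω γ U Φ φ₀) : ∀ z ∈ Ω, U z < φ₀ := by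
  have hle : ∀ z ∈ Ω, U z ≤ φ₀ := by
    intro z hz
    by_contra! hlt
    -- The midpoint is strictly between `φ₀` and `U z`. Its superlevel set is compact, so inside a
    -- large ball the frontier of the truncated domain carries only smaller or equal values, and the
    -- maximum principle contradicts the value at `z`.
    have hK := h.isCompact_superlevel ((φ₀ + U z) / 2)
    obtain ⟨R, hR⟩ := hK.isBounded.subset_ball 0
    have hzR : z ∈ Metric.ball (0 : ℂ) R := hR ⟨subset_closure hz, by linarith⟩
    have h1 := InnerProductSpace.HarmonicOnNhd.le_of_forall_frontier_le (u := U)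
      (V := Ω ∩ Metric.ball 0 R) (M := (φ₀ + U z) / 2) (h.isOpen.inter Metric.isOpen_ball)
      (Metric.isBounded_ball.subset Set.inter_subset_right)
      (h.harmonic.mono Set.inter_subset_left)
      (h.continuousOn.mono (closure_mono Set.inter_subset_left)) ?_ z (subset_closure ⟨hz, hzR⟩)
    · linarith
    · intro w hw
      have hwc : w ∈ closure Ω := closure_mono Set.inter_subset_left hw.1
      by_cases hwΩ : w ∈ Ω
      · by_contra! hwU
        have hwR := hR ⟨hwc, hwU.le⟩
        have : w ∈ interior (Ω ∩ Metric.ball 0 R) := by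
          rw [(h.isOpen.inter Metric.isOpen_ball).interior_eq]; exact ⟨hwΩ, hwR⟩
        exact hw.2 this
      · rw [h.boundaryValue w (h.mem_frontier_of_notMem hwc hwΩ)]; linarith
  intro z hz
  refine lt_of_le_of_ne (hle z hz) fun heq => ?_
  -- If `φ₀` were attained inside, the set of such points would be relatively clopen in the
  -- connected `Ω`, which is impossible as `U → -∞`.
  have hsub : Ω ⊆ {w | w ∈ Ω ∧ U w = φ₀} := by
    refine h.isConnected.isPreconnected.subset_of_closure_inter_subset ?_ ⟨z, hz, hz, heq⟩ ?_
    · rw [isOpen_iff_mem_nhds]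
      rintro w ⟨hw, hwe⟩
      have hlm : IsLocalMax U w := by
        filter_upwards [h.isOpen.mem_nhds hw] with v hv
        exact (hle v hv).trans_eq hwe.symm
      filter_upwards [(h.harmonic w hw).eventually_eq_of_isLocalMax hlm, h.isOpen.mem_nhds hw]
        with v hv hvΩ
      exact ⟨hvΩ, hv.trans hwe⟩
    · rintro w ⟨hw, hwΩ⟩
      refine ⟨hwΩ, ?_⟩
      have hcl : IsClosed {v ∈ closure Ω | U v = φ₀} :=
        h.continuousOn.preimage_isClosed_of_isClosed isClosed_closure isClosed_singleton
      have : closure {w | w ∈ Ω ∧ U w = φ₀} ⊆ {v ∈ closure Ω | U v = φ₀} :=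
        closure_minimal (fun v hv => ⟨subset_closure hv.1, hv.2⟩) hcl
      exact (this hw).2
  obtain ⟨w, hw1, hw2⟩ := ((h.tendsto_atBot.eventually (Filter.eventually_lt_atBot φ₀)).and
    (Filter.le_principal_iff.1 h.cocompact_le)).exists
  exact hw1.ne (hsub hw2).2

theorem isOpen_sublevel (h : IsExteriorDirichlet Ω γ U Φ φ₀) (a : ℝ) :
    IsOpen {z ∈ Ω | U z < a} :=
  (h.continuousOn.mono subset_closure).isOpen_inter_preimage h.isOpen isOpen_Iio

/-- Points of `∂Ω` carry the value `φ₀ > a`, so this closure stays inside the open set `Ω`. -/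
theorem closure_sublevel_subset (h : IsExteriorDirichlet Ω γ U Φ φ₀) {a : ℝ} (ha : a < φ₀) :
    closure {z ∈ Ω | U z < a} ⊆ {z ∈ Ω | U z ≤ a} := by
  have hcl : IsClosed {z ∈ closure Ω | U z ≤ a} :=
    h.continuousOn.preimage_isClosed_of_isClosed isClosed_closure isClosed_Iic
  intro z hz
  have hsub : {z ∈ Ω | U z < a} ⊆ {z ∈ closure Ω | U z ≤ a} := fun v hv =>
    ⟨subset_closure hv.1, le_of_lt hv.2⟩
  have h1 : z ∈ {z ∈ closure Ω | U z ≤ a} := closure_minimal hsub hcl hz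
  refine ⟨?_, h1.2⟩
  by_contra hzΩ
  have h2 := h.boundaryValue z (h.mem_frontier_of_notMem h1.1 hzΩ)
  have h3 : U z ≤ a := h1.2
  linarith

/-- The sublevel sets of the potential are connected, by the maximum principle. -/
theorem isPreconnected_sublevel (h : IsExteriorDirichlet Ω γ U Φ φ₀) {a : ℝ} (ha : a < φ₀) :
    IsPreconnected {z ∈ Ω | U z < a} := by
  obtain ⟨R₁, hR₁, hext⟩ := h.exists_exterior
  obtain ⟨R₂, hR₂⟩ := (h.isCompact_superlevel a).isBounded.subset_closedBall 0
  set R := max R₁ R₂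
  have hR : 0 < R := lt_max_of_lt_left hR₁
  have hout : {z : ℂ | R < ‖z‖} ⊆ {z ∈ Ω | U z < a} := by
    intro z hz
    have hzΩ := hext z ((le_max_left _ _).trans_lt hz)
    refine ⟨hzΩ, ?_⟩
    by_contra! hcon
    have := hR₂ ⟨subset_closure hzΩ, hcon⟩
    rw [mem_closedBall_zero_iff] at this
    exact absurd ((le_max_right R₁ R₂).trans_lt hz) (not_lt.2 this)
  have hpre := Complex.isPreconnected_setOf_lt_norm hR
  -- In a separation, the part not containing a neighbourhood of infinity is bounded, and `U ≥ a` on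
  -- its frontier. The maximum principle for `-U` then gives `U ≥ a` inside, contrary to `U < a`.
  have key : ∀ u v : Set ℂ, IsOpen u → IsOpen v → {z ∈ Ω | U z < a} ⊆ u ∪ v →
      {z ∈ Ω | U z < a} ∩ (u ∩ v) = ∅ → {z : ℂ | R < ‖z‖} ⊆ u →
      ¬ ({z ∈ Ω | U z < a} ∩ v).Nonempty := by
    intro u v hu hv huv hdis hRu
    rintro ⟨x, hx, hxv⟩
    set V := {z ∈ Ω | U z < a} ∩ v with hV
    have hVo : IsOpen V := (h.isOpen_sublevel a).inter hv
    have hVb : Bornology.IsBounded V := by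
      refine isBounded_iff_forall_norm_le.2 ⟨R, fun z hz => ?_⟩
      by_contra! hcon
      have : z ∈ {z ∈ Ω | U z < a} ∩ (u ∩ v) := ⟨hz.1, hRu hcon, hz.2⟩
      rw [hdis] at this
      exact this
    have hcl : closure V ⊆ {z ∈ Ω | U z ≤ a} :=
      (closure_mono Set.inter_subset_left).trans (h.closure_sublevel_subset ha)
    have := InnerProductSpace.HarmonicOnNhd.le_of_forall_frontier_le (u := -U) (M := -a) hVo hVb
      ((h.harmonic.mono (fun z hz => hz.1.1)).neg)
      ((h.continuousOn.mono fun z hz => subset_closure (hcl hz).1).neg) ?_ x (subset_closure ⟨hx, hxv⟩)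
    · have h2 : U x < a := hx.2
      simp only [Pi.neg_apply] at this
      linarith
    · intro z hz
      simp only [Pi.neg_apply, neg_le_neg_iff]
      by_contra! hza
      have hzD : z ∈ {z ∈ Ω | U z < a} := ⟨(hcl hz.1).1, hza⟩
      rcases huv hzD with hzu | hzv
      · obtain ⟨y, hyu, hyV⟩ := mem_closure_iff.1 hz.1 u hu hzu
        have : y ∈ {z ∈ Ω | U z < a} ∩ (u ∩ v) := ⟨hyV.1, hyu, hyV.2⟩
        rw [hdis] at this
        exact this
      · exact hz.2 (by rw [hVo.interior_eq]; exact ⟨hzD, hzv⟩)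
  intro u v hu hv huv hnu hnv
  by_contra hcon
  rw [Set.not_nonempty_iff_eq_empty] at hcon
  by_cases hRu : {z : ℂ | R < ‖z‖} ⊆ u
  · exact key u v hu hv huv hcon hRu hnv
  · refine key v u hv hu (by rwa [Set.union_comm]) (by rwa [Set.inter_comm v u]) ?_ hnu
    by_contra hRv
    obtain ⟨z₁, hz₁, hz₁u⟩ := Set.not_subset.1 hRu
    obtain ⟨z₂, hz₂, hz₂v⟩ := Set.not_subset.1 hRv
    obtain ⟨z, hz, hzuv⟩ := hpre u v hu hv (hout.trans huv)
      ⟨z₂, hz₂, (huv (hout hz₂)).resolve_right hz₂v⟩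
      ⟨z₁, hz₁, (huv (hout hz₁)).resolve_left hz₁u⟩
    have : z ∈ {z ∈ Ω | U z < a} ∩ (u ∩ v) := ⟨hout hz, hzuv⟩
    rw [hcon] at this
    exact this

end IsExteriorDirichlet

/-! ### The complex gradient and Hopf's lemma. -/

/-- The complex gradient `U_x - i U_y` on `closure Ω`. -/
noncomputable def complexGradient (Ω : Set ℂ) (U : ℂ → ℝ) (z : ℂ) : ℂ :=
  fderivWithin ℝ U (closure Ω) z 1 - Complex.I * fderivWithin ℝ U (closure Ω) z Complex.I

section
variable {Ω : Set ℂ} {U : ℂ → ℝ}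

theorem fderivWithin_eq_re_complexGradient_mul (z v : ℂ) :
    fderivWithin ℝ U (closure Ω) z v = (complexGradient Ω U z * v).re := by
  have e : v = v.re • (1 : ℂ) + v.im • Complex.I := by simp [Complex.re_add_im]
  conv_lhs => rw [e]
  rw [map_add, map_smul, map_smul]
  simp [complexGradient]
  ring

theorem gradientWithin_eq_conj_complexGradient (z : ℂ) :
    gradientWithin U (closure Ω) z = starRingEnd ℂ (complexGradient Ω U z) := by
  refine ext_inner_right ℝ fun v => ?_
  rw [gradientWithin, InnerProductSpace.toDual_symm_apply, fderivWithin_eq_re_complexGradient_mul,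
    Complex.inner]
  simp
  ring

theorem fieldStrength_eq_norm (z : ℂ) : fieldStrength Ω U z = ‖complexGradient Ω U z‖ := by
  rw [fieldStrength, gradientWithin_eq_conj_complexGradient, RCLike.norm_conj]

theorem levelNormal_eq (z : ℂ) : levelNormal Ω U z =
    -((‖complexGradient Ω U z‖⁻¹ : ℝ) • starRingEnd ℂ (complexGradient Ω U z)) := by
  rw [levelNormal, fieldStrength_eq_norm, gradientWithin_eq_conj_complexGradient]

end

namespace IsExteriorDirichlet

variable {Ω : Set ℂ} {γ : ℝ → ℂ} {U : ℂ → ℝ} {Φ φ₀ : ℝ}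

theorem uniqueDiffOn (h : IsExteriorDirichlet Ω γ U Φ φ₀) : UniqueDiffOn ℝ (closure Ω) :=
  h.boundary.uniqueDiffOn_closure h.isOpen

theorem contDiffOn_complexGradient (h : IsExteriorDirichlet Ω γ U Φ φ₀) :
    ContDiffOn ℝ 1 (complexGradient Ω U) (closure Ω) := by
  have h1 : ContDiffOn ℝ 1 (fderivWithin ℝ U (closure Ω)) (closure Ω) :=
    h.regular.fderivWithin h.uniqueDiffOn (by norm_num)
  have h2 : ∀ v : ℂ, ContDiffOn ℝ 1 (fun z => ((fderivWithin ℝ U (closure Ω) z v : ℝ) : ℂ))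
      (closure Ω) := fun v =>
    Complex.ofRealCLM.contDiff.comp_contDiffOn (h1.clm_apply contDiffOn_const)
  exact (h2 1).sub (contDiffOn_const.mul (h2 Complex.I))

theorem hasFDerivWithinAt (h : IsExteriorDirichlet Ω γ U Φ φ₀) {z : ℂ} (hz : z ∈ closure Ω) :
    HasFDerivWithinAt U (fderivWithin ℝ U (closure Ω) z) (closure Ω) z :=
  ((h.regular.differentiableOn two_ne_zero) z hz).hasFDerivWithinAt

theorem closure_mem_nhds (h : IsExteriorDirichlet Ω γ U Φ φ₀) {z : ℂ} (hz : z ∈ Ω) :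
    closure Ω ∈ 𝓝 z := Filter.mem_of_superset (h.isOpen.mem_nhds hz) subset_closure

theorem differentiableAt_complexGradient (h : IsExteriorDirichlet Ω γ U Φ φ₀) {z : ℂ}
    (hz : z ∈ Ω) : DifferentiableAt ℂ (complexGradient Ω U) z := by
  refine (HarmonicAt.differentiableAt_complex_partial (h.harmonic z hz)).congr_of_eventuallyEq ?_
  filter_upwards [h.isOpen.mem_nhds hz] with w hw
  rw [complexGradient, fderivWithin_of_mem_nhds (h.closure_mem_nhds hw)]

/-- Hopf's boundary point lemma: the normal derivative does not vanish on the boundary. -/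
theorem normal_deriv_neg (h : IsExteriorDirichlet Ω γ U Φ φ₀) (t : ℝ) :
    fderivWithin ℝ U (closure Ω) (γ t) (-Complex.I * deriv γ t) < 0 := by
  obtain ⟨r, hr, hball⟩ := h.boundary.exists_tangent_disc h.isOpen t
  set N : ℂ := -Complex.I * deriv γ t with hN
  have hNn : ‖N‖ = ‖deriv γ t‖ := by simp [hN]
  rw [← hNn] at hball
  have hN0 : 0 < ‖N‖ := by rw [hNn]; exact norm_pos_iff.2 (h.boundary.regular t)
  set q : ℂ := γ t + r * N with hq
  set ρ : ℝ := r * ‖N‖ with hρ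
  have hρ0 : 0 < ρ := mul_pos hr hN0
  have hγt : ‖γ t - q‖ = ρ := by
    rw [hq, sub_add_cancel_left, norm_neg, norm_mul, Complex.norm_real, Real.norm_eq_abs,
      abs_of_pos hr]
  have hcb : Metric.closedBall q ρ ⊆ closure Ω := by
    intro w hw
    by_cases e : w = γ t
    · rw [e]; exact frontier_subset_closure (h.boundary.mem_frontier t)
    · exact subset_closure (hball ⟨hw, e⟩)
  have hin : ∀ w, ‖w - q‖ < ρ → w ∈ Ω := by
    intro w hw
    refine hball ⟨by rw [Metric.mem_closedBall, dist_eq_norm]; exact hw.le, ?_⟩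
    rintro rfl
    rw [hγt] at hw
    exact lt_irrefl _ hw
  have hsph : Metric.sphere q (ρ / 2) ⊆ Ω := by
    intro w hw
    rw [mem_sphere_iff_norm] at hw
    exact hin w (by rw [hw]; linarith)
  obtain ⟨w₀, hw₀, hmax⟩ := (isCompact_sphere q (ρ / 2)).exists_isMaxOn
    (NormedSpace.sphere_nonempty.2 (by positivity)) (h.continuousOn.mono (hsph.trans subset_closure))
  set m : ℝ := φ₀ - U w₀ with hm
  have hm0 : 0 < m := sub_pos.2 (h.lt_boundaryValue w₀ (hsph hw₀))
  -- The barrier on the annulus is `φ₀ + k log (‖w - q‖ / ρ)`. This `k` makes it equal to `φ₀ - m =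
  -- U w₀`, the maximum of `U`, on the inner circle of radius `ρ / 2`.
  set k : ℝ := m / Real.log 2 with hk
  have hlog2 : 0 < Real.log 2 := Real.log_pos (by norm_num)
  have hk0 : 0 < k := div_pos hm0 hlog2
  set A : Set ℂ := Metric.ball q ρ ∩ {w | ρ / 2 < ‖w - q‖} with hA
  have hAo : IsOpen A := Metric.isOpen_ball.inter (isOpen_lt continuous_const (by fun_prop))
  have hAc : closure A ⊆ {w | ‖w - q‖ ≤ ρ ∧ ρ / 2 ≤ ‖w - q‖} := by
    refine closure_minimal ?_ ?_
    · rintro w ⟨hw1, hw2⟩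
      rw [Metric.mem_ball, dist_eq_norm] at hw1
      exact ⟨hw1.le, le_of_lt hw2⟩
    · have hc : Continuous fun w : ℂ => ‖w - q‖ := by fun_prop
      exact (isClosed_le hc continuous_const).inter (isClosed_le continuous_const hc)
  have hbar : ∀ w ∈ closure A, U w - k * Real.log ‖w - q‖ ≤ φ₀ - k * Real.log ρ := by
    refine InnerProductSpace.HarmonicOnNhd.le_of_forall_frontier_le hAo
      (Metric.isBounded_ball.subset Set.inter_subset_left) ?_ ?_ ?_
    · intro w hw
      have hw1 : ‖w - q‖ < ρ := by simpa [dist_eq_norm] using hw.1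
      have hw2 : ρ / 2 < ‖w - q‖ := hw.2
      have hne : w - q ≠ 0 := norm_pos_iff.1 (by linarith)
      have h1 : InnerProductSpace.HarmonicAt (fun w => Real.log ‖w - q‖) w :=
        AnalyticAt.harmonicAt_log_norm (f := fun w => w - q) (by fun_prop) hne
      exact (h.harmonic w (hin w hw1)).sub (h1.const_smul (c := k))
    · refine ContinuousOn.sub (h.continuousOn.mono fun w hw => hcb ?_) ?_
      · rw [Metric.mem_closedBall, dist_eq_norm]; exact (hAc hw).1
      · refine continuousOn_const.mul (ContinuousOn.log (by fun_prop) fun w hw => ?_)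
        have := (hAc hw).2
        linarith
    · intro w hw
      have hw1 := hAc hw.1
      have hwΩ : w ∈ closure Ω := hcb (by rw [Metric.mem_closedBall, dist_eq_norm]; exact hw1.1)
      have hUle : U w ≤ φ₀ := by
        by_cases hwO : w ∈ Ω
        · exact (h.lt_boundaryValue w hwO).le
        · exact (h.boundaryValue w (h.mem_frontier_of_notMem hwΩ hwO)).le
      have hcase : ‖w - q‖ = ρ ∨ ‖w - q‖ = ρ / 2 := by
        by_contra! hcon
        refine hw.2 ?_
        rw [hAo.interior_eq]
        refine ⟨?_, lt_of_le_of_ne hw1.2 (Ne.symm hcon.2)⟩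
        rw [Metric.mem_ball, dist_eq_norm]
        exact lt_of_le_of_ne hw1.1 hcon.1
      rcases hcase with e | e
      · rw [e]; linarith
      · have h1 : U w ≤ U w₀ := hmax (mem_sphere_iff_norm.2 e)
        rw [e, Real.log_div hρ0.ne' two_ne_zero]
        have : k * Real.log 2 = m := by rw [hk]; field_simp
        nlinarith
  -- Along the normal the barrier is `φ₀ + k log ((r - ε) / r)`, and `log x ≤ x - 1` bounds its
  -- difference quotient by `-k / r`, uniformly in `ε`.
  have hbound : ∀ᶠ ε : ℝ in 𝓝[>] 0, (U (γ t + ε * N) - φ₀) / ε ≤ -(k / r) := by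
    filter_upwards [Ioo_mem_nhdsGT (show (0 : ℝ) < r / 2 by linarith)] with ε hε
    have e1 : ‖γ t + ε * N - q‖ = (r - ε) * ‖N‖ := by
      have : γ t + ε * N - q = -(((r - ε : ℝ) : ℂ) * N) := by rw [hq]; push_cast; ring
      rw [this, norm_neg, norm_mul, Complex.norm_real, Real.norm_eq_abs,
        abs_of_pos (by linarith [hε.2, hε.1])]
    have hmem : γ t + ε * N ∈ A := by
      constructor
      · rw [Metric.mem_ball, dist_eq_norm, e1, hρ]
        nlinarith [hε.1]
      · change ρ / 2 < ‖γ t + ε * N - q‖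
        rw [e1, hρ]
        nlinarith [hε.2]
    have h1 := hbar _ (subset_closure hmem)
    have hrε : 0 < r - ε := by linarith [hε.1, hε.2]
    rw [e1, hρ, Real.log_mul hrε.ne' hN0.ne', Real.log_mul hr.ne' hN0.ne'] at h1
    have h2 : Real.log ((r - ε) / r) ≤ (r - ε) / r - 1 := Real.log_le_sub_one_of_pos (by positivity)
    rw [Real.log_div hrε.ne' hr.ne'] at h2
    rw [div_le_iff₀ hε.1]
    have h3 : (r - ε) / r - 1 = -(ε / r) := by field_simp; ring
    rw [h3] at h2
    have h4 : k / r * ε = k * (ε / r) := by ring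
    nlinarith
  have hder : HasDerivWithinAt (fun ε : ℝ => U (γ t + ε * N))
      (fderivWithin ℝ U (closure Ω) (γ t) N) (Set.Icc 0 r) 0 := by
    have h0 : γ t + ((0 : ℝ) : ℂ) * N = γ t := by simp
    have h1 : HasFDerivWithinAt U (fderivWithin ℝ U (closure Ω) (γ t)) (closure Ω)
        (γ t + ((0 : ℝ) : ℂ) * N) := by
      rw [h0]
      exact h.hasFDerivWithinAt (frontier_subset_closure (h.boundary.mem_frontier t))
    have h2 : HasDerivWithinAt (fun ε : ℝ => γ t + ε * N) N (Set.Icc 0 r) 0 := by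
      simpa using (((Complex.ofRealCLM.hasDerivAt (x := (0 : ℝ))).mul_const N).const_add
        (γ t)).hasDerivWithinAt
    refine h1.comp_hasDerivWithinAt 0 h2 fun ε hε => hcb ?_
    rw [Metric.mem_closedBall, dist_eq_norm]
    have : γ t + ε * N - q = -(((r - ε : ℝ) : ℂ) * N) := by rw [hq]; push_cast; ring
    rw [this, norm_neg, norm_mul, Complex.norm_real, Real.norm_eq_abs,
      abs_of_nonneg (by linarith [hε.2]), hρ]
    nlinarith [hε.1]
  have hslope := (hasDerivWithinAt_iff_tendsto_slope' (s := Set.Ioc 0 r) (by simp)).1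
    (hder.mono Set.Ioc_subset_Icc_self)
  rw [nhdsWithin_Ioc_eq_nhdsGT hr] at hslope
  refine lt_of_le_of_lt (le_of_tendsto hslope ?_) (neg_neg_of_pos (div_pos hk0 hr))
  filter_upwards [hbound] with ε hε
  simpa [slope_def_field, h.boundaryValue _ (h.boundary.mem_frontier t)] using hε

theorem tangential_deriv_eq_zero (h : IsExteriorDirichlet Ω γ U Φ φ₀) (t : ℝ) :
    fderivWithin ℝ U (closure Ω) (γ t) (deriv γ t) = 0 := by
  have hmem : ∀ s, γ s ∈ closure Ω := fun s => frontier_subset_closure (h.boundary.mem_frontier s)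
  have h1 : HasDerivAt (U ∘ γ) (fderivWithin ℝ U (closure Ω) (γ t) (deriv γ t)) t :=
    (h.hasFDerivWithinAt (hmem t)).comp_hasDerivAt t (h.boundary.hasDerivAt t)
      (Filter.Eventually.of_forall hmem)
  have h2 : U ∘ γ = fun _ => φ₀ := funext fun s => h.boundaryValue _ (h.boundary.mem_frontier s)
  rw [h2] at h1
  exact h1.unique (hasDerivAt_const t φ₀)

theorem complexGradient_ne_zero_frontier (h : IsExteriorDirichlet Ω γ U Φ φ₀) {z : ℂ}
    (hz : z ∈ frontier Ω) : complexGradient Ω U z ≠ 0 := by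
  rw [← h.boundary.range_eq] at hz
  obtain ⟨t, rfl⟩ := hz
  intro h0
  have := h.normal_deriv_neg t
  rw [fderivWithin_eq_re_complexGradient_mul, h0] at this
  simp at this

/-- On the boundary the gradient is normal and points out of `Ω`. -/
theorem complexGradient_mul_normal (h : IsExteriorDirichlet Ω γ U Φ φ₀) (t : ℝ) :
    complexGradient Ω U (γ t) * (-Complex.I * deriv γ t) =
      -((‖complexGradient Ω U (γ t)‖ * ‖deriv γ t‖ : ℝ) : ℂ) := by
  set w := complexGradient Ω U (γ t) * (-Complex.I * deriv γ t) with hw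
  have h1 : w.re < 0 := by
    have := h.normal_deriv_neg t
    rwa [fderivWithin_eq_re_complexGradient_mul] at this
  have h2 : w.im = 0 := by
    have := h.tangential_deriv_eq_zero t
    rw [fderivWithin_eq_re_complexGradient_mul] at this
    have e : w = -Complex.I * (complexGradient Ω U (γ t) * deriv γ t) := by rw [hw]; ring
    rw [e]
    simp [this] at this ⊢
  have h3 : w = (w.re : ℂ) := Complex.ext rfl (by simpa using h2)
  have h4 : ‖w‖ = ‖complexGradient Ω U (γ t)‖ * ‖deriv γ t‖ := by simp [hw]
  have h5 : ‖w‖ = -w.re := by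
    conv_lhs => rw [h3]
    rw [Complex.norm_real, Real.norm_eq_abs, abs_of_neg h1]
  rw [← h4, h5]
  push_cast
  rw [neg_neg]
  exact h3

/-- On the boundary the gradient is purely normal, so the flux integrand is `E ds`. This is what
makes one turn of `γ` correspond to an angle of exactly `2π` in isothermal coordinates. -/
theorem integral_norm_complexGradient (h : IsExteriorDirichlet Ω γ U Φ φ₀) :
    ∫ t in (0 : ℝ)..1, ‖complexGradient Ω U (γ t)‖ * ‖deriv γ t‖ = Φ := by
  rw [← h.flux, ← intervalIntegral.integral_neg]
  congr 1
  ext t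
  rw [fderivWithin_eq_re_complexGradient_mul, h.complexGradient_mul_normal t, ← Complex.ofReal_neg,
    Complex.ofReal_re, neg_neg]

end IsExteriorDirichlet

/-! ### Decay of the gradient at infinity. -/

/-- The gradient estimate for bounded harmonic functions on a disc. -/
theorem InnerProductSpace.HarmonicOnNhd.norm_complex_partial_le {u : ℂ → ℝ} {z : ℂ} {R M : ℝ}
    (hR : 0 < R) (hM : 0 < M) (hu : InnerProductSpace.HarmonicOnNhd u (Metric.ball z R))
    (hb : ∀ w ∈ Metric.ball z R, |u w| ≤ M) :
    ‖(fderiv ℝ u z 1 : ℂ) - Complex.I * fderiv ℝ u z Complex.I‖ ≤ 10 * M / R := by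
  obtain ⟨f, hf, hfu⟩ := hu.exists_analyticOnNhd_ball_re_eq
  have hz : z ∈ Metric.ball z R := Metric.mem_ball_self hR
  have hmem : ∀ w ∈ Metric.ball (0 : ℂ) R, z + w ∈ Metric.ball z R := by
    intro w hw
    simpa using hw
  -- Removing the imaginary part at the centre gives `‖g 0‖ = |u z| ≤ M`. Borel–Carathéodory at
  -- radius `R / 2` then yields `2M + 3M`, and the Cauchy estimate on that circle `10M / R`.
  set g : ℂ → ℂ := fun w => f (z + w) - Complex.I * (f z).im with hg
  have hgd : ∀ w ∈ Metric.ball (0 : ℂ) R, DifferentiableAt ℂ g w := by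
    intro w hw
    have h1 : DifferentiableAt ℂ f (z + w) := (hf _ (hmem w hw)).differentiableAt
    exact (h1.comp w (by fun_prop : DifferentiableAt ℂ (fun w => z + w) w)).sub_const _
  have hgre : ∀ w ∈ Metric.ball (0 : ℂ) R, (g w).re = u (z + w) := by
    intro w hw
    rw [← hfu (hmem w hw)]
    simp [hg]
  have hg0 : ‖g 0‖ ≤ M := by
    have h1 : g 0 = ((u z : ℝ) : ℂ) := by
      apply Complex.ext
      · rw [hgre 0 (Metric.mem_ball_self hR)]; simp
      · simp [hg]
    rw [h1, Complex.norm_real]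
    exact hb z hz
  have hbc : ∀ w ∈ Metric.sphere (0 : ℂ) (R / 2), ‖g w‖ ≤ 5 * M := by
    intro w hw
    rw [mem_sphere_zero_iff_norm] at hw
    have hwR : w ∈ Metric.ball (0 : ℂ) R := by rw [mem_ball_zero_iff, hw]; linarith
    have h1 := Complex.borelCaratheodory hM
      (fun w hw => (hgd w hw).differentiableWithinAt)
      (fun w hw => by
        change (g w).re ≤ M
        rw [hgre w hw]
        exact (le_abs_self _).trans (hb _ (hmem w hw))) hR hwR
    refine h1.trans ?_
    rw [hw]
    have e1 : 2 * M * (R / 2) / (R - R / 2) = 2 * M := by field_simp; ring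
    have e2 : ‖g 0‖ * (R + R / 2) / (R - R / 2) = 3 * ‖g 0‖ := by field_simp; ring
    rw [e1, e2]
    linarith
  have hder := Complex.norm_deriv_le_of_forall_mem_sphere_norm_le (c := 0) (f := g)
    (half_pos hR) (DifferentiableOn.diffContOnCl (by
      rw [closure_ball _ (half_pos hR).ne']
      intro w hw
      refine (hgd w ?_).differentiableWithinAt
      rw [mem_closedBall_zero_iff] at hw
      rw [mem_ball_zero_iff]
      linarith)) hbc
  have hg' : deriv g 0 = deriv f z := by
    have h1 : HasDerivAt f (deriv f z) (z + 0) := by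
      rw [add_zero]; exact (hf z hz).differentiableAt.hasDerivAt
    exact ((h1.comp_const_add z 0).sub_const _).deriv
  have hfd : fderiv ℝ u z = Complex.reCLM.comp
      ((ContinuousLinearMap.toSpanSingleton ℂ (deriv f z)).restrictScalars ℝ) := by
    have h1 : HasFDerivAt f ((ContinuousLinearMap.toSpanSingleton ℂ (deriv f z)).restrictScalars ℝ) z :=
      ((hf z hz).differentiableAt.hasDerivAt.hasFDerivAt).restrictScalars ℝ
    have h2 := Complex.reCLM.hasFDerivAt.comp z h1
    refine (h2.congr_of_eventuallyEq ?_).fderiv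
    filter_upwards [Metric.isOpen_ball.mem_nhds hz] with w hw
    exact (hfu hw).symm
  have e : (fderiv ℝ u z 1 : ℂ) - Complex.I * fderiv ℝ u z Complex.I = deriv f z := by
    rw [hfd]
    apply Complex.ext <;> simp
  rw [e, ← hg']
  refine hder.trans (le_of_eq ?_)
  field_simp
  norm_num

namespace IsExteriorDirichlet

variable {Ω : Set ℂ} {γ : ℝ → ℂ} {U : ℂ → ℝ} {Φ φ₀ : ℝ}

theorem isLittleO_norm (h : IsExteriorDirichlet Ω γ U Φ φ₀) :
    U =o[Filter.cocompact ℂ] fun z => ‖z‖ := by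
  have hL := h.boundary.curveLength_pos
  have hpi := Real.pi_pos
  set b := 2 * Real.pi / curveLength (frontier Ω) with hb
  have hb0 : 0 < b := by positivity
  have h1 : Filter.Tendsto (fun z : ℂ => b * ‖z‖) (Filter.cocompact ℂ) Filter.atTop :=
    Filter.Tendsto.const_mul_atTop hb0 tendsto_norm_cocompact_atTop
  have h2 : (fun z : ℂ => Real.log (b * ‖z‖)) =o[Filter.cocompact ℂ] fun z => ‖z‖ :=
    (Real.isLittleO_log_id_atTop.comp_tendsto h1).trans_isBigO
      (Asymptotics.isBigO_const_mul_self b _ _)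
  refine h.isEquivalent.isBigO.trans_isLittleO ?_
  refine Asymptotics.IsLittleO.const_mul_left ?_ _
  refine h2.congr_left fun z => ?_
  rw [hb]
  congr 1
  ring

/-- `U` grows only logarithmically, so it is `o(‖z‖)`; the gradient estimate on the disc of radius
`‖z‖ / 2` turns this into `o(1)`. -/
theorem tendsto_complexGradient (h : IsExteriorDirichlet Ω γ U Φ φ₀) :
    Filter.Tendsto (complexGradient Ω U) (Filter.cocompact ℂ) (𝓝 0) := by
  obtain ⟨R₀, hR₀, hext⟩ := h.exists_exterior
  rw [NormedAddGroup.tendsto_nhds_zero]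
  intro ε hε
  have h1 := h.isLittleO_norm.def (show 0 < ε / 60 by linarith)
  rw [← Metric.cobounded_eq_cocompact] at h1 ⊢
  obtain ⟨R₁, -, hR₁⟩ := (Metric.hasBasis_cobounded_compl_closedBall (0 : ℂ)).eventually_iff.1 h1
  refine (Metric.hasBasis_cobounded_compl_closedBall (0 : ℂ)).eventually_iff.2
    ⟨2 * max R₀ R₁, trivial, fun z hz => ?_⟩
  rw [Set.mem_compl_iff, mem_closedBall_zero_iff, not_le] at hz
  have hz0 : 0 < ‖z‖ := by
    have := le_max_left R₀ R₁
    linarith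
  have hball : ∀ w ∈ Metric.ball z (‖z‖ / 2), max R₀ R₁ < ‖w‖ ∧ ‖w‖ ≤ 3 / 2 * ‖z‖ := by
    intro w hw
    rw [Metric.mem_ball, dist_eq_norm] at hw
    have h2 := norm_sub_norm_le z w
    have h3 := norm_sub_norm_le w z
    rw [norm_sub_rev] at h2
    constructor <;> linarith
  have hΩ : ∀ w ∈ Metric.ball z (‖z‖ / 2), w ∈ Ω := fun w hw =>
    hext w ((le_max_left _ _).trans_lt (hball w hw).1)
  have hzΩ : z ∈ Ω := hΩ z (Metric.mem_ball_self (by positivity))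
  have h4 := InnerProductSpace.HarmonicOnNhd.norm_complex_partial_le (u := U) (z := z)
    (R := ‖z‖ / 2) (M := ε / 60 * (3 / 2 * ‖z‖)) (by positivity) (by positivity)
    (h.harmonic.mono hΩ) (fun w hw => by
      have h5 := hR₁ (x := w) (by
        rw [Set.mem_compl_iff, mem_closedBall_zero_iff, not_le]
        exact (le_max_right _ _).trans_lt (hball w hw).1)
      rw [norm_norm, Real.norm_eq_abs] at h5
      refine h5.trans (mul_le_mul_of_nonneg_left (hball w hw).2 (by positivity)))
  rw [complexGradient, fderivWithin_of_mem_nhds (h.closure_mem_nhds hzΩ)]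
  refine h4.trans_lt ?_
  have : 10 * (ε / 60 * (3 / 2 * ‖z‖)) / (‖z‖ / 2) = ε / 2 := by field_simp; norm_num
  rw [this]
  linarith

end IsExteriorDirichlet

/-! ### A single-valued primitive of the complex gradient up to one pole. -/

/-- Two nearby poles differ by the derivative of a bounded logarithm. Thus the property is locally
constant in the position of the pole, which feeds the clopen arguments for moving poles. -/
theorem eventually_hasBddPrimitive_pole_iff {D : Set ℂ} {w w₀ : ℂ} (hw : w ∉ closure D) :
    ∀ᶠ v in 𝓝 w, (HasBddPrimitive (fun z => 1 / (z - v) - 1 / (z - w₀)) D ↔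
      HasBddPrimitive (fun z => 1 / (z - w) - 1 / (z - w₀)) D) := by
  obtain ⟨δ, hδ, hball⟩ := Metric.isOpen_iff.1 isClosed_closure.isOpen_compl w hw
  have hD : ∀ z ∈ D, δ ≤ ‖z - w‖ := by
    intro z hz
    by_contra! hlt
    exact hball (show z ∈ Metric.ball w δ by rwa [Metric.mem_ball, dist_eq_norm])
      (subset_closure hz)
  filter_upwards [Metric.ball_mem_nhds w (half_pos hδ)] with v hv
  rw [Metric.mem_ball, dist_eq_norm] at hv
  have h1 := hasBddPrimitive_pole_sub_pole hδ hD (w := v) (by linarith)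
  constructor
  · intro h2
    exact (h2.add (h1.const_mul (-1))).congr fun z _ => by ring
  · intro h2
    exact (h2.add h1).congr fun z _ => by ring

namespace IsExteriorDirichlet

variable {Ω : Set ℂ} {γ : ℝ → ℂ} {U : ℂ → ℝ} {Φ φ₀ : ℝ}

theorem notMem_closure_sublevel (h : IsExteriorDirichlet Ω γ U Φ φ₀) {a : ℝ} (ha : a < φ₀) {w : ℂ}
    (hw : a < U w) : w ∉ closure {z ∈ Ω | U z < a} := fun hw' =>
  absurd (h.closure_sublevel_subset ha hw').2 (not_le.2 hw)

/-- The good parameters form a clopen subset of the real line containing `0`, so a pole can be slid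
along the boundary curve. -/
theorem hasBddPrimitive_pole_frontier (h : IsExteriorDirichlet Ω γ U Φ φ₀) {a : ℝ} (ha : a < φ₀)
    (t : ℝ) : HasBddPrimitive (fun z => 1 / (z - γ t) - 1 / (z - γ 0)) {z ∈ Ω | U z < a} := by
  set T : Set ℝ := {t | HasBddPrimitive (fun z => 1 / (z - γ t) - 1 / (z - γ 0)) {z ∈ Ω | U z < a}}
    with hT
  have hloc : ∀ t, ∀ᶠ s in 𝓝 t, (s ∈ T ↔ t ∈ T) := by
    intro t
    have h1 : γ t ∉ closure {z ∈ Ω | U z < a} := h.notMem_closure_sublevel ha (by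
      rwa [h.boundaryValue _ (h.boundary.mem_frontier t)])
    exact (h.boundary.smooth.continuous.tendsto t).eventually
      (eventually_hasBddPrimitive_pole_iff h1)
  have hclopen : IsClopen T := by
    constructor
    · rw [← isOpen_compl_iff, isOpen_iff_mem_nhds]
      intro t ht
      filter_upwards [hloc t] with s hs hsT
      exact ht (hs.1 hsT)
    · rw [isOpen_iff_mem_nhds]
      intro t ht
      filter_upwards [hloc t] with s hs using hs.2 ht
  have h0 : (0 : ℝ) ∈ T := (HasBddPrimitive.zero _).congr fun z _ => by ring
  have ht : t ∈ T := hclopen.eq_univ ⟨0, h0⟩ ▸ Set.mem_univ t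
  exact ht

/-- The bad poles in `{U > a}` form a bounded open set `B`. A frontier point of `B` with `U > a`
would be a good pole, on `∂Ω` or inside, and local constancy would make the nearby points of `B`
good too. So `U ≤ a` on the frontier of `B`, and the maximum principle empties `B`. No knowledge of
the topology of the complement of `Ω` is needed. -/
theorem hasBddPrimitive_pole (h : IsExteriorDirichlet Ω γ U Φ φ₀) {a : ℝ} (ha : a < φ₀) {w : ℂ}
    (hw : w ∈ Ω) (hwa : a < U w) :
    HasBddPrimitive (fun z => 1 / (z - w) - 1 / (z - γ 0)) {z ∈ Ω | U z < a} := by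
  by_contra hcon
  set Q : ℂ → Prop := fun w =>
    HasBddPrimitive (fun z => 1 / (z - w) - 1 / (z - γ 0)) {z ∈ Ω | U z < a}
  set B : Set ℂ := {w | (w ∈ Ω ∧ a < U w) ∧ ¬ Q w} with hB
  have hloc : ∀ v, a < U v → ∀ᶠ y in 𝓝 v, (Q y ↔ Q v) := fun v hv =>
    eventually_hasBddPrimitive_pole_iff (h.notMem_closure_sublevel ha hv)
  have hUo : IsOpen {w | w ∈ Ω ∧ a < U w} :=
    (h.continuousOn.mono subset_closure).isOpen_inter_preimage h.isOpen isOpen_Ioi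
  have hBo : IsOpen B := by
    rw [isOpen_iff_mem_nhds]
    rintro v ⟨hv, hvQ⟩
    filter_upwards [hUo.mem_nhds hv, hloc v hv.2] with y hy hyQ
    exact ⟨hy, fun hy' => hvQ (hyQ.1 hy')⟩
  have hBsub : B ⊆ {z ∈ closure Ω | a ≤ U z} := fun v hv => ⟨subset_closure hv.1.1, hv.1.2.le⟩
  have hBc : closure B ⊆ {z ∈ closure Ω | a ≤ U z} :=
    closure_minimal hBsub (h.isCompact_superlevel a).isClosed
  have hle := InnerProductSpace.HarmonicOnNhd.le_of_forall_frontier_le (u := U) (M := a) hBo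
    ((h.isCompact_superlevel a).isBounded.subset hBsub) (h.harmonic.mono fun v hv => hv.1.1)
    (h.continuousOn.mono fun v hv => (hBc hv).1) ?_ w (subset_closure ⟨⟨hw, hwa⟩, hcon⟩)
  · linarith
  · intro y hy
    by_contra! hya
    have hyB : y ∉ B := fun hyB => hy.2 (by rwa [hBo.interior_eq])
    have hyQ : Q y := by
      by_cases hyΩ : y ∈ Ω
      · by_contra hyQ
        exact hyB ⟨⟨hyΩ, hya⟩, hyQ⟩
      · have := h.mem_frontier_of_notMem (hBc hy.1).1 hyΩ
        rw [← h.boundary.range_eq] at this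
        obtain ⟨t, rfl⟩ := this
        exact h.hasBddPrimitive_pole_frontier ha t
    obtain ⟨x, hx, hxB⟩ := mem_closure_iff_nhds.1 hy.1 _ (hloc y hya)
    exact hxB.2 (hx.2 hyQ)

theorem contDiffAt_complexGradient (h : IsExteriorDirichlet Ω γ U Φ φ₀) {z : ℂ} (hz : z ∈ Ω) :
    ContDiffAt ℝ 1 (complexGradient Ω U) z :=
  h.contDiffOn_complexGradient.contDiffAt (h.closure_mem_nhds hz)

/-- On sublevel sets the complex gradient is the derivative of a bounded holomorphic function, up
to a single pole outside `Ω`. -/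
theorem exists_hasBddPrimitive (h : IsExteriorDirichlet Ω γ U Φ φ₀) {a : ℝ} (ha : a < φ₀) :
    ∃ A : ℂ, HasBddPrimitive (fun z => complexGradient Ω U z - A / (z - γ 0)) {z ∈ Ω | U z < a} := by
  classical
  obtain ⟨a', haa', ha'⟩ := exists_between ha
  obtain ⟨b, hab, hb⟩ := exists_between ha'
  set F := complexGradient Ω U with hF
  -- `χ ∘ U` is `1` where `U ≤ a'` and `0` where `U ≥ b`. So the truncated gradient `G` equals `F`
  -- near `{U < a}`, vanishes near `∂Ω`, and is nonholomorphic only on the compact set `a' ≤ U ≤ b`.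
  set χ : ℝ → ℝ := fun x => 1 - Real.smoothTransition ((x - a') / (b - a')) with hχ
  have hχs : ContDiff ℝ 1 χ :=
    contDiff_const.sub (Real.smoothTransition.contDiff.comp (by fun_prop))
  have hχ1 : ∀ x ≤ a', χ x = 1 := fun x hx => by
    simp only [hχ]
    rw [Real.smoothTransition.zero_of_nonpos (div_nonpos_of_nonpos_of_nonneg (by linarith)
      (by linarith)), sub_zero]
  have hχ0 : ∀ x, b ≤ x → χ x = 0 := fun x hx => by
    simp only [hχ]
    rw [Real.smoothTransition.one_of_one_le ((one_le_div (by linarith)).2 (by linarith)), sub_self]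
  set G : ℂ → ℂ := fun z => if z ∈ Ω then (χ (U z) : ℂ) * F z else 0 with hG
  have hKcl : IsClosed {z ∈ closure Ω | U z ≤ b} :=
    h.continuousOn.preimage_isClosed_of_isClosed isClosed_closure isClosed_Iic
  have hKΩ : ∀ z ∈ closure Ω, U z ≤ b → z ∈ Ω := by
    intro z hz hzb
    by_contra hzΩ
    have := h.boundaryValue z (h.mem_frontier_of_notMem hz hzΩ)
    linarith
  have hG0 : ∀ z, z ∉ {z ∈ closure Ω | U z ≤ b} → G z = 0 := by
    intro z hz
    by_cases hzΩ : z ∈ Ω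
    · have : b ≤ U z := by
        by_contra! hlt
        exact hz ⟨subset_closure hzΩ, hlt.le⟩
      simp [hG, hχ0 _ this]
    · simp [hG, hzΩ]
  have hG0' : ∀ z, z ∉ {z ∈ closure Ω | U z ≤ b} → G =ᶠ[𝓝 z] fun _ => 0 := by
    intro z hz
    filter_upwards [hKcl.isOpen_compl.mem_nhds hz] with w hw using hG0 w hw
  have hGF : ∀ z ∈ Ω, U z < a' → G =ᶠ[𝓝 z] F := by
    intro z hz hza
    filter_upwards [(h.isOpen_sublevel a').mem_nhds ⟨hz, hza⟩] with w hw
    have hw2 : U w < a' := hw.2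
    simp [hG, hw.1, hχ1 _ hw2.le]
  have hGs : ContDiff ℝ 1 G := by
    rw [contDiff_iff_contDiffAt]
    intro z
    by_cases hz : z ∈ {z ∈ closure Ω | U z ≤ b}
    · have hzΩ := hKΩ z hz.1 hz.2
      have h1 : ContDiffAt ℝ 1 U z :=
        (h.regular.contDiffAt (h.closure_mem_nhds hzΩ)).of_le (by norm_num)
      have h2 : ContDiffAt ℝ 1 (fun z => (χ (U z) : ℂ) * F z) z :=
        (Complex.ofRealCLM.contDiff.contDiffAt.comp z (hχs.contDiffAt.comp z h1)).mul
          (h.contDiffAt_complexGradient hzΩ)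
      refine h2.congr_of_eventuallyEq ?_
      filter_upwards [h.isOpen.mem_nhds hzΩ] with w hw
      simp [hG, hw]
    · exact contDiffAt_const.congr_of_eventuallyEq (hG0' z hz)
  set S : Set ℂ := {z ∈ closure Ω | a' ≤ U z} ∩ {z ∈ closure Ω | U z ≤ b} with hS
  have hSc : IsCompact S := (h.isCompact_superlevel a').inter_right hKcl
  have hdbar : ∀ z ∉ S, dbar G z = 0 := by
    intro z hz
    by_cases hz' : z ∈ {z ∈ closure Ω | U z ≤ b}
    · have hzΩ := hKΩ z hz'.1 hz'.2
      have hza : U z < a' := by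
        by_contra! hge
        exact hz ⟨⟨hz'.1, hge⟩, hz'⟩
      have h1 := (h.differentiableAt_complexGradient hzΩ).hasFDerivAt.restrictScalars ℝ
      have h2 := (h1.congr_of_eventuallyEq (hGF z hzΩ hza)).fderiv
      rw [dbar, h2]
      have e : fderiv ℂ F z Complex.I = Complex.I * fderiv ℂ F z 1 := by
        rw [← smul_eq_mul, ← map_smul, smul_eq_mul, mul_one]
      simp only [ContinuousLinearMap.coe_restrictScalars']
      rw [e, ← mul_assoc, Complex.I_mul_I]
      ring
    · rw [dbar, (hG0' z hz').fderiv_eq]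
      simp
  have hsupp : HasCompactSupport (dbar G) := HasCompactSupport.intro hSc hdbar
  have hlim : Filter.Tendsto G (Filter.cocompact ℂ) (𝓝 0) := by
    refine h.tendsto_complexGradient.congr' ?_
    filter_upwards [h.tendsto_atBot.eventually (Filter.eventually_lt_atBot a'),
      Filter.le_principal_iff.1 h.cocompact_le] with z hz hzΩ
    exact ((hGF z hzΩ hz).eq_of_nhds).symm
  have hρ : MeasureTheory.Integrable (dbar G) :=
    (continuous_dbar hGs).integrable_of_hasCompactSupport hsupp
  have hpr := hasBddPrimitive_cauchyTransform (h.isOpen_sublevel a) hρ hSc hdbar (w₀ := γ 0)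
    (fun w hw => by
      have h1 := h.notMem_closure_sublevel ha (haa'.trans_le hw.1.2)
      obtain ⟨δ, hδ, hball⟩ := Metric.isOpen_iff.1 isClosed_closure.isOpen_compl w h1
      refine ⟨δ, hδ, fun z hz => ?_⟩
      by_contra! hlt
      exact hball (show z ∈ Metric.ball w δ by rwa [Metric.mem_ball, dist_eq_norm])
        (subset_closure hz))
    (fun w hw => h.hasBddPrimitive_pole ha (hKΩ w hw.2.1 hw.2.2) (haa'.trans_le hw.1.2))
  -- By Cauchy–Pompeiu, `π F` is the Cauchy transform of `dbar G` on `{U < a}`, so the residue is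
  -- the total mass of `dbar G` divided by `π`.
  refine ⟨(Real.pi : ℂ)⁻¹ * ∫ w, dbar G w, (hpr.const_mul (Real.pi : ℂ)⁻¹).congr fun z hz => ?_⟩
  have h1 := eq_integral_dbar_div hGs hsupp hlim z
  have hz2 : U z < a := hz.2
  rw [(hGF z hz.1 (hz2.trans haa')).eq_of_nhds] at h1
  rw [h1]
  have : (Real.pi : ℂ) ≠ 0 := by exact_mod_cast Real.pi_ne_zero
  field_simp

end IsExteriorDirichlet

theorem hasFDerivAt_re_of_hasDerivAt {f : ℂ → ℂ} {f' z : ℂ} (hf : HasDerivAt f f' z) :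
    HasFDerivAt (fun z => (f z).re) (Complex.reCLM.comp
      ((ContinuousLinearMap.toSpanSingleton ℂ f').restrictScalars ℝ)) z :=
  Complex.reCLM.hasFDerivAt.comp z (hf.hasFDerivAt.restrictScalars ℝ)

/-- The derivative of `log ‖z - w‖`. -/
theorem hasFDerivAt_log_norm_sub {z w : ℂ} (hz : z ≠ w) :
    HasFDerivAt (fun z => Real.log ‖z - w‖) (Complex.reCLM.comp
      ((ContinuousLinearMap.toSpanSingleton ℂ (1 / (z - w))).restrictScalars ℝ)) z := by
  have h0 : z - w ≠ 0 := sub_ne_zero.2 hz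
  have h1 : HasDerivAt (fun y => Complex.log ((y - w) / (z - w))) (1 / (z - w)) z := by
    have h2 : HasDerivAt (fun y => (y - w) / (z - w)) (1 / (z - w)) z :=
      ((hasDerivAt_id z).sub_const w).div_const _
    have h3 := h2.clog (by simp [div_self h0])
    refine h3.congr_deriv ?_
    rw [div_self h0, div_one]
  have h2 := (hasFDerivAt_re_of_hasDerivAt h1).add_const (Real.log ‖z - w‖)
  refine h2.congr_of_eventuallyEq ?_
  filter_upwards [isOpen_ne.mem_nhds hz] with y hy
  have hy0 : y - w ≠ 0 := sub_ne_zero.2 hy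
  rw [Complex.log_re, norm_div, Real.log_div (norm_ne_zero_iff.2 hy0) (norm_ne_zero_iff.2 h0)]
  ring

namespace IsExteriorDirichlet

variable {Ω : Set ℂ} {γ : ℝ → ℂ} {U : ℂ → ℝ} {Φ φ₀ : ℝ}

theorem hasFDerivAt (h : IsExteriorDirichlet Ω γ U Φ φ₀) {z : ℂ} (hz : z ∈ Ω) :
    HasFDerivAt U (Complex.reCLM.comp ((ContinuousLinearMap.toSpanSingleton ℂ
      (complexGradient Ω U z)).restrictScalars ℝ)) z := by
  have h1 := (h.hasFDerivWithinAt (subset_closure hz)).hasFDerivAt (h.closure_mem_nhds hz)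
  convert h1 using 1
  ext v
  rw [fderivWithin_eq_re_complexGradient_mul]
  simp [mul_comm]

theorem exists_exterior_sublevel (h : IsExteriorDirichlet Ω γ U Φ φ₀) (a : ℝ) :
    ∃ R > 0, ∀ z : ℂ, R < ‖z‖ → z ∈ Ω ∧ U z < a := by
  obtain ⟨R₁, hR₁, hext⟩ := h.exists_exterior
  obtain ⟨R₂, hR₂⟩ := (h.isCompact_superlevel a).isBounded.subset_closedBall 0
  refine ⟨max R₁ R₂, lt_max_of_lt_left hR₁, fun z hz => ?_⟩
  have hzΩ := hext z ((le_max_left _ _).trans_lt hz)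
  refine ⟨hzΩ, ?_⟩
  by_contra! hcon
  have := hR₂ ⟨subset_closure hzΩ, hcon⟩
  rw [mem_closedBall_zero_iff] at this
  exact absurd ((le_max_right R₁ R₂).trans_lt hz) (not_lt.2 this)

theorem gamma_notMem (h : IsExteriorDirichlet Ω γ U Φ φ₀) (t : ℝ) : γ t ∉ Ω := by
  have := (h.boundary.mem_frontier t).2
  rwa [h.isOpen.interior_eq] at this

/-- The logarithmic decomposition of the potential on a sublevel set. -/
theorem exists_log_decomposition (h : IsExteriorDirichlet Ω γ U Φ φ₀) {a : ℝ} (ha : a < φ₀) :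
    ∃ (l : ℂ → ℂ) (C B : ℝ),
      (∀ z ∈ Ω, U z < a →
        HasDerivAt l (complexGradient Ω U z + (Φ / (2 * Real.pi) : ℝ) / (z - γ 0)) z ∧ ‖l z‖ ≤ B ∧
        U z = (l z).re - Φ / (2 * Real.pi) * Real.log ‖z - γ 0‖ + C) := by
  obtain ⟨A, l, hl, B, hB⟩ := h.exists_hasBddPrimitive ha
  set D : Set ℂ := {z ∈ Ω | U z < a} with hD
  have hne : ∀ z ∈ D, z ≠ γ 0 := fun z hz e => h.gamma_notMem 0 (e ▸ hz.1)
  -- All that is left in the differential of `Y` is `-Im A` times the angular form `d arg (z - γ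
  -- 0)`.
  set Y : ℂ → ℝ := fun z => U z - (l z).re - A.re * Real.log ‖z - γ 0‖ with hY
  have hYd : ∀ z ∈ D, HasFDerivAt Y
      ((Complex.reCLM.comp ((ContinuousLinearMap.toSpanSingleton ℂ
        (complexGradient Ω U z)).restrictScalars ℝ)) -
        (Complex.reCLM.comp ((ContinuousLinearMap.toSpanSingleton ℂ
        (complexGradient Ω U z - A / (z - γ 0))).restrictScalars ℝ)) -
        A.re • (Complex.reCLM.comp
        ((ContinuousLinearMap.toSpanSingleton ℂ (1 / (z - γ 0))).restrictScalars ℝ))) z := by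
    intro z hz
    exact ((h.hasFDerivAt hz.1).sub (hasFDerivAt_re_of_hasDerivAt (hl z hz))).sub
      ((hasFDerivAt_log_norm_sub (hne z hz)).const_mul A.re)
  have hYv : ∀ z ∈ D, ∀ v, fderiv ℝ Y z v = -A.im * (v / (z - γ 0)).im := by
    intro z hz v
    rw [(hYd z hz).fderiv]
    have e : v * (A / (z - γ 0)) = A * (v / (z - γ 0)) := by ring
    have e2 : v * (1 / (z - γ 0)) = v / (z - γ 0) := by ring
    simp only [sub_apply, ContinuousLinearMap.comp_apply,
      smul_apply, ContinuousLinearMap.coe_restrictScalars',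
      ContinuousLinearMap.toSpanSingleton_apply, smul_eq_mul, mul_sub, e, e2, Complex.reCLM_apply,
      Complex.sub_re, Complex.mul_re]
    ring
  obtain ⟨R, hR, hext⟩ := h.exists_exterior_sublevel a
  -- On a large circle about `γ 0`, `Y` has constant angular derivative `-Im A` and returns to its
  -- starting value.
  have hAim : A.im = 0 := by
    set r : ℝ := R + ‖γ 0‖ + 1 with hr
    have hr0 : 0 < r := by positivity
    set c : ℝ → ℂ := fun θ => γ 0 + r * Complex.exp (θ * Complex.I) with hc
    have hcD : ∀ θ, c θ ∈ D := by
      intro θ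
      refine hext _ ?_
      have h3 : ‖(r : ℂ) * Complex.exp (θ * Complex.I)‖ = r := by
        rw [norm_mul, Complex.norm_exp_ofReal_mul_I, mul_one, Complex.norm_real, Real.norm_eq_abs,
          abs_of_pos hr0]
      have h4 := norm_sub_le (c θ) (γ 0)
      rw [hc] at h4
      simp only at h4
      rw [add_sub_cancel_left, h3] at h4
      linarith
    have hder : ∀ θ : ℝ, HasDerivAt (fun θ => Y (c θ)) (-A.im) θ := by
      intro θ
      have h2 : HasDerivAt c (Complex.I * (r * Complex.exp (θ * Complex.I))) θ := by
        have := ((((Complex.ofRealCLM.hasDerivAt (x := θ)).mul_const Complex.I).cexp).const_mul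
          (r : ℂ)).const_add (γ 0)
        refine this.congr_deriv ?_
        simp only [Complex.ofRealCLM_apply, Complex.ofReal_one]
        ring
      have h3 := ((hYd _ (hcD θ)).differentiableAt.hasFDerivAt).comp_hasDerivAt θ h2
      refine h3.congr_deriv ?_
      rw [hYv _ (hcD θ)]
      have hne' : (r : ℂ) * Complex.exp (θ * Complex.I) ≠ 0 :=
        mul_ne_zero (by exact_mod_cast hr0.ne') (Complex.exp_ne_zero _)
      have e : Complex.I * (r * Complex.exp (θ * Complex.I)) / (c θ - γ 0) = Complex.I := by
        simp only [hc, add_sub_cancel_left]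
        rw [mul_div_assoc, div_self hne', mul_one]
      rw [e]
      simp
    have h5 := intervalIntegral.integral_eq_sub_of_hasDerivAt (a := 0) (b := 2 * Real.pi)
      (fun θ _ => hder θ) intervalIntegrable_const
    have e : c (2 * Real.pi) = c 0 := by
      simp only [hc]
      push_cast
      rw [Complex.exp_two_pi_mul_I]
      simp
    rw [e, sub_self, intervalIntegral.integral_const, smul_eq_mul] at h5
    have hpi := Real.pi_pos
    rcases mul_eq_zero.1 h5 with h6 | h6 <;> linarith
  have hconst : ∃ C, ∀ z ∈ D, Y z = C := by
    refine (h.isOpen_sublevel a).exists_is_const_of_fderiv_eq_zero (𝕜 := ℝ)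
      (h.isPreconnected_sublevel ha)
      (fun z hz => (hYd z hz).differentiableAt.differentiableWithinAt) fun z hz => ?_
    ext v
    rw [hYv z hz, hAim]
    simp
  obtain ⟨C, hC⟩ := hconst
  -- `U` is `Re A` times the logarithm up to a bounded error. Comparison with the assumed
  -- equivalence at infinity identifies the coefficient, since the logarithm is unbounded.
  have hAre : A.re = -(Φ / (2 * Real.pi)) := by
    set g : ℂ → ℝ := fun z => Real.log (2 * Real.pi * ‖z‖ / curveLength (frontier Ω)) with hg
    have hgt : Filter.Tendsto g (Filter.cocompact ℂ) Filter.atTop := h.tendsto_log_atTop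
    have hpi := Real.pi_pos
    have hΦ := h.flux_pos
    have hL := h.boundary.curveLength_pos
    have h1 : (fun z => U z - -(Φ / (2 * Real.pi)) * g z) =o[Filter.cocompact ℂ] g :=
      h.isEquivalent.isLittleO.trans_isBigO (Asymptotics.isBigO_const_mul_self _ _ _)
    have h2 : (fun z => U z - A.re * g z) =o[Filter.cocompact ℂ] g := by
      have hbd : (fun z => U z - A.re * g z) =O[Filter.cocompact ℂ] fun _ => (1 : ℝ) := by
        set κ : ℝ := Real.log (2 * Real.pi / curveLength (frontier Ω)) with hκ
        refine Asymptotics.IsBigO.of_bound (B + |C| + |A.re| * (Real.log 2 + |κ|)) ?_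
        filter_upwards [(tendsto_norm_cocompact_atTop (E := ℂ)).eventually
          (Filter.eventually_gt_atTop (max R (2 * ‖γ 0‖)))] with z hz
        have hzD : z ∈ D := hext z ((le_max_left _ _).trans_lt hz)
        have hzγ : 2 * ‖γ 0‖ < ‖z‖ := (le_max_right _ _).trans_lt hz
        have hz0 : 0 < ‖z‖ := hR.trans ((le_max_left _ _).trans_lt hz)
        have h3 := norm_sub_norm_le z (γ 0)
        have h4 := norm_sub_le z (γ 0)
        have h5 : 0 < ‖z - γ 0‖ := by linarith
        have hlog : |Real.log ‖z - γ 0‖ - Real.log ‖z‖| ≤ Real.log 2 := by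
          rw [abs_le]
          constructor
          · have := Real.log_le_log (by positivity) (show ‖z‖ / 2 ≤ ‖z - γ 0‖ by linarith)
            rw [Real.log_div hz0.ne' two_ne_zero] at this
            linarith
          · have := Real.log_le_log h5 (show ‖z - γ 0‖ ≤ 2 * ‖z‖ by linarith)
            rw [Real.log_mul two_ne_zero hz0.ne'] at this
            linarith
        have hgz : g z = κ + Real.log ‖z‖ := by
          rw [hg, hκ, ← Real.log_mul (by positivity) hz0.ne']
          simp only
          congr 1
          ring
        have hYz := hC z hzD
        simp only [hY] at hYz
        have e : U z - A.re * g z = (l z).re + C +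
            A.re * ((Real.log ‖z - γ 0‖ - Real.log ‖z‖) - κ) := by
          rw [hgz]; linarith
        have h6 : |(l z).re| ≤ B := (Complex.abs_re_le_norm _).trans (hB z hzD)
        rw [Real.norm_eq_abs, e, norm_one, mul_one]
        calc _ ≤ |(l z).re| + |C| + |A.re * ((Real.log ‖z - γ 0‖ - Real.log ‖z‖) - κ)| :=
              abs_add_three _ _ _
          _ ≤ B + |C| + |A.re| * (Real.log 2 + |κ|) := by
              rw [abs_mul]
              have := (abs_sub (Real.log ‖z - γ 0‖ - Real.log ‖z‖) κ).trans
                (add_le_add hlog le_rfl)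
              gcongr
      refine hbd.trans_isLittleO ?_
      rw [Asymptotics.isLittleO_const_left]
      right
      exact tendsto_norm_atTop_atTop.comp hgt
    have h3 : (fun z => (A.re - -(Φ / (2 * Real.pi))) * g z) =o[Filter.cocompact ℂ] g :=
      (h1.sub h2).congr_left fun z => by ring
    by_contra hcon
    have h4 := (Asymptotics.isLittleO_const_mul_left_iff (sub_ne_zero.2 hcon)).1 h3
    obtain ⟨z, hz1, hz2⟩ := ((h4.def (show (0 : ℝ) < 1 / 2 by norm_num)).and
      (hgt.eventually (Filter.eventually_gt_atTop 0))).exists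
    rw [Real.norm_eq_abs, abs_of_pos hz2] at hz1
    linarith
  have hA : A = ((-(Φ / (2 * Real.pi)) : ℝ) : ℂ) := 
    Complex.ext (by rw [Complex.ofReal_re, hAre]) (by rw [Complex.ofReal_im, hAim])
  refine ⟨l, C, B, fun z hz hza => ⟨?_, hB z ⟨hz, hza⟩, ?_⟩⟩
  · refine (hl z ⟨hz, hza⟩).congr_deriv ?_
    rw [hA]
    push_cast
    ring
  · have := hC z ⟨hz, hza⟩
    simp only [hY, hAre] at this
    linarith

end IsExteriorDirichlet

/-! ### The uniformizing map and its injectivity near infinity. -/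

theorem HasStrictDerivAt.exists_injOn {f : ℂ → ℂ} {f' z : ℂ} (hf : HasStrictDerivAt f f' z)
    (hf' : f' ≠ 0) : ∃ s ∈ 𝓝 z, Set.InjOn f s := by
  have h1 := hf.hasStrictFDerivAt_equiv hf'
  exact ⟨_, (h1.toOpenPartialHomeomorph f).open_source.mem_nhds h1.mem_toOpenPartialHomeomorph_source,
    (h1.toOpenPartialHomeomorph f).injOn⟩

/-- A holomorphic function with a simple pole at infinity is injective near infinity. -/
theorem exists_injOn_exterior {g : ℂ → ℂ} {w₀ : ℂ} {R B : ℝ} (hR : 0 < R)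
    (hg : ∀ z, R < ‖z‖ → DifferentiableAt ℂ g z) (hB : ∀ z, R < ‖z‖ → ‖g z‖ ≤ B) :
    ∃ R' ≥ R, Set.InjOn (fun z => (z - w₀) * Complex.exp (g z)) {z : ℂ | R' < ‖z‖} := by
  set r : ℝ := (R + 2 * ‖w₀‖)⁻¹ with hr
  have hr0 : 0 < r := by positivity
  have hpt : ∀ ξ ∈ Metric.ball (0 : ℂ) r \ {0}, R < ‖ξ⁻¹‖ ∧ ‖w₀ * ξ‖ ≤ 1 / 2 := by
    rintro ξ ⟨h1, h2⟩
    have hξ : 0 < ‖ξ‖ := norm_pos_iff.2 h2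
    rw [mem_ball_zero_iff, hr, lt_inv_comm₀ hξ (by positivity)] at h1
    rw [norm_inv, norm_mul]
    have hw := norm_nonneg w₀
    refine ⟨by linarith, ?_⟩
    have h3 : 2 * ‖w₀‖ ≤ ‖ξ‖⁻¹ := by linarith
    calc ‖w₀‖ * ‖ξ‖ ≤ (‖ξ‖⁻¹ / 2) * ‖ξ‖ := by gcongr; linarith
      _ = 1 / 2 := by field_simp
  have hden : ∀ ξ ∈ Metric.ball (0 : ℂ) r \ {0}, 1 / 2 ≤ ‖1 - w₀ * ξ‖ ∧ ‖1 - w₀ * ξ‖ ≤ 3 / 2 := by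
    intro ξ hξ
    have h1 := (hpt ξ hξ).2
    have h2 := norm_sub_norm_le (1 : ℂ) (w₀ * ξ)
    have h3 := norm_sub_le (1 : ℂ) (w₀ * ξ)
    rw [norm_one] at h2 h3
    constructor <;> linarith
  -- In the coordinate `ξ = 1 / z`, the reciprocal of the map is `ξ * m ξ`. The bounds on `g` keep
  -- `m` bounded and away from zero, so the singularity at `0` is removable with nonzero value, and
  -- `ξ * m ξ` is locally injective.
  set m : ℂ → ℂ := fun ξ => Complex.exp (-g ξ⁻¹) / (1 - w₀ * ξ) with hm
  have hmd : DifferentiableOn ℂ m (Metric.ball 0 r \ {0}) := by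
    intro ξ hξ
    have h0 : ξ ≠ 0 := hξ.2
    have h1 : DifferentiableAt ℂ (fun ξ => g ξ⁻¹) ξ :=
      (hg _ (hpt ξ hξ).1).comp ξ (differentiableAt_inv h0)
    have h2 : 1 - w₀ * ξ ≠ 0 := norm_pos_iff.1 (by linarith [(hden ξ hξ).1])
    exact (h1.neg.cexp.div (by fun_prop) h2).differentiableWithinAt
  have hexp : ∀ ξ ∈ Metric.ball (0 : ℂ) r \ {0},
      Real.exp (-B) ≤ ‖Complex.exp (-g ξ⁻¹)‖ ∧ ‖Complex.exp (-g ξ⁻¹)‖ ≤ Real.exp B := by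
    intro ξ hξ
    have h1 := abs_le.1 ((Complex.abs_re_le_norm _).trans (hB _ (hpt ξ hξ).1))
    rw [Complex.norm_exp, Complex.neg_re, Real.exp_le_exp, Real.exp_le_exp]
    constructor <;> linarith [h1.1, h1.2]
  have hmb : BddAbove (norm ∘ m '' (Metric.ball 0 r \ {0})) := by
    refine ⟨Real.exp B / (1 / 2), ?_⟩
    rintro _ ⟨ξ, hξ, rfl⟩
    simp only [Function.comp, hm, norm_div]
    exact div_le_div₀ (Real.exp_pos B).le (hexp ξ hξ).2 (by norm_num) (hden ξ hξ).1
  have hext := Complex.differentiableOn_update_limUnder_of_bddAbove (Metric.ball_mem_nhds 0 hr0)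
    hmd hmb
  set M : ℂ → ℂ := Function.update m 0 ((𝓝[≠] (0 : ℂ)).limUnder m) with hM
  have hMm : ∀ ξ, ξ ≠ 0 → M ξ = m ξ := fun ξ hξ => Function.update_of_ne hξ _ _
  have hMda : DifferentiableOn ℂ M (Metric.ball 0 r) := hext
  have hM0 : M 0 ≠ 0 := by
    have hc : ContinuousAt M 0 :=
      (hMda.differentiableAt (Metric.ball_mem_nhds 0 hr0)).continuousAt
    have h1 : Filter.Tendsto (fun ξ => ‖M ξ‖) (𝓝[≠] 0) (𝓝 ‖M 0‖) :=
      (hc.norm.tendsto).mono_left nhdsWithin_le_nhds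
    have h2 : Real.exp (-B) / (3 / 2) ≤ ‖M 0‖ := by
      refine ge_of_tendsto h1 ?_
      have h3 : Metric.ball (0 : ℂ) r \ {0} ∈ 𝓝[≠] (0 : ℂ) :=
        sdiff_mem_nhdsWithin_compl (Metric.ball_mem_nhds 0 hr0) _
      filter_upwards [h3] with ξ hξ
      rw [hMm ξ hξ.2]
      simp only [hm, norm_div]
      exact div_le_div₀ (norm_nonneg _) (hexp ξ hξ).1 (by linarith [(hden ξ hξ).1]) (hden ξ hξ).2
    have h4 : 0 < Real.exp (-B) / (3 / 2) := by positivity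
    exact norm_pos_iff.1 (h4.trans_le h2)
  have hk : HasStrictDerivAt (fun ξ => ξ * M ξ) (M 0) 0 := by
    have h1 : AnalyticAt ℂ M 0 := hMda.analyticAt (Metric.ball_mem_nhds 0 hr0)
    have h2 : AnalyticAt ℂ (fun ξ => ξ * M ξ) 0 := analyticAt_id.mul h1
    have h3 := h2.hasStrictDerivAt
    have h4 : deriv (fun ξ => ξ * M ξ) 0 = M 0 := by
      have h5 : deriv (fun ξ => ξ * M ξ) 0 = 1 * M 0 + 0 * deriv M 0 :=
        ((hasDerivAt_id' (0 : ℂ)).mul h1.differentiableAt.hasDerivAt).deriv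
      rw [h5]
      ring
    rwa [h4] at h3
  obtain ⟨s, hs, hinj⟩ := hk.exists_injOn hM0
  obtain ⟨δ, hδ, hδs⟩ := Metric.mem_nhds_iff.1 hs
  have key : ∀ z : ℂ, max (max R r⁻¹) δ⁻¹ < ‖z‖ → z⁻¹ ∈ s ∧
      z⁻¹ * M z⁻¹ = ((z - w₀) * Complex.exp (g z))⁻¹ := by
    intro z hz
    have h1 : δ⁻¹ < ‖z‖ := (le_max_right _ _).trans_lt hz
    have h2 : r⁻¹ < ‖z‖ := (le_max_right _ _).trans_lt ((le_max_left _ _).trans_lt hz)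
    have hz0 : 0 < ‖z‖ := (inv_pos.2 hδ).trans h1
    have hzne : z ≠ 0 := norm_pos_iff.1 hz0
    have hball : z⁻¹ ∈ Metric.ball (0 : ℂ) r \ {0} := by
      refine ⟨?_, inv_ne_zero hzne⟩
      rw [mem_ball_zero_iff, norm_inv]
      exact inv_lt_of_inv_lt₀ hr0 h2
    refine ⟨hδs ?_, ?_⟩
    · rw [mem_ball_zero_iff, norm_inv]
      exact inv_lt_of_inv_lt₀ hδ h1
    · have h3 : 1 - w₀ * z⁻¹ ≠ 0 := norm_pos_iff.1 (by linarith [(hden _ hball).1])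
      rw [hMm _ (inv_ne_zero hzne)]
      simp only [hm, inv_inv, Complex.exp_neg]
      have h4 : z - w₀ = z * (1 - w₀ * z⁻¹) := by field_simp
      rw [h4]
      field_simp
  refine ⟨max (max R r⁻¹) δ⁻¹, (le_max_left _ _).trans (le_max_left _ _), fun z hz w hw hzw => ?_⟩
  have hz' := key z hz
  have hw' := key w hw
  simp only at hzw
  refine inv_injective (hinj hz'.1 hw'.1 ?_)
  simp only
  rw [hz'.2, hw'.2, hzw]

namespace IsExteriorDirichlet

variable {Ω : Set ℂ} {γ : ℝ → ℂ} {U : ℂ → ℝ} {Φ φ₀ : ℝ}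

/-- The multivalued part of the exponent is exactly `log (z - γ 0)`, because the residue is `-c`.
Hence `f = (z - γ 0) exp (-(l + C - φ₀) / c)` is single-valued. -/
theorem exists_conformal_sublevel (h : IsExteriorDirichlet Ω γ U Φ φ₀) {a : ℝ} (ha : a < φ₀) :
    ∃ f : ℂ → ℂ, (∀ z ∈ Ω, U z < a →
      HasDerivAt f (-(complexGradient Ω U z / (Φ / (2 * Real.pi) : ℝ)) * f z) z ∧
      ‖f z‖ = Real.exp ((φ₀ - U z) / (Φ / (2 * Real.pi)))) ∧
      ∃ R, Set.InjOn f {z : ℂ | R < ‖z‖} := by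
  obtain ⟨l, C, B, hl⟩ := h.exists_log_decomposition ha
  set c : ℝ := Φ / (2 * Real.pi) with hc
  have hc0 : 0 < c := div_pos h.flux_pos (by positivity)
  have hcC : (c : ℂ) ≠ 0 := by exact_mod_cast hc0.ne'
  set g : ℂ → ℂ := fun z => -(l z) / c + ((φ₀ - C) / c : ℝ) with hg
  have hgd : ∀ z ∈ Ω, U z < a →
      HasDerivAt g (-(complexGradient Ω U z + c / (z - γ 0)) / c) z := fun z hz hza =>
    (((hl z hz hza).1.neg).div_const _).add_const _
  refine ⟨fun z => (z - γ 0) * Complex.exp (g z), fun z hz hza => ⟨?_, ?_⟩, ?_⟩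
  · have hz0 : z - γ 0 ≠ 0 := sub_ne_zero.2 fun e => h.gamma_notMem 0 (e ▸ hz)
    refine (((hasDerivAt_id z).sub_const (γ 0)).mul (hgd z hz hza).cexp).congr_deriv ?_
    simp only [id]
    field_simp
    ring
  · have hz0 : 0 < ‖z - γ 0‖ :=
      norm_pos_iff.2 (sub_ne_zero.2 fun e => h.gamma_notMem 0 (e ▸ hz))
    rw [norm_mul, Complex.norm_exp]
    conv_lhs => rw [← Real.exp_log hz0]
    rw [← Real.exp_add]
    congr 1
    have e : (g z).re = -(l z).re / c + (φ₀ - C) / c := by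
      simp only [hg, Complex.add_re, Complex.ofReal_re, Complex.div_ofReal_re, Complex.neg_re]
    rw [e, (hl z hz hza).2.2]
    field_simp
    ring
  · obtain ⟨R, hR, hext⟩ := h.exists_exterior_sublevel a
    obtain ⟨R', -, hinj⟩ := exists_injOn_exterior (w₀ := γ 0) (g := g) (R := R)
      (B := B / c + |(φ₀ - C) / c|) hR
      (fun z hz => (hgd z (hext z hz).1 (hext z hz).2).differentiableAt)
      (fun z hz => by
        refine (norm_add_le _ _).trans (add_le_add ?_ ?_)
        · rw [norm_div, norm_neg, Complex.norm_real, Real.norm_eq_abs, abs_of_pos hc0]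
          exact div_le_div_of_nonneg_right (hl z (hext z hz).1 (hext z hz).2).2.1 hc0.le
        · rw [Complex.norm_real, Real.norm_eq_abs])
    exact ⟨R', hinj⟩

/-- The exterior uniformizing map `f = exp (-(U - φ₀ + i V) / c)`. -/
theorem exists_conformal (h : IsExteriorDirichlet Ω γ U Φ φ₀) :
    ∃ f : ℂ → ℂ, (∀ z ∈ Ω,
      HasDerivAt f (-(complexGradient Ω U z / (Φ / (2 * Real.pi) : ℝ)) * f z) z ∧
      ‖f z‖ = Real.exp ((φ₀ - U z) / (Φ / (2 * Real.pi)))) ∧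
      ∃ R, Set.InjOn f {z : ℂ | R < ‖z‖} := by
  obtain ⟨R, hR, hext⟩ := h.exists_exterior_sublevel φ₀
  set p : ℂ := ((R + 1 : ℝ) : ℂ) with hp
  have hpn : R < ‖p‖ := by
    rw [hp, Complex.norm_real, Real.norm_eq_abs, abs_of_pos (by linarith)]; linarith
  have hpΩ : p ∈ Ω := (hext p hpn).1
  have hpU : U p < φ₀ := (hext p hpn).2
  set ψ : ℂ → ℂ := fun z => -(complexGradient Ω U z / (Φ / (2 * Real.pi) : ℝ)) with hψ
  set n : ℂ → ℝ := fun z => Real.exp ((φ₀ - U z) / (Φ / (2 * Real.pi))) with hn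
  -- The maps on different sublevel sets agree only up to a unimodular factor, which is fixed by
  -- making the value at the base point `p` positive.
  have hloc : ∀ a : ℝ, ∃ f : ℂ → ℂ, a < φ₀ → U p < a → ((∀ z ∈ Ω, U z < a →
      HasDerivAt f (ψ z * f z) z ∧ ‖f z‖ = n z) ∧ f p = n p ∧
      ∃ R, Set.InjOn f {z : ℂ | R < ‖z‖}) := by
    intro a
    by_cases ha : a < φ₀ ∧ U p < a
    · obtain ⟨f, hf, R', hinj⟩ := h.exists_conformal_sublevel ha.1
      have hfp : f p ≠ 0 := by
        rw [← norm_pos_iff, (hf p hpΩ ha.2).2]; exact Real.exp_pos _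
      set u : ℂ := n p / f p with hu
      have hu1 : ‖u‖ = 1 := by
        rw [hu, norm_div, (hf p hpΩ ha.2).2, Complex.norm_real, Real.norm_eq_abs,
          abs_of_pos (Real.exp_pos _), div_self (Real.exp_pos _).ne']
      have hu0 : u ≠ 0 := norm_pos_iff.1 (by rw [hu1]; exact one_pos)
      refine ⟨fun z => u * f z, fun _ _ => ⟨fun z hz hza => ⟨?_, ?_⟩, ?_, R', ?_⟩⟩
      · refine ((hf z hz hza).1.const_mul u).congr_deriv ?_
        simp only [hψ]
        ring
      · rw [norm_mul, hu1, one_mul, (hf z hz hza).2]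
      · simp only [hu]
        field_simp
      · intro z hz w hw hzw
        exact hinj hz hw (mul_left_cancel₀ hu0 hzw)
    · exact ⟨0, fun h1 h2 => absurd ⟨h1, h2⟩ ha⟩
  choose F hF using hloc
  -- The quotient of the two maps has zero derivative on a connected sublevel set and equals `1` at
  -- `p`.
  have hagree : ∀ a b, a < φ₀ → b < φ₀ → U p < a → a ≤ b → ∀ z ∈ Ω, U z < a → F a z = F b z := by
    intro a b ha hb hpa hab z hz hza
    have hA := hF a ha hpa
    have hB := hF b hb (hpa.trans_le hab)
    have hB0 : ∀ w ∈ Ω, U w < a → F b w ≠ 0 := fun w hw hwa => by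
      rw [← norm_pos_iff, (hB.1 w hw (hwa.trans_le hab)).2]; exact Real.exp_pos _
    have hder : ∀ w ∈ {w ∈ Ω | U w < a}, HasDerivAt (fun w => F a w / F b w) 0 w := by
      rintro w ⟨hw, hwa⟩
      refine ((hA.1 w hw hwa).1.div (hB.1 w hw (hwa.trans_le hab)).1 (hB0 w hw hwa)).congr_deriv ?_
      ring
    have hconst := (h.isOpen_sublevel a).is_const_of_deriv_eq_zero (h.isPreconnected_sublevel ha)
      (fun w hw => (hder w hw).differentiableAt.differentiableWithinAt)
      (fun w hw => (hder w hw).deriv) (x := z) (y := p) ⟨hz, hza⟩ ⟨hpΩ, hpa⟩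
    have hp0 : (n p : ℂ) ≠ 0 := by exact_mod_cast (Real.exp_pos _).ne'
    rw [hA.2.1, hB.2.1, div_self hp0] at hconst
    exact (div_eq_one_iff_eq (hB0 z hz hza)).1 hconst
  -- A level above `U z` and `U p` but below `φ₀`, so that `F (α z)` is defined near `z`.
  set α : ℂ → ℝ := fun z => (max (U z) (U p) + φ₀) / 2 with hα
  have hα1 : ∀ z ∈ Ω, U z < α z ∧ U p < α z ∧ α z < φ₀ := by
    intro z hz
    have h1 := h.lt_boundaryValue z hz
    have h2 : max (U z) (U p) < φ₀ := max_lt h1 hpU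
    have h3 := le_max_left (U z) (U p)
    have h4 := le_max_right (U z) (U p)
    simp only [hα]
    exact ⟨by linarith, by linarith, by linarith⟩
  have hcomp : ∀ z ∈ Ω, ∀ b, b < φ₀ → U p < b → U z < b → F (α z) z = F b z := by
    intro z hz b hb hpb hzb
    obtain ⟨h1, h2, h3⟩ := hα1 z hz
    rcases le_total (α z) b with hle | hle
    · exact hagree _ _ h3 hb h2 hle z hz h1
    · exact (hagree _ _ hb h3 hpb hle z hz hzb).symm
  refine ⟨fun z => F (α z) z, fun z hz => ?_, ?_⟩
  · obtain ⟨h1, h2, h3⟩ := hα1 z hz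
    have h4 := (hF (α z) h3 h2).1 z hz h1
    refine ⟨?_, h4.2⟩
    refine h4.1.congr_of_eventuallyEq ?_
    filter_upwards [(h.isOpen_sublevel (α z)).mem_nhds ⟨hz, h1⟩] with w hw
    exact hcomp w hw.1 _ h3 h2 hw.2
  · set b := α p
    obtain ⟨-, h2, h3⟩ := hα1 p hpΩ
    obtain ⟨R₁, hinj⟩ := (hF b h3 h2).2.2
    obtain ⟨R₂, -, hext₂⟩ := h.exists_exterior_sublevel b
    refine ⟨max R₁ R₂, fun z hz w hw hzw => ?_⟩
    have hz' := hext₂ z ((le_max_right _ _).trans_lt hz)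
    have hw' := hext₂ w ((le_max_right _ _).trans_lt hw)
    refine hinj (show R₁ < ‖z‖ from (le_max_left _ _).trans_lt hz)
      (show R₁ < ‖w‖ from (le_max_left _ _).trans_lt hw) ?_
    rw [← hcomp z hz'.1 b h3 h2 hz'.2, ← hcomp w hw'.1 b h3 h2 hw'.2]
    exact hzw

end IsExteriorDirichlet

/-! ### Proper holomorphic maps onto the exterior of the disc. -/

/-- Near a critical point a nonconstant holomorphic function takes every nearby value twice. -/
theorem AnalyticAt.eventually_two_preimages {f : ℂ → ℂ} {z₀ : ℂ} (hf : AnalyticAt ℂ f z₀)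
    (hnc : ¬ ∀ᶠ z in 𝓝 z₀, f z = f z₀) (hd : deriv f z₀ = 0) {N : Set ℂ} (hN : N ∈ 𝓝 z₀) :
    ∀ᶠ ζ in 𝓝 (f z₀), ζ ≠ f z₀ → ∃ z₁ ∈ N, ∃ z₂ ∈ N, z₁ ≠ z₂ ∧ f z₁ = ζ ∧ f z₂ = ζ := by
  have hsub : AnalyticAt ℂ (fun z => f z - f z₀) z₀ := hf.sub analyticAt_const
  have hne : analyticOrderAt (fun z => f z - f z₀) z₀ ≠ ⊤ := by
    intro htop
    refine hnc ?_
    filter_upwards [analyticOrderAt_eq_top.1 htop] with z hz using sub_eq_zero.1 hz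
  obtain ⟨g, hg, hg0, heq⟩ := hsub.analyticOrderAt_ne_top.1 hne
  set n := analyticOrderNatAt (fun z => f z - f z₀) z₀ with hn
  simp only [smul_eq_mul] at heq
  have hn2 : 2 ≤ n := by
    by_contra! hlt
    interval_cases n
    · have := heq.eq_of_nhds
      simp at this
      exact hg0 this.symm
    · have h1 : HasDerivAt (fun z => (z - z₀) ^ 1 * g z) (g z₀) z₀ := by
        have := (((hasDerivAt_id' z₀).sub_const z₀).pow 1).mul hg.differentiableAt.hasDerivAt
        refine this.congr_deriv ?_
        simp
      have h2 : HasDerivAt (fun z => f z - f z₀) (deriv f z₀) z₀ :=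
        hf.differentiableAt.hasDerivAt.sub_const _
      have h3 := h2.unique (h1.congr_of_eventuallyEq heq)
      exact hg0 (h3.symm.trans hd)
  have hn0 : n ≠ 0 := by omega
  obtain ⟨r, hr⟩ := IsAlgClosed.exists_pow_nat_eq (g z₀) (Nat.pos_of_ne_zero hn0)
  have hr0 : r ≠ 0 := by
    rintro rfl
    rw [zero_pow hn0] at hr
    exact hg0 hr.symm
  -- `k` is a holomorphic `n`-th root of `g`, so `ψ = (z - z₀) k` is a local coordinate with `f = f
  -- z₀ + ψ ^ n`. Since `n ≥ 2`, a nonzero `n`-th root `η` and its rotation `η * ϖ` give distinct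
  -- preimages.
  set k : ℂ → ℂ := fun z => Complex.exp (Complex.log (g z / g z₀) / n) * r with hk
  have hka : AnalyticAt ℂ k z₀ := by
    have h1 : AnalyticAt ℂ (fun z => g z / g z₀) z₀ := hg.div analyticAt_const hg0
    have h2 : AnalyticAt ℂ (fun z => Complex.log (g z / g z₀)) z₀ :=
      h1.clog (by simp [div_self hg0])
    have h3 : AnalyticAt ℂ (fun z => Complex.log (g z / g z₀) / n) z₀ :=
      h2.div analyticAt_const (by exact_mod_cast hn0)
    exact h3.cexp.mul analyticAt_const
  have hk0 : k z₀ = r := by simp [hk, div_self hg0]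
  have hkn : ∀ᶠ z in 𝓝 z₀, k z ^ n = g z := by
    filter_upwards [hg.continuousAt.eventually_ne hg0] with z hz
    simp only [hk]
    rw [mul_pow, hr, ← Complex.exp_nat_mul]
    have : (n : ℂ) ≠ 0 := by exact_mod_cast hn0
    rw [mul_div_cancel₀ _ this, Complex.exp_log (div_ne_zero hz hg0), div_mul_cancel₀ _ hg0]
  set ψ : ℂ → ℂ := fun z => (z - z₀) * k z with hψ
  have hψa : AnalyticAt ℂ ψ z₀ := (analyticAt_id.sub analyticAt_const).mul hka
  have hψ0 : ψ z₀ = 0 := by simp [hψ]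
  have hψd : HasStrictDerivAt ψ r z₀ := by
    have h1 := hψa.hasStrictDerivAt
    have h2 : deriv ψ z₀ = r := by
      have h3 : HasDerivAt ψ (1 * k z₀ + (z₀ - z₀) * deriv k z₀) z₀ :=
        ((hasDerivAt_id' z₀).sub_const z₀).mul hka.differentiableAt.hasDerivAt
      rw [h3.deriv, hk0]
      ring
    rwa [h2] at h1
  have hmap := hψd.map_nhds_eq hr0
  set N' : Set ℂ := N ∩ {z | f z = f z₀ + ψ z ^ n} with hN'
  have hN'mem : N' ∈ 𝓝 z₀ := by
    refine Filter.inter_mem hN ?_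
    filter_upwards [heq, hkn] with z h1 h2
    simp only [hψ]
    rw [mul_pow, h2, ← h1]
    ring
  have himg : ψ '' N' ∈ 𝓝 (0 : ℂ) := by
    rw [← hψ0, ← hmap]
    exact Filter.image_mem_map hN'mem
  obtain ⟨δ, hδ, hball⟩ := Metric.mem_nhds_iff.1 himg
  filter_upwards [Metric.ball_mem_nhds (f z₀) (pow_pos hδ n)] with ζ hζ hζne
  rw [Metric.mem_ball, dist_eq_norm] at hζ
  obtain ⟨η, hη⟩ := IsAlgClosed.exists_pow_nat_eq (ζ - f z₀) (Nat.pos_of_ne_zero hn0)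
  have hη0 : η ≠ 0 := by
    rintro rfl
    rw [zero_pow hn0] at hη
    exact hζne (sub_eq_zero.1 hη.symm)
  have hηδ : ‖η‖ < δ := by
    rw [← hη, norm_pow] at hζ
    exact lt_of_pow_lt_pow_left₀ n hδ.le hζ
  have hprim := Complex.isPrimitiveRoot_exp n hn0
  set ϖ := Complex.exp (2 * Real.pi * Complex.I / n) with hϖ
  have hϖ1 : ϖ ≠ 1 := hprim.ne_one (by omega)
  have hϖn : ‖ϖ‖ = 1 := hprim.norm'_eq_one hn0
  obtain ⟨z₁, hz₁, e₁⟩ := hball (show η ∈ Metric.ball 0 δ by rwa [mem_ball_zero_iff])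
  obtain ⟨z₂, hz₂, e₂⟩ := hball (show η * ϖ ∈ Metric.ball 0 δ by
    rwa [mem_ball_zero_iff, norm_mul, hϖn, mul_one])
  refine ⟨z₁, hz₁.1, z₂, hz₂.1, ?_, ?_, ?_⟩
  · rintro rfl
    rw [e₁] at e₂
    exact hϖ1 (mul_left_cancel₀ hη0 (by rw [← e₂, mul_one]))
  · have : f z₁ = f z₀ + ψ z₁ ^ n := hz₁.2
    rw [this, e₁, hη]
    ring
  · have : f z₂ = f z₀ + ψ z₂ ^ n := hz₂.2
    rw [this, e₂, mul_pow, hprim.pow_eq_one, hη]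
    ring

/-- A proper holomorphic map onto the exterior of the unit disc which is injective near infinity is
a biholomorphism. -/
theorem injOn_and_surjOn_of_proper {Ω : Set ℂ} {f : ℂ → ℂ} {R M : ℝ} (ho : IsOpen Ω)
    (hc : IsPreconnected Ω) (hf : DifferentiableOn ℂ f Ω) (hmaps : ∀ z ∈ Ω, 1 < ‖f z‖)
    (hproper : ∀ r₁ r₂ : ℝ, 1 < r₁ → IsCompact {z ∈ Ω | r₁ ≤ ‖f z‖ ∧ ‖f z‖ ≤ r₂})
    (hext : ∀ z : ℂ, R < ‖z‖ → z ∈ Ω) (hinj : Set.InjOn f {z : ℂ | R < ‖z‖})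
    (hM : ∀ z ∈ Ω, ‖z‖ ≤ R → ‖f z‖ ≤ M) :
    Set.InjOn f Ω ∧ f '' Ω = {ζ : ℂ | 1 < ‖ζ‖} ∧ ∀ z ∈ Ω, deriv f z ≠ 0 := by
  have hfa : AnalyticOnNhd ℂ f Ω := hf.analyticOnNhd ho
  have hfc : ContinuousOn f Ω := hf.continuousOn
  have hfd : ContinuousOn (deriv f) Ω := (hfa.deriv).continuousOn
  have hnc : ∀ z ∈ Ω, ¬ ∀ᶠ w in 𝓝 z, f w = f z := by
    intro z hz hev
    have h1 : Set.EqOn f (fun _ => f z) Ω :=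
      hfa.eqOn_of_preconnected_of_eventuallyEq analyticOnNhd_const hc hz hev
    have hp : ∀ k : ℝ, |R| < k → ((k : ℂ) ∈ {z : ℂ | R < ‖z‖}) := by
      intro k hk
      change R < ‖(k : ℂ)‖
      rw [Complex.norm_real, Real.norm_eq_abs]
      exact (le_abs_self R).trans_lt (hk.trans_le (le_abs_self k))
    have h2 := hp (|R| + 1) (by linarith)
    have h3 := hp (|R| + 2) (by linarith)
    have h4 := hinj h2 h3 ((h1 (hext _ h2)).trans (h1 (hext _ h3)).symm)
    have h5 : |R| + 1 = |R| + 2 := by exact_mod_cast h4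
    linarith
  have hopen : ∀ z ∈ Ω, 𝓝 (f z) ≤ Filter.map f (𝓝 z) := fun z hz =>
    ((hfa z hz).eventually_constant_or_nhds_le_map_nhds).resolve_left (hnc z hz)
  set E : Set ℂ := {ζ : ℂ | 1 < ‖ζ‖} with hE
  have hEpre : IsPreconnected E := Complex.isPreconnected_setOf_lt_norm one_pos
  have hEo : IsOpen E := isOpen_lt continuous_const continuous_norm
  have hbig : ∃ ζ ∈ E, M < ‖ζ‖ := by
    refine ⟨((max 1 M + 1 : ℝ) : ℂ), ?_, ?_⟩
    · change 1 < ‖((max 1 M + 1 : ℝ) : ℂ)‖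
      rw [Complex.norm_real, Real.norm_eq_abs]
      have := le_max_left 1 M
      exact lt_of_lt_of_le (by linarith) (le_abs_self _)
    · rw [Complex.norm_real, Real.norm_eq_abs]
      have := le_max_right 1 M
      exact lt_of_lt_of_le (by linarith) (le_abs_self _)
  -- The values with two preimages counted with multiplicity: a pair on the diagonal is admitted
  -- only at a critical point. `A` turns out to be relatively clopen in `E`.
  set A : Set ℂ := {ζ | ∃ p : ℂ × ℂ, (p.1 ∈ Ω ∧ p.2 ∈ Ω) ∧ (f p.1 = ζ ∧ f p.2 = ζ) ∧
    (p.1 = p.2 → deriv f p.1 = 0)} with hA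
  have hAo : IsOpen A := by
    rw [isOpen_iff_mem_nhds]
    rintro ζ ⟨⟨z₁, z₂⟩, ⟨h₁, h₂⟩, ⟨e₁, e₂⟩, hcrit⟩
    simp only at h₁ h₂ e₁ e₂ hcrit
    by_cases hz : z₁ = z₂
    · subst hz
      have hev := (hfa z₁ h₁).eventually_two_preimages (hnc z₁ h₁) (hcrit rfl) (ho.mem_nhds h₁)
      rw [e₁] at hev
      filter_upwards [hev] with ξ hξ
      by_cases hξζ : ξ = ζ
      · exact ⟨(z₁, z₁), ⟨h₁, h₁⟩, ⟨by rw [hξζ]; exact e₁, by rw [hξζ]; exact e₁⟩, hcrit⟩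
      · obtain ⟨w₁, hw₁, w₂, hw₂, hne, k₁, k₂⟩ := hξ hξζ
        exact ⟨(w₁, w₂), ⟨hw₁, hw₂⟩, ⟨k₁, k₂⟩, fun e => absurd e hne⟩
    · obtain ⟨u, v, hu, hv, huv⟩ := t2_separation_nhds hz
      have k₁ : f '' (u ∩ Ω) ∈ 𝓝 ζ := by
        rw [← e₁]
        exact hopen z₁ h₁ (Filter.image_mem_map (Filter.inter_mem hu (ho.mem_nhds h₁)))
      have k₂ : f '' (v ∩ Ω) ∈ 𝓝 ζ := by
        rw [← e₂]
        exact hopen z₂ h₂ (Filter.image_mem_map (Filter.inter_mem hv (ho.mem_nhds h₂)))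
      filter_upwards [k₁, k₂] with ξ hξ₁ hξ₂
      obtain ⟨w₁, hw₁, j₁⟩ := hξ₁
      obtain ⟨w₂, hw₂, j₂⟩ := hξ₂
      refine ⟨(w₁, w₂), ⟨hw₁.2, hw₂.2⟩, ⟨j₁, j₂⟩, fun e => ?_⟩
      simp only at e
      exact absurd hw₂.1 (Set.disjoint_left.1 huv (e ▸ hw₁.1))
  have hlocK : ∀ ζ ∈ E, ∃ K, IsCompact K ∧ K ⊆ Ω ∧ ∀ᶠ ξ in 𝓝 ζ, ∀ z ∈ Ω, f z = ξ → z ∈ K := by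
    intro ζ hζ
    obtain ⟨r₁, hr₁, hr₁'⟩ := exists_between (show 1 < ‖ζ‖ from hζ)
    refine ⟨_, hproper r₁ (‖ζ‖ + 1) hr₁, fun z hz => hz.1, ?_⟩
    have hcn := (continuous_norm (E := ℂ)).tendsto ζ
    filter_upwards [hcn.eventually (eventually_gt_nhds hr₁'),
      hcn.eventually (eventually_lt_nhds (lt_add_one ‖ζ‖))] with ξ h1 h2 z hz e
    exact ⟨hz, by rw [e]; exact le_of_lt h1, by rw [e]; exact le_of_lt h2⟩
  -- Properness gives a convergent subsequence of pairs. If they merged at a noncritical point,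
  -- local injectivity would put them on the diagonal, hence at critical points, against the
  -- continuity of `deriv f`.
  have hAcl : closure A ∩ E ⊆ A := by
    rintro ζ ⟨hζA, hζE⟩
    obtain ⟨ξ, hξA, hξ⟩ := mem_closure_iff_seq_limit.1 hζA
    obtain ⟨K, hK, hKΩ, hKev⟩ := hlocK ζ hζE
    choose p hpΩ hpf hpc using hξA
    obtain ⟨n₀, hn₀⟩ := Filter.eventually_atTop.1 (hξ.eventually hKev)
    have hpK : ∀ n, p (n + n₀) ∈ K ×ˢ K := fun n =>
      ⟨hn₀ _ (by omega) _ (hpΩ _).1 (hpf _).1, hn₀ _ (by omega) _ (hpΩ _).2 (hpf _).2⟩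
    obtain ⟨q, hqK, φ, hφ, hlim⟩ := (hK.prod hK).tendsto_subseq hpK
    have hlim1 : Filter.Tendsto (fun n => (p (φ n + n₀)).1) Filter.atTop (𝓝 q.1) :=
      (continuous_fst.tendsto q).comp hlim
    have hlim2 : Filter.Tendsto (fun n => (p (φ n + n₀)).2) Filter.atTop (𝓝 q.2) :=
      (continuous_snd.tendsto q).comp hlim
    have hq1 := hKΩ hqK.1
    have hq2 := hKΩ hqK.2
    have hξ' : Filter.Tendsto (fun n => ξ (φ n + n₀)) Filter.atTop (𝓝 ζ) :=
      hξ.comp ((Filter.tendsto_add_atTop_nat n₀).comp hφ.tendsto_atTop)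
    have e1 : f q.1 = ζ := by
      refine tendsto_nhds_unique (((hfc.continuousAt (ho.mem_nhds hq1)).tendsto).comp hlim1) ?_
      exact hξ'.congr fun n => ((hpf _).1).symm
    have e2 : f q.2 = ζ := by
      refine tendsto_nhds_unique (((hfc.continuousAt (ho.mem_nhds hq2)).tendsto).comp hlim2) ?_
      exact hξ'.congr fun n => ((hpf _).2).symm
    refine ⟨q, ⟨hq1, hq2⟩, ⟨e1, e2⟩, fun hq => ?_⟩
    by_contra hd
    obtain ⟨s, hs, hsinj⟩ := ((hfa _ hq1).hasStrictDerivAt).exists_injOn hd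
    have hd' : ∀ᶠ z in 𝓝 q.1, deriv f z ≠ 0 :=
      (hfd.continuousAt (ho.mem_nhds hq1)).eventually_ne hd
    rw [← hq] at hlim2
    obtain ⟨n, ⟨hn1, hn2⟩, hn3⟩ := (((hlim1.eventually hs).and (hlim2.eventually hs)).and
      (hlim1.eventually hd')).exists
    exact hn3 (hpc _ (hsinj hn1 hn2 ((hpf _).1.trans (hpf _).2.symm)))
  -- Otherwise `A` contains all of `E`. A value larger than `M` has preimages only where `f` is
  -- injective, so its pair is diagonal and critical, and then nearby values have two preimages
  -- there.
  have hAempty : ¬ (E ∩ A).Nonempty := by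
    intro hne
    have hsub := hEpre.subset_of_closure_inter_subset hAo hne hAcl
    obtain ⟨ζ, hζE, hζM⟩ := hbig
    obtain ⟨⟨z₁, z₂⟩, ⟨h₁, h₂⟩, ⟨e₁, e₂⟩, hcrit⟩ := hsub hζE
    simp only at h₁ h₂ e₁ e₂ hcrit
    have hR₁ : R < ‖z₁‖ := by
      by_contra! hle
      have := hM z₁ h₁ hle
      rw [e₁] at this
      linarith
    have hR₂ : R < ‖z₂‖ := by
      by_contra! hle
      have := hM z₂ h₂ hle
      rw [e₂] at this
      linarith
    have hz : z₁ = z₂ := hinj hR₁ hR₂ (e₁.trans e₂.symm)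
    have hN : {z : ℂ | R < ‖z‖} ∈ 𝓝 z₁ := (isOpen_lt continuous_const continuous_norm).mem_nhds hR₁
    have hev := (hfa z₁ h₁).eventually_two_preimages (hnc z₁ h₁) (hcrit hz) hN
    obtain ⟨ξ, hξ2, hξ1⟩ : ∃ ξ, _ ∧ ξ ≠ f z₁ :=
      ((hev.filter_mono nhdsWithin_le_nhds).and
        (self_mem_nhdsWithin : {f z₁}ᶜ ∈ 𝓝[≠] (f z₁))).exists
    obtain ⟨w₁, hw₁, w₂, hw₂, hne, k₁, k₂⟩ := hξ2 hξ1
    exact hne (hinj hw₁ hw₂ (k₁.trans k₂.symm))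
  refine ⟨fun z₁ h₁ z₂ h₂ e => ?_, ?_, fun z hz hd => ?_⟩
  · by_contra hne
    exact hAempty ⟨f z₁, hmaps z₁ h₁, (z₁, z₂), ⟨h₁, h₂⟩, ⟨rfl, e.symm⟩, fun h => absurd h hne⟩
  · refine Set.Subset.antisymm ?_ ?_
    · rintro _ ⟨z, hz, rfl⟩
      exact hmaps z hz
    · have hz₀ : (((|R| + 1 : ℝ)) : ℂ) ∈ Ω := hext _ (by
        rw [Complex.norm_real, Real.norm_eq_abs]
        exact lt_of_lt_of_le (lt_of_le_of_lt (le_abs_self R) (lt_add_one _)) (le_abs_self _))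
      refine hEpre.subset_of_closure_inter_subset ?_ ⟨_, hmaps _ hz₀, _, hz₀, rfl⟩ ?_
      · rw [isOpen_iff_mem_nhds]
        rintro _ ⟨z, hz, rfl⟩
        exact hopen z hz (Filter.image_mem_map (ho.mem_nhds hz))
      · rintro ζ ⟨hζ, hζE⟩
        obtain ⟨K, hK, hKΩ, hKev⟩ := hlocK ζ hζE
        have hcl : IsClosed (f '' K) := (hK.image_of_continuousOn (hfc.mono hKΩ)).isClosed
        have h1 : ζ ∈ closure (f '' K) := by
          rw [mem_closure_iff_nhds]
          intro t ht
          obtain ⟨ξ, ⟨hξt, hξK⟩, z, hz, hzξ⟩ :=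
            mem_closure_iff_nhds.1 hζ _ (Filter.inter_mem ht hKev)
          exact ⟨ξ, hξt, z, hξK z hz hzξ, hzξ⟩
        rw [hcl.closure_eq] at h1
        obtain ⟨z, hz, e⟩ := h1
        exact ⟨z, hKΩ hz, e⟩
  · exact hAempty ⟨f z, hmaps z hz, (z, z), ⟨hz, hz⟩, ⟨rfl, rfl⟩, fun _ => hd⟩

/-! ### Isothermal coordinates on the open domain. -/

namespace IsExteriorDirichlet

variable {Ω : Set ℂ} {γ : ℝ → ℂ} {U : ℂ → ℝ} {Φ φ₀ : ℝ}

theorem const_pos (h : IsExteriorDirichlet Ω γ U Φ φ₀) : 0 < Φ / (2 * Real.pi) :=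
  div_pos h.flux_pos (by positivity)

/-- Isothermal coordinates on the open domain: the inverse of the uniformizing map, in
logarithmic coordinates. -/
theorem exists_isothermal (h : IsExteriorDirichlet Ω γ U Φ φ₀) :
    ∃ G : ℂ → ℂ, (∀ s : ℂ, 0 < s.re → G s ∈ Ω ∧ U (G s) = φ₀ - Φ / (2 * Real.pi) * s.re ∧
        complexGradient Ω U (G s) ≠ 0 ∧
        HasDerivAt G (-((Φ / (2 * Real.pi) : ℝ) : ℂ) / complexGradient Ω U (G s)) s) ∧
      (∀ s s' : ℂ, 0 < s.re → 0 < s'.re → (G s = G s' ↔ Complex.exp s = Complex.exp s')) ∧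
      ∀ z ∈ Ω, ∃ s : ℂ, 0 < s.re ∧ G s = z := by
  obtain ⟨f, hf, R₁, hinj⟩ := h.exists_conformal
  obtain ⟨R₂, hR₂, hext⟩ := h.exists_exterior
  set c : ℝ := Φ / (2 * Real.pi) with hc
  have hc0 : 0 < c := h.const_pos
  have hcC : (c : ℂ) ≠ 0 := by exact_mod_cast hc0.ne'
  have hfd : DifferentiableOn ℂ f Ω := fun z hz => (hf z hz).1.differentiableAt.differentiableWithinAt
  have hmaps : ∀ z ∈ Ω, 1 < ‖f z‖ := by
    intro z hz
    rw [(hf z hz).2, Real.one_lt_exp_iff]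
    exact div_pos (sub_pos.2 (h.lt_boundaryValue z hz)) hc0
  -- `‖f‖` is a decreasing function of `U`, so this set is a band of values of `U`, compact by the
  -- behaviour at infinity; `1 < r₁` keeps it off `∂Ω`.
  have hproper : ∀ r₁ r₂ : ℝ, 1 < r₁ → IsCompact {z ∈ Ω | r₁ ≤ ‖f z‖ ∧ ‖f z‖ ≤ r₂} := by
    intro r₁ r₂ hr₁
    rcases lt_or_ge r₂ r₁ with hlt | hle
    · convert isCompact_empty
      ext z
      simp only [Set.mem_empty_iff_false, iff_false]
      rintro ⟨-, h1, h2⟩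
      linarith
    have hr₂ : 0 < r₂ := by linarith
    have hset : {z ∈ Ω | r₁ ≤ ‖f z‖ ∧ ‖f z‖ ≤ r₂} = {z ∈ closure Ω | φ₀ - c * Real.log r₂ ≤ U z} ∩
        {z ∈ closure Ω | U z ≤ φ₀ - c * Real.log r₁} := by
      ext z
      have hiff : ∀ z ∈ Ω, (r₁ ≤ ‖f z‖ ↔ U z ≤ φ₀ - c * Real.log r₁) ∧
          (‖f z‖ ≤ r₂ ↔ φ₀ - c * Real.log r₂ ≤ U z) := by
        intro z hz
        rw [(hf z hz).2, ← Real.log_le_iff_le_exp (by linarith), ← Real.le_log_iff_exp_le hr₂,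
          le_div_iff₀ hc0, div_le_iff₀ hc0]
        constructor <;> constructor <;> intro h1 <;> linarith
      constructor
      · rintro ⟨hz, h1, h2⟩
        exact ⟨⟨subset_closure hz, (hiff z hz).2.1 h2⟩, subset_closure hz, (hiff z hz).1.1 h1⟩
      · rintro ⟨⟨hz, h1⟩, -, h2⟩
        have hzΩ : z ∈ Ω := by
          by_contra hzΩ
          have h3 := h.boundaryValue z (h.mem_frontier_of_notMem hz hzΩ)
          have h4 := mul_pos hc0 (Real.log_pos hr₁)
          linarith
        exact ⟨hzΩ, (hiff z hzΩ).1.2 h2, (hiff z hzΩ).2.2 h1⟩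
    rw [hset]
    exact (h.isCompact_superlevel _).inter_right
      (h.continuousOn.preimage_isClosed_of_isClosed isClosed_closure isClosed_Iic)
  set R := max R₁ R₂
  obtain ⟨M, hM⟩ : ∃ M, ∀ z ∈ Ω, ‖z‖ ≤ R → ‖f z‖ ≤ M := by
    have hK : IsCompact (closure Ω ∩ Metric.closedBall 0 R) :=
      (isCompact_closedBall 0 R).inter_left isClosed_closure
    obtain ⟨C, hC⟩ := hK.exists_bound_of_continuousOn (h.continuousOn.mono Set.inter_subset_left)
    refine ⟨Real.exp ((φ₀ + C) / c), fun z hz hzR => ?_⟩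
    rw [(hf z hz).2, Real.exp_le_exp]
    have h1 := hC z ⟨subset_closure hz, by rwa [mem_closedBall_zero_iff]⟩
    rw [Real.norm_eq_abs] at h1
    have h2 := (abs_le.1 h1).1
    exact div_le_div_of_nonneg_right (by linarith) hc0.le
  obtain ⟨hfinj, hfimg, hfder⟩ := injOn_and_surjOn_of_proper h.isOpen h.isConnected.isPreconnected
    hfd hmaps hproper (fun z hz => hext z ((le_max_right _ _).trans_lt hz))
    (hinj.mono fun z hz => show R₁ < ‖z‖ from (le_max_left _ _).trans_lt hz) hM
  set g : ℂ → ℂ := Function.invFunOn f Ω with hg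
  have hgf : ∀ z ∈ Ω, g (f z) = z := fun z hz => hfinj.leftInvOn_invFunOn hz
  have hex : ∀ s : ℂ, 0 < s.re → ∃ z ∈ Ω, f z = Complex.exp s := by
    intro s hs
    have : Complex.exp s ∈ f '' Ω := by
      rw [hfimg]
      change 1 < ‖Complex.exp s‖
      rwa [Complex.norm_exp, Real.one_lt_exp_iff]
    exact this
  have hgm : ∀ s : ℂ, 0 < s.re → g (Complex.exp s) ∈ Ω := fun s hs => Function.invFunOn_mem (hex s hs)
  have hfg : ∀ s : ℂ, 0 < s.re → f (g (Complex.exp s)) = Complex.exp s := fun s hs =>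
    Function.invFunOn_eq (hex s hs)
  have hF0 : ∀ z ∈ Ω, complexGradient Ω U z ≠ 0 := by
    intro z hz h0
    refine hfder z hz ?_
    rw [(hf z hz).1.deriv, h0]
    simp
  refine ⟨fun s => g (Complex.exp s), fun s hs => ⟨hgm s hs, ?_, hF0 _ (hgm s hs), ?_⟩, ?_, ?_⟩
  · have h1 := (hf _ (hgm s hs)).2
    rw [hfg s hs, Complex.norm_exp, Real.exp_eq_exp, eq_div_iff hc0.ne'] at h1
    linarith
  · set z := g (Complex.exp s) with hz
    have hzΩ : z ∈ Ω := hgm s hs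
    have hstr : HasStrictDerivAt f (deriv f z) z :=
      ((hfd.analyticOnNhd h.isOpen) z hzΩ).hasStrictDerivAt
    have hcont : ContinuousAt g (f z) := by
      rw [ContinuousAt, hgf z hzΩ, ← hstr.map_nhds_eq (hfder z hzΩ), Filter.tendsto_map'_iff]
      refine Filter.tendsto_id.congr' ?_
      filter_upwards [h.isOpen.mem_nhds hzΩ] with w hw
      exact (hgf w hw).symm
    have hgd : HasDerivAt g (deriv f z)⁻¹ (f z) := by
      refine HasDerivAt.of_local_left_inverse (f := f) hcont ?_ (hfder z hzΩ) ?_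
      · rw [hgf z hzΩ]; exact hstr.hasDerivAt
      · rw [← hstr.map_nhds_eq (hfder z hzΩ), Filter.eventually_map]
        filter_upwards [h.isOpen.mem_nhds hzΩ] with w hw
        rw [hgf w hw]
    rw [hfg s hs] at hgd
    refine (hgd.comp s (Complex.hasDerivAt_exp s)).congr_deriv ?_
    rw [(hf z hzΩ).1.deriv, hfg s hs]
    have := Complex.exp_ne_zero s
    have := hF0 z hzΩ
    change _ = -(c : ℂ) / complexGradient Ω U z
    field_simp
  · intro s s' hs hs'
    constructor
    · intro e
      simp only at e
      rw [← hfg s hs, ← hfg s' hs', e]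
    · intro e
      simp only
      rw [e]
  · intro z hz
    have h1 := hmaps z hz
    have hne : f z ≠ 0 := norm_pos_iff.1 (by linarith)
    refine ⟨Complex.log (f z), ?_, ?_⟩
    · rw [Complex.log_re]; exact Real.log_pos h1
    · simp only
      rw [Complex.exp_log hne, hgf z hz]

theorem continuousOn_complexGradient (h : IsExteriorDirichlet Ω γ U Φ φ₀) :
    ContinuousOn (complexGradient Ω U) (closure Ω) := h.contDiffOn_complexGradient.continuousOn

/-- The complex gradient vanishes nowhere on the closed domain. -/
theorem complexGradient_ne_zero (h : IsExteriorDirichlet Ω γ U Φ φ₀) {z : ℂ} (hz : z ∈ closure Ω) :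
    complexGradient Ω U z ≠ 0 := by
  by_cases hzΩ : z ∈ Ω
  · obtain ⟨G, hG, -, hsurj⟩ := h.exists_isothermal
    obtain ⟨s, hs, rfl⟩ := hsurj z hzΩ
    exact (hG s hs).2.2.1
  · exact h.complexGradient_ne_zero_frontier (h.mem_frontier_of_notMem hz hzΩ)

end IsExteriorDirichlet

/-! ### Extension of the coordinates to the boundary. -/

theorem closure_rightHalfPlane : closure {s : ℂ | 0 < s.re} = {s : ℂ | 0 ≤ s.re} :=
  Complex.closure_setOfPred_lt_re 0

/-- A function on the closed half plane whose derivative extends continuously to the boundary line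
is differentiable along vertical lines up to the boundary. -/
theorem hasDerivAt_vertical {g g₁ : ℂ → ℂ} (hg : ContinuousOn g {s : ℂ | 0 ≤ s.re})
    (hg₁ : ContinuousOn g₁ {s : ℂ | 0 ≤ s.re}) (hd : ∀ s : ℂ, 0 < s.re → HasDerivAt g (g₁ s) s)
    {t : ℝ} (ht : 0 ≤ t) (θ : ℝ) :
    HasDerivAt (fun θ : ℝ => g (t + θ * Complex.I)) (Complex.I * g₁ (t + θ * Complex.I)) θ := by
  have hre : ∀ θ : ℝ, ((t : ℂ) + θ * Complex.I).re = t := by simp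
  have hopen : IsOpen {s : ℂ | 0 < s.re} := isOpen_lt continuous_const Complex.continuous_re
  have hsub : {s : ℂ | 0 < s.re} ⊆ {s : ℂ | 0 ≤ s.re} := fun s (hs : 0 < s.re) => hs.le
  set x : ℂ := t + θ * Complex.I with hx
  have hxm : x ∈ {s : ℂ | 0 ≤ s.re} := by change 0 ≤ x.re; rw [hx, hre]; exact ht
  let L : ℂ → (ℂ →L[ℝ] ℂ) := fun v => (ContinuousLinearMap.toSpanSingleton ℂ v).restrictScalars ℝ
  have hL : Continuous L :=
    (ContinuousLinearMap.restrictScalarsL ℂ ℂ ℂ ℝ ℝ).continuous.comp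
      (ContinuousLinearMap.toSpanSingletonLE ℂ ℂ ℂ).continuous_of_finiteDimensional
  have hfd : ∀ s : ℂ, 0 < s.re → HasFDerivAt g (L (g₁ s)) s := fun s hs =>
    (hd s hs).hasFDerivAt.restrictScalars ℝ
  have h1 : HasFDerivWithinAt g (L (g₁ x)) (closure {s : ℂ | 0 < s.re}) x := by
    refine hasFDerivWithinAt_closure_of_tendsto_fderiv
      (fun s hs => (hfd s hs).differentiableAt.differentiableWithinAt) (convex_halfSpace_re_gt 0)
      hopen ?_ ?_
    · intro y hy
      rw [closure_rightHalfPlane] at hy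
      exact (hg y hy).mono hsub
    · have h2 : Filter.Tendsto (fun s => L (g₁ s)) (𝓝[{s : ℂ | 0 < s.re}] x) (𝓝 (L (g₁ x))) :=
        (hL.tendsto _).comp ((hg₁ x hxm).mono hsub)
      refine h2.congr' ?_
      filter_upwards [self_mem_nhdsWithin] with s hs
      exact (hfd s hs).fderiv.symm
  rw [closure_rightHalfPlane] at h1
  have h2 : HasDerivAt (fun θ : ℝ => (t : ℂ) + θ * Complex.I) Complex.I θ := by
    simpa using ((Complex.ofRealCLM.hasDerivAt (x := θ)).mul_const Complex.I).const_add (t : ℂ)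
  have h3 := h1.comp_hasDerivAt θ h2 (Filter.Eventually.of_forall fun y => by
    change 0 ≤ ((t : ℂ) + y * Complex.I).re; rw [hre]; exact ht)
  exact h3.congr_deriv (by simp [L])

/-- Isothermal coordinates `G (t + iθ)` on the closed domain with first and second derivatives
`G₁`, `G₂` that are continuous up to the boundary; the level curves are the images of vertical
lines. -/
structure IsLevelParam (Ω : Set ℂ) (U : ℂ → ℝ) (φ₀ c : ℝ) (G G₁ G₂ : ℂ → ℂ) : Prop where
  cont : ContinuousOn G {s : ℂ | 0 ≤ s.re}
  cont₁ : ContinuousOn G₁ {s : ℂ | 0 ≤ s.re}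
  cont₂ : ContinuousOn G₂ {s : ℂ | 0 ≤ s.re}
  deriv : ∀ s : ℂ, 0 < s.re → HasDerivAt G (G₁ s) s
  deriv₁ : ∀ s : ℂ, 0 < s.re → HasDerivAt G₁ (G₂ s) s
  mem : ∀ s : ℂ, 0 ≤ s.re → G s ∈ closure Ω
  potential : ∀ s : ℂ, 0 ≤ s.re → U (G s) = φ₀ - c * s.re
  grad : ∀ s : ℂ, 0 ≤ s.re → complexGradient Ω U (G s) * G₁ s = -c
  periodic : ∀ s : ℂ, 0 ≤ s.re → G (s + 2 * Real.pi * Complex.I) = G s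
  periodic₁ : ∀ s : ℂ, 0 ≤ s.re → G₁ (s + 2 * Real.pi * Complex.I) = G₁ s
  periodic₂ : ∀ s : ℂ, 0 ≤ s.re → G₂ (s + 2 * Real.pi * Complex.I) = G₂ s
  surj : ∀ z ∈ closure Ω, ∃ s : ℂ, 0 ≤ s.re ∧ G s = z

namespace IsExteriorDirichlet

variable {Ω : Set ℂ} {γ : ℝ → ℂ} {U : ℂ → ℝ} {Φ φ₀ : ℝ}

theorem continuousOn_fderivWithin_complexGradient (h : IsExteriorDirichlet Ω γ U Φ φ₀) :
    ContinuousOn (fun z => fderivWithin ℝ (complexGradient Ω U) (closure Ω) z 1) (closure Ω) :=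
  (h.contDiffOn_complexGradient.continuousOn_fderivWithin h.uniqueDiffOn le_rfl).clm_apply
    continuousOn_const

theorem hasDerivAt_complexGradient (h : IsExteriorDirichlet Ω γ U Φ φ₀) {z : ℂ} (hz : z ∈ Ω) :
    HasDerivAt (complexGradient Ω U)
      (fderivWithin ℝ (complexGradient Ω U) (closure Ω) z 1) z := by
  have h1 := h.differentiableAt_complexGradient hz
  rw [fderivWithin_of_mem_nhds (h.closure_mem_nhds hz),
    (h1.hasFDerivAt.restrictScalars ℝ).fderiv]
  exact h1.hasDerivAt

/-- The derivative `-c / F(G)` is bounded near the imaginary axis because `F` does not vanish on the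
closed domain. So `G` is Lipschitz on a strip and extends; potential and periodicity pass to the
limit by density. -/
theorem exists_levelParam (h : IsExteriorDirichlet Ω γ U Φ φ₀) :
    ∃ G G₁ G₂ : ℂ → ℂ, IsLevelParam Ω U φ₀ (Φ / (2 * Real.pi)) G G₁ G₂ ∧
      ∀ s s' : ℂ, 0 < s.re → 0 < s'.re → G s = G s' → Complex.exp s = Complex.exp s' := by
  classical
  obtain ⟨g, hg, hgexp, hgsurj⟩ := h.exists_isothermal
  set c : ℝ := Φ / (2 * Real.pi) with hc
  have hc0 : 0 < c := h.const_pos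
  set F := complexGradient Ω U with hF
  have hopen : IsOpen {s : ℂ | 0 < s.re} := isOpen_lt continuous_const Complex.continuous_re
  obtain ⟨m, hm0, hm⟩ : ∃ m > 0, ∀ z ∈ closure Ω, φ₀ - c ≤ U z → m ≤ ‖F z‖ := by
    have hK := h.isCompact_superlevel (φ₀ - c)
    have hne : ({z ∈ closure Ω | φ₀ - c ≤ U z}).Nonempty := by
      refine ⟨γ 0, frontier_subset_closure (h.boundary.mem_frontier 0), ?_⟩
      rw [h.boundaryValue _ (h.boundary.mem_frontier 0)]
      linarith
    obtain ⟨z₀, hz₀, hmin⟩ := hK.exists_isMinOn hne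
      ((h.continuousOn_complexGradient.mono fun z hz => hz.1).norm)
    exact ⟨‖F z₀‖, norm_pos_iff.2 (h.complexGradient_ne_zero hz₀.1), fun z hz hzU => hmin ⟨hz, hzU⟩⟩
  have hstrip : Convex ℝ ({s : ℂ | 0 < s.re} ∩ {s : ℂ | s.re < 1}) :=
    (convex_halfSpace_re_gt 0).inter (convex_halfSpace_re_lt 1)
  have hlip : LipschitzOnWith (Real.toNNReal (c / m)) g ({s : ℂ | 0 < s.re} ∩ {s : ℂ | s.re < 1}) := by
    refine hstrip.lipschitzOnWith_of_nnnorm_hasDerivWithin_le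
      (fun s hs => (hg s hs.1).2.2.2.hasDerivWithinAt) fun s hs => ?_
    obtain ⟨h1, h2, h3, -⟩ := hg s hs.1
    have hs1 : s.re < 1 := hs.2
    rw [← NNReal.coe_le_coe, coe_nnnorm, Real.coe_toNNReal _ (by positivity), norm_div, norm_neg,
      Complex.norm_real, Real.norm_eq_abs, abs_of_pos hc0]
    exact div_le_div_of_nonneg_left hc0.le hm0 (hm _ (subset_closure h1) (by rw [h2]; nlinarith))
  obtain ⟨e, heL, hge⟩ := hlip.extend_finite_dimension
  set G : ℂ → ℂ := fun s => if 0 < s.re then g s else e s with hG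
  have hGg : ∀ s : ℂ, 0 < s.re → G s = g s := fun s hs => by simp [hG, hs]
  have hGe : ∀ s : ℂ, s.re < 1 → G s = e s := by
    intro s hs
    by_cases h0 : 0 < s.re
    · rw [hGg s h0]; exact hge ⟨h0, hs⟩
    · simp [hG, h0]
  have hGcont : ∀ s : ℂ, 0 ≤ s.re → ContinuousAt G s := by
    intro s hs
    by_cases h0 : 0 < s.re
    · refine (hg s h0).2.2.2.continuousAt.congr ?_
      filter_upwards [hopen.mem_nhds h0] with w hw using (hGg w hw).symm
    · have h1 : s.re < 1 := by linarith
      refine heL.continuous.continuousAt.congr ?_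
      filter_upwards [(isOpen_lt Complex.continuous_re continuous_const).mem_nhds h1] with w hw
      exact (hGe w hw).symm
  have hcontG : ContinuousOn G {s : ℂ | 0 ≤ s.re} := fun s hs => (hGcont s hs).continuousWithinAt
  have hclos : {s : ℂ | 0 ≤ s.re} = closure {s : ℂ | 0 < s.re} := closure_rightHalfPlane.symm
  have hmem : ∀ s : ℂ, 0 ≤ s.re → G s ∈ closure Ω := by
    intro s hs
    have h1 : s ∈ closure {s : ℂ | 0 < s.re} := hclos ▸ hs
    refine closure_mono ?_ (mem_closure_image (hGcont s hs) h1)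
    rintro _ ⟨w, hw, rfl⟩
    rw [hGg w hw]
    exact (hg w hw).1
  have hpot : ∀ s : ℂ, 0 ≤ s.re → U (G s) = φ₀ - c * s.re := by
    have h1 : Set.EqOn (fun s => U (G s)) (fun s => φ₀ - c * s.re) {s : ℂ | 0 < s.re} := by
      intro s hs
      simp only
      rw [hGg s hs]
      exact (hg s hs).2.1
    have h2 : ContinuousOn (fun s => U (G s)) {s : ℂ | 0 ≤ s.re} :=
      h.continuousOn.comp hcontG hmem
    have h3 : ContinuousOn (fun s : ℂ => φ₀ - c * s.re) {s : ℂ | 0 ≤ s.re} := by fun_prop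
    exact h1.of_subset_closure h2 h3 (fun s (hs : 0 < s.re) => hs.le) hclos.le
  have hFne : ∀ s : ℂ, 0 ≤ s.re → F (G s) ≠ 0 := fun s hs => h.complexGradient_ne_zero (hmem s hs)
  have hper : ∀ s : ℂ, 0 ≤ s.re → G (s + 2 * Real.pi * Complex.I) = G s := by
    have hshift : ∀ s : ℂ, (s + 2 * Real.pi * Complex.I).re = s.re := by simp
    have h1 : Set.EqOn (fun s => G (s + 2 * Real.pi * Complex.I)) G {s : ℂ | 0 < s.re} := by
      intro s (hs : 0 < s.re)
      have hs' : 0 < (s + 2 * Real.pi * Complex.I).re := by rwa [hshift]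
      simp only
      rw [hGg s hs, hGg _ hs', hgexp _ _ hs' hs, Complex.exp_add, Complex.exp_two_pi_mul_I, mul_one]
    have h2 : ContinuousOn (fun s => G (s + 2 * Real.pi * Complex.I)) {s : ℂ | 0 ≤ s.re} :=
      hcontG.comp (by fun_prop) fun s hs => by
        change 0 ≤ (s + 2 * Real.pi * Complex.I).re
        rwa [hshift]
    exact h1.of_subset_closure h2 hcontG (fun s (hs : 0 < s.re) => hs.le) hclos.le
  set F₁ : ℂ → ℂ := fun z => fderivWithin ℝ F (closure Ω) z 1 with hF₁
  have hFG : ContinuousOn (fun s => F (G s)) {s : ℂ | 0 ≤ s.re} :=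
    h.continuousOn_complexGradient.comp hcontG hmem
  have hF₁G : ContinuousOn (fun s => F₁ (G s)) {s : ℂ | 0 ≤ s.re} :=
    h.continuousOn_fderivWithin_complexGradient.comp hcontG hmem
  have hderiv : ∀ s : ℂ, 0 < s.re → HasDerivAt G (-(c : ℂ) / F (G s)) s := by
    intro s hs
    have := (hg s hs).2.2.2
    rw [hGg s hs]
    refine this.congr_of_eventuallyEq ?_
    filter_upwards [hopen.mem_nhds hs] with w hw using hGg w hw
  have hsurjΩ : ∀ z ∈ Ω, ∃ s : ℂ, 0 < s.re ∧ -Real.pi ≤ s.im ∧ s.im ≤ Real.pi ∧ G s = z := by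
    intro z hz
    obtain ⟨s, hs, rfl⟩ := hgsurj z hz
    have hre : (Complex.log (Complex.exp s)).re = s.re := by
      rw [Complex.log_re, Complex.norm_exp, Real.log_exp]
    refine ⟨Complex.log (Complex.exp s), by rwa [hre], (Complex.neg_pi_lt_log_im _).le,
      Complex.log_im_le_pi _, ?_⟩
    rw [hGg _ (by rwa [hre]), hgexp _ _ (by rwa [hre]) hs, Complex.exp_log (Complex.exp_ne_zero s)]
  -- Both derivatives are written through `F` and its derivative at `G s`, which makes continuity up
  -- to the axis automatic.
  refine ⟨G, fun s => -(c : ℂ) / F (G s),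
    fun s => (c : ℂ) * (F₁ (G s) * (-(c : ℂ) / F (G s))) / F (G s) ^ 2, ?_, ?_⟩
  · refine ⟨hcontG, continuousOn_const.div hFG hFne,
      (continuousOn_const.mul (hF₁G.mul (continuousOn_const.div hFG hFne))).div (hFG.pow 2)
        (fun s hs => pow_ne_zero 2 (hFne s hs)), hderiv, ?_, hmem, hpot, ?_, hper, ?_, ?_, ?_⟩
    · intro s hs
      have hGΩ : G s ∈ Ω := by rw [hGg s hs]; exact (hg s hs).1
      have h1 : HasDerivAt (fun s => F (G s)) (F₁ (G s) * (-(c : ℂ) / F (G s))) s :=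
        (h.hasDerivAt_complexGradient hGΩ).comp s (hderiv s hs)
      refine ((hasDerivAt_const s (-(c : ℂ))).div h1 (hFne s hs.le)).congr_deriv ?_
      ring
    · intro s hs
      have h1 := hFne s hs
      change F (G s) * (-(c : ℂ) / F (G s)) = -c
      field_simp
    · intro s hs
      rw [hper s hs]
    · intro s hs
      rw [hper s hs]
    · intro z hz
      by_cases hzΩ : z ∈ Ω
      · obtain ⟨s, hs, -, -, e⟩ := hsurjΩ z hzΩ
        exact ⟨s, hs.le, e⟩
      -- `K` covers one period of the strip on which `U > φ₀ - c`. Its image is compact and contains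
      -- all points of `Ω` near `z`, hence `z` itself.
      · set K : Set ℂ := Set.Icc 0 1 ×ℂ Set.Icc (-Real.pi) Real.pi with hK
        have hKc : IsCompact K := isCompact_Icc.reProdIm isCompact_Icc
        have hKsub : K ⊆ {s : ℂ | 0 ≤ s.re} := fun s hs => hs.1.1
        have hcl : IsClosed (G '' K) := (hKc.image_of_continuousOn (hcontG.mono hKsub)).isClosed
        have hzU : U z = φ₀ := h.boundaryValue z (h.mem_frontier_of_notMem hz hzΩ)
        have hz2 : z ∈ closure (G '' K) := by
          rw [mem_closure_iff_nhds]
          intro N hN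
          have hev : ∀ᶠ w in 𝓝[closure Ω] z, φ₀ - c < U w :=
            (h.continuousOn z hz).eventually (by rw [hzU]; exact eventually_gt_nhds (by linarith))
          have hev2 : ∀ᶠ w in 𝓝[Ω] z, φ₀ - c < U w :=
            hev.filter_mono (nhdsWithin_mono z subset_closure)
          have : (𝓝[Ω] z).NeBot := mem_closure_iff_nhdsWithin_neBot.1 hz
          obtain ⟨w, ⟨hw1, hw2⟩, hw3⟩ := ((hev2.and self_mem_nhdsWithin).and
            (mem_nhdsWithin_of_mem_nhds hN)).exists
          obtain ⟨s, hs, him1, him2, e⟩ := hsurjΩ w hw2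
          refine ⟨w, hw3, s, ⟨⟨hs.le, ?_⟩, him1, him2⟩, e⟩
          have h1 := hpot s hs.le
          rw [e] at h1
          rw [h1] at hw1
          by_contra! hcon
          nlinarith
        rw [hcl.closure_eq] at hz2
        obtain ⟨s, hs, e⟩ := hz2
        exact ⟨s, hKsub hs, e⟩
  · intro s s' hs hs' e
    rw [hGg s hs, hGg s' hs'] at e
    exact (hgexp s s' hs hs').1 e

end IsExteriorDirichlet

/-! ### Injectivity on the boundary curve. -/

/-- The chord–arc bound converts smoothness in the parameter into a Lipschitz bound for Euclidean
distance. This provides the Lipschitz hypothesis for ODE uniqueness, where the field is controlled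
only on the frontier. -/
theorem IsSmoothJordanBoundary.exists_lipschitzOnWith {Ω : Set ℂ} {γ : ℝ → ℂ}
    (h : IsSmoothJordanBoundary Ω γ) {f : ℂ → ℂ} (hf : ContDiff ℝ 1 fun t => f (γ t)) :
    ∃ K : NNReal, LipschitzOnWith K f (frontier Ω) := by
  obtain ⟨c, hc, hca⟩ := h.exists_chord_arc
  set p : ℝ → ℂ := fun t => f (γ t) with hp
  have hper : Function.Periodic p 1 := fun t => by simp only [hp]; rw [h.periodic t]
  have hper' : Function.Periodic (deriv p) 1 := by
    intro t
    rw [← deriv_comp_add_const]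
    congr 1
    ext s
    exact hper s
  obtain ⟨B, hB⟩ := (hper'.isBounded_of_continuous one_ne_zero
    (hf.continuous_deriv le_rfl)).exists_norm_le
  have hB0 : 0 ≤ B := (norm_nonneg _).trans (hB _ (Set.mem_range_self 0))
  have hL : ∀ x y, ‖p x - p y‖ ≤ B * ‖x - y‖ := fun x y =>
    convex_univ.norm_image_sub_le_of_norm_deriv_le
      (fun t _ => hf.differentiable one_ne_zero t) (fun t _ => hB _ (Set.mem_range_self t))
      (Set.mem_univ y) (Set.mem_univ x)
  refine ⟨Real.toNNReal (B / c), LipschitzOnWith.of_dist_le_mul ?_⟩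
  intro z hz w hw
  rw [← h.range_eq] at hz hw
  obtain ⟨x, rfl⟩ := hz
  obtain ⟨y, rfl⟩ := hw
  set v : ℝ := (x - y) - round (x - y) with hv
  have hxv : γ (y + v) = γ x := by
    have := h.periodic.sub_zsmul_eq (x := x) (round (x - y))
    rw [zsmul_eq_mul, mul_one] at this
    rw [← this, hv]
    congr 1
    ring
  have h1 := hca y v (abs_sub_round _)
  have h2 := hL (y + v) y
  simp only [hp, hxv, add_sub_cancel_left] at h2
  rw [hxv] at h1
  rw [dist_eq_norm, dist_eq_norm, Real.coe_toNNReal _ (by positivity)]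
  calc _ ≤ B * ‖v‖ := h2
    _ = B / c * (c * |v|) := by rw [Real.norm_eq_abs]; field_simp
    _ ≤ _ := by gcongr

namespace IsExteriorDirichlet

variable {Ω : Set ℂ} {γ : ℝ → ℂ} {U : ℂ → ℝ} {Φ φ₀ : ℝ} {G G₁ G₂ : ℂ → ℂ}

theorem contDiff_complexGradient_boundary (h : IsExteriorDirichlet Ω γ U Φ φ₀) :
    ContDiff ℝ 1 fun t => complexGradient Ω U (γ t) := by
  rw [← contDiffOn_univ]
  exact h.contDiffOn_complexGradient.comp
    ((h.boundary.smooth.of_le (by exact_mod_cast le_top)).contDiffOn)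
    fun t _ => frontier_subset_closure (h.boundary.mem_frontier t)

/-- On the boundary, the isothermal coordinates are injective up to the period. -/
theorem exp_eq_of_boundary_eq (h : IsExteriorDirichlet Ω γ U Φ φ₀)
    (hG : IsLevelParam Ω U φ₀ (Φ / (2 * Real.pi)) G G₁ G₂) {θ θ' : ℝ}
    (e : G (θ * Complex.I) = G (θ' * Complex.I)) :
    Complex.exp (θ * Complex.I) = Complex.exp (θ' * Complex.I) := by
  set c : ℝ := Φ / (2 * Real.pi) with hc
  have hc0 : 0 < c := h.const_pos
  set F := complexGradient Ω U with hF
  have hcl : ∀ t, γ t ∈ closure Ω := fun t => frontier_subset_closure (h.boundary.mem_frontier t)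
  have hFγ : ∀ t, F (γ t) ≠ 0 := fun t => h.complexGradient_ne_zero (hcl t)
  set a : ℝ → ℝ := fun t => ‖F (γ t)‖ * ‖deriv γ t‖ with ha
  have hac : Continuous a :=
    h.contDiff_complexGradient_boundary.continuous.norm.mul h.boundary.continuous_deriv.norm
  have hapos : ∀ t, 0 < a t := fun t =>
    mul_pos (norm_pos_iff.2 (hFγ t)) (norm_pos_iff.2 (h.boundary.regular t))
  have haper : Function.Periodic a 1 := fun t => by
    simp only [ha]; rw [h.boundary.periodic t, h.boundary.periodic_deriv t]
  have hai : ∀ x y, IntervalIntegrable a MeasureTheory.volume x y := fun x y =>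
    hac.intervalIntegrable x y
  -- The angle swept along `γ`. It grows by `Φ / c = 2π` in each period, by the flux identity.
  set Θ : ℝ → ℝ := fun t => (∫ u in (0 : ℝ)..t, a u) / c with hΘ
  have hΘd : ∀ t, HasDerivAt Θ (a t / c) t := fun t =>
    (hac.integral_hasStrictDerivAt 0 t).hasDerivAt.div_const c
  have h_int : ∫ u in (0 : ℝ)..1, a u = Φ := h.integral_norm_complexGradient
  have hΘsurj : Function.Surjective Θ := by
    refine (continuous_iff_continuousAt.2 fun t => (hΘd t).continuousAt).surjective ?_ ?_
    · refine Filter.Tendsto.atTop_div_const hc0 ?_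
      exact haper.tendsto_atTop_intervalIntegral_of_pos' (hai 0 1) (fun t => hapos t) one_pos
    · refine Filter.Tendsto.atBot_div_const hc0 ?_
      exact haper.tendsto_atBot_intervalIntegral_of_pos' (hai 0 1) (fun t => hapos t) one_pos
  have hΘk : ∀ t (k : ℤ), Θ (t + k) = Θ t + k * (2 * Real.pi) := by
    intro t k
    have h1 := haper.intervalIntegral_add_zsmul_eq k t hai
    rw [zsmul_eq_mul, mul_one, zsmul_eq_mul] at h1
    have h2 := haper.intervalIntegral_add_eq t 0
    rw [zero_add] at h2
    rw [h2, h_int] at h1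
    simp only [hΘ]
    rw [← intervalIntegral.integral_add_adjacent_intervals (hai 0 t) (hai t (t + k)), h1, hc]
    have := h.flux_pos
    field_simp
  obtain ⟨s₀, hs₀, hG0⟩ := hG.surj (γ 0) (hcl 0)
  have hre : s₀.re = 0 := by
    have h1 := hG.potential s₀ hs₀
    rw [hG0, h.boundaryValue _ (h.boundary.mem_frontier 0)] at h1
    have : c * s₀.re = 0 := by linarith
    exact (mul_eq_zero.1 this).resolve_left hc0.ne'
  set θ₀ := s₀.im with hθ₀
  have hs₀' : s₀ = (0 : ℝ) + (θ₀ : ℝ) * Complex.I := by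
    rw [← Complex.re_add_im s₀, hre]
  set β : ℝ → ℂ := fun t => G ((0 : ℝ) + ((θ₀ + Θ t : ℝ) : ℂ) * Complex.I) with hβ
  have hnn : ∀ x : ℝ, 0 ≤ (((0 : ℝ) : ℂ) + (x : ℂ) * Complex.I).re := by intro x; simp
  have hF' : ∀ s : ℂ, 0 ≤ s.re → F (G s) ≠ 0 := fun s hs => h.complexGradient_ne_zero (hG.mem s hs)
  have hβd : ∀ t, HasDerivAt β (-(a t : ℂ) * Complex.I * (F (β t))⁻¹) t := by
    intro t
    have h1 := hasDerivAt_vertical hG.cont hG.cont₁ hG.deriv le_rfl (θ₀ + Θ t)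
    have h2 := HasDerivAt.scomp t h1 ((hΘd t).const_add θ₀)
    refine h2.congr_deriv ?_
    have h3 := hG.grad _ (hnn (θ₀ + Θ t))
    have h4 := hF' _ (hnn (θ₀ + Θ t))
    have h5 : G₁ ((0 : ℝ) + ((θ₀ + Θ t : ℝ) : ℂ) * Complex.I) = -c * (F (β t))⁻¹ := by
      rw [eq_mul_inv_iff_mul_eq₀ h4, mul_comm]
      exact h3
    rw [h5, Complex.real_smul]
    have : (c : ℂ) ≠ 0 := by exact_mod_cast hc0.ne'
    push_cast
    field_simp
  have hβf : ∀ t, β t ∈ frontier Ω := by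
    intro t
    refine h.mem_frontier_of_notMem (hG.mem _ (hnn _)) fun hmem => ?_
    have h1 := h.lt_boundaryValue _ hmem
    have h2 := hG.potential _ (hnn (θ₀ + Θ t))
    simp at h2
    simp only [hβ, Complex.ofReal_zero, zero_add, Complex.ofReal_add] at h1
    linarith
  have hγd : ∀ t, HasDerivAt γ (-(a t : ℂ) * Complex.I * (F (γ t))⁻¹) t := by
    intro t
    refine (h.boundary.hasDerivAt t).congr_deriv ?_
    have h1 := h.complexGradient_mul_normal t
    rw [eq_mul_inv_iff_mul_eq₀ (hFγ t)]
    have h2 : F (γ t) * (-Complex.I * deriv γ t) = -(a t : ℂ) := h1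
    rw [← h2]
    linear_combination ((F (γ t) * deriv γ t)) * Complex.I_mul_I
  obtain ⟨K, hK⟩ := h.boundary.exists_lipschitzOnWith (f := fun z => (F z)⁻¹)
    (h.contDiff_complexGradient_boundary.inv hFγ)
  obtain ⟨A, hA⟩ := (haper.isBounded_of_continuous one_ne_zero hac).exists_norm_le
  have hA0 : 0 ≤ A := (norm_nonneg _).trans (hA _ (Set.mem_range_self 0))
  -- Both curves lie in the frontier, solve `z' = -i a(t) / F(z)` and start at `γ 0`. Hence `G` on
  -- the axis is injective up to `2π` because `γ` is injective up to its period.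
  have heq : β = γ := by
    refine ODE_solution_unique_univ (K := A.toNNReal * K) (t₀ := 0)
      (v := fun t z => -(a t : ℂ) * Complex.I * (F z)⁻¹) (s := fun _ => frontier Ω) ?_
      (fun t => ⟨hβd t, hβf t⟩) (fun t => ⟨hγd t, h.boundary.mem_frontier t⟩) ?_
    · intro t
      refine LipschitzOnWith.of_dist_le_mul fun z hz w hw => ?_
      have h1 := hK.dist_le_mul z hz w hw
      rw [dist_eq_norm, ← mul_sub, norm_mul, NNReal.coe_mul, Real.coe_toNNReal _ hA0, mul_assoc]
      refine mul_le_mul ?_ (by rwa [← dist_eq_norm]) (norm_nonneg _) hA0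
      simpa using hA _ (Set.mem_range_self t)
    · simp only [hβ, hΘ, intervalIntegral.integral_same, zero_div, add_zero]
      rw [← hs₀', hG0]
  obtain ⟨x, hx⟩ := hΘsurj (θ - θ₀)
  obtain ⟨y, hy⟩ := hΘsurj (θ' - θ₀)
  have hx1 : γ x = γ y := by
    rw [← heq]
    simp only [hβ, hx, hy]
    simpa using e
  obtain ⟨k, hk⟩ := h.boundary.exists_int_of_eq hx1
  have hk2 : θ = θ' + k * (2 * Real.pi) := by
    have h1 := hΘk y k
    rw [show y + k = x by linarith, hx, hy] at h1
    linarith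
  rw [hk2]
  rw [Complex.exp_eq_exp_iff_exists_int]
  exact ⟨k, by push_cast; ring⟩

theorem exists_levelParam_injOn (h : IsExteriorDirichlet Ω γ U Φ φ₀) :
    ∃ G G₁ G₂ : ℂ → ℂ, IsLevelParam Ω U φ₀ (Φ / (2 * Real.pi)) G G₁ G₂ ∧
      ∀ t : ℝ, 0 ≤ t →
        Set.InjOn (fun θ : ℝ => G (t + θ * Complex.I)) (Set.Ico 0 (2 * Real.pi)) := by
  obtain ⟨G, G₁, G₂, hG, hinj⟩ := h.exists_levelParam
  refine ⟨G, G₁, G₂, hG, fun t ht θ hθ θ' hθ' e => ?_⟩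
  have hexp : Complex.exp (θ * Complex.I) = Complex.exp (θ' * Complex.I) := by
    rcases ht.eq_or_lt with rfl | ht
    · refine h.exp_eq_of_boundary_eq hG ?_
      simpa using e
    · have := hinj _ _ (by simpa using ht) (by simpa using ht) e
      rw [Complex.exp_add, Complex.exp_add] at this
      exact mul_left_cancel₀ (Complex.exp_ne_zero _) this
  obtain ⟨k, hk⟩ := Complex.exp_eq_exp_iff_exists_int.1 hexp
  have hk1 : θ = θ' + k * (2 * Real.pi) := by
    have := congrArg Complex.im hk
    simpa using this
  have hpi := Real.pi_pos
  have h1 : (k : ℝ) < 1 := by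
    by_contra! hcon
    nlinarith [hθ.2, hθ'.1]
  have h2 : (-1 : ℝ) < k := by
    by_contra! hcon
    nlinarith [hθ.1, hθ'.2]
  have hk0 : k = 0 := by
    have h1' : k < 1 := by exact_mod_cast h1
    have h2' : -1 < k := by exact_mod_cast h2
    omega
  rw [hk1, hk0]
  simp

end IsExteriorDirichlet

/-! ### Calculus of integrals over the level curves. -/

namespace IsLevelParam

variable {Ω : Set ℂ} {U : ℂ → ℝ} {φ₀ c t : ℝ} {G G₁ G₂ : ℂ → ℂ}

theorem re_nonneg_of (ht : 0 ≤ t) (θ : ℝ) : 0 ≤ ((t : ℂ) + θ * Complex.I).re := by simpa using ht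

theorem levelCurve_eq (hG : IsLevelParam Ω U φ₀ c G G₁ G₂) (hc : 0 < c) (ht : 0 ≤ t) :
    levelCurve Ω U (φ₀ - c * t) =
      (fun θ : ℝ => G (t + θ * Complex.I)) '' Set.Ico 0 (2 * Real.pi) := by
  apply Set.Subset.antisymm
  · rintro z ⟨hz, hzU⟩
    obtain ⟨s, hs, rfl⟩ := hG.surj z hz
    have hst : s.re = t := by
      have h1 := hG.potential s hs
      rw [hzU] at h1
      have : c * t = c * s.re := by linarith
      exact (mul_left_cancel₀ hc.ne' this).symm
    have hper : Function.Periodic (fun θ : ℝ => G (t + θ * Complex.I)) (2 * Real.pi) := by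
      intro θ
      have := hG.periodic _ (re_nonneg_of ht θ)
      simp only
      rw [← this]
      congr 1
      push_cast
      ring
    obtain ⟨θ, hθ, e⟩ := hper.exists_mem_Ico₀ (by positivity) s.im
    refine ⟨θ, hθ, ?_⟩
    refine e.symm.trans ?_
    rw [← hst, Complex.re_add_im]
  · rintro _ ⟨θ, -, rfl⟩
    refine ⟨hG.mem _ (re_nonneg_of ht θ), ?_⟩
    rw [hG.potential _ (re_nonneg_of ht θ)]
    simp

end IsLevelParam

theorem HasDerivAt.norm_complex {f : ℝ → ℂ} {f' : ℂ} {x : ℝ} (hf : HasDerivAt f f' x)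
    (h0 : f x ≠ 0) : HasDerivAt (fun x => ‖f x‖) (‖f x‖ * (f' / f x).re) x := by
  have h1 := hf.norm_sq
  have hn : ‖f x‖ ≠ 0 := norm_ne_zero_iff.2 h0
  have h2 := h1.sqrt (pow_ne_zero 2 hn)
  simp only [Real.sqrt_sq (norm_nonneg _)] at h2
  refine h2.congr_deriv ?_
  have h3 : (f' / f x).re = Inner.inner ℝ (f x) f' / ‖f x‖ ^ 2 := by
    rw [Complex.inner, Complex.div_re, ← Complex.normSq_eq_norm_sq]
    simp only [Complex.mul_re, Complex.conj_re, Complex.conj_im]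
    ring
  rw [h3]
  field_simp

theorem hasDerivWithinAt_Ici_of_hasDerivAt_Ioi {f f' : ℝ → ℝ} (hf : ContinuousOn f (Set.Ici 0))
    (hf' : ContinuousOn f' (Set.Ici 0)) (hd : ∀ t, 0 < t → HasDerivAt f (f' t) t) {t : ℝ}
    (ht : 0 ≤ t) : HasDerivWithinAt f (f' t) (Set.Ici 0) t := by
  rcases ht.eq_or_lt with rfl | ht
  · refine hasDerivWithinAt_Ici_of_tendsto_deriv (s := Set.Ioi 0)
      (fun t ht => (hd t ht).differentiableAt.differentiableWithinAt)
      ((hf 0 Set.self_mem_Ici).mono Set.Ioi_subset_Ici_self) self_mem_nhdsWithin ?_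
    refine (((hf' 0 Set.self_mem_Ici).mono Set.Ioi_subset_Ici_self).tendsto).congr' ?_
    filter_upwards [self_mem_nhdsWithin] with t ht using (hd t ht).deriv.symm
  · exact (hd t ht).hasDerivWithinAt

theorem continuous_vertical {E : Type*} [TopologicalSpace E] {f : ℂ → E} {t : ℝ}
    (hf : ContinuousOn f {s : ℂ | 0 ≤ s.re}) (ht : 0 ≤ t) :
    Continuous fun θ : ℝ => f (t + θ * Complex.I) :=
  hf.comp_continuous (by fun_prop) fun θ => by simpa using ht

theorem continuousOn_integral_vertical {f : ℂ → ℝ} (hf : ContinuousOn f {s : ℂ | 0 ≤ s.re})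
    (a b : ℝ) :
    ContinuousOn (fun t : ℝ => ∫ θ in a..b, f (t + θ * Complex.I)) (Set.Ici 0) := by
  -- Replacing `t` by `max t 0` makes the integrand continuous in both variables on the whole plane.
  have h1 : Continuous fun t : ℝ => ∫ θ in a..b, f ((max t 0 : ℝ) + θ * Complex.I) := by
    refine intervalIntegral.continuous_parametric_intervalIntegral_of_continuous'
      (f := fun (t : ℝ) (θ : ℝ) => f ((max t 0 : ℝ) + θ * Complex.I)) ?_ a b
    exact hf.comp_continuous (f := fun p : ℝ × ℝ => ((max p.1 0 : ℝ) : ℂ) + p.2 * Complex.I)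
      (by fun_prop) fun p => by simp
  refine h1.continuousOn.congr fun t ht => ?_
  simp only
  rw [max_eq_left ht]

theorem hasDerivAt_integral_vertical {f f' : ℂ → ℝ} (hf : ContinuousOn f {s : ℂ | 0 ≤ s.re})
    (hf' : ContinuousOn f' {s : ℂ | 0 < s.re})
    (hd : ∀ t θ : ℝ, 0 < t →
      HasDerivAt (fun t : ℝ => f (t + θ * Complex.I)) (f' (t + θ * Complex.I)) t)
    (a b : ℝ) {t : ℝ} (ht : 0 < t) :
    HasDerivAt (fun t : ℝ => ∫ θ in a..b, f (t + θ * Complex.I))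
      (∫ θ in a..b, f' (t + θ * Complex.I)) t := by
  refine hasDerivAt_intervalIntegral_of_continuousOn (s := Set.Ioi 0)
    (F := fun (t : ℝ) (θ : ℝ) => f (t + θ * Complex.I))
    (F' := fun (t : ℝ) (θ : ℝ) => f' (t + θ * Complex.I)) isOpen_Ioi
    (fun t ht θ => hd t θ ht) (fun t (ht : 0 < t) => continuous_vertical hf ht.le) ?_ ht
  exact hf'.comp (f := fun p : ℝ × ℝ => (p.1 : ℂ) + p.2 * Complex.I) (by fun_prop)
    fun p hp => by simpa using hp.1

theorem hasDerivAt_horizontal {f : ℂ → ℂ} {f' : ℂ} {t θ : ℝ}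
    (hf : HasDerivAt f f' (t + θ * Complex.I)) :
    HasDerivAt (fun t : ℝ => f (t + θ * Complex.I)) f' t := by
  have h1 : HasDerivAt (fun t : ℝ => (t : ℂ) + θ * Complex.I) 1 t :=
    (Complex.ofRealCLM.hasDerivAt (x := t)).add_const _
  exact (hf.scomp t h1).congr_deriv (by simp)

namespace IsLevelParam

variable {Ω : Set ℂ} {U : ℂ → ℝ} {φ₀ c t : ℝ} {G G₁ G₂ : ℂ → ℂ}

theorem ne_zero (hG : IsLevelParam Ω U φ₀ c G G₁ G₂) (hc : 0 < c) {s : ℂ} (hs : 0 ≤ s.re) :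
    G₁ s ≠ 0 := by
  intro h0
  have h1 := hG.grad s hs
  rw [h0, mul_zero, eq_comm, neg_eq_zero] at h1
  exact hc.ne' (by exact_mod_cast h1)

theorem continuousOn_quot (hG : IsLevelParam Ω U φ₀ c G G₁ G₂) (hc : 0 < c) :
    ContinuousOn (fun s => G₂ s / G₁ s) {s : ℂ | 0 ≤ s.re} :=
  hG.cont₂.div hG.cont₁ fun _ hs => hG.ne_zero hc hs

theorem differentiableOn_quot (hG : IsLevelParam Ω U φ₀ c G G₁ G₂) (hc : 0 < c) :
    DifferentiableOn ℂ (fun s => G₂ s / G₁ s) {s : ℂ | 0 < s.re} := by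
  have hopen : IsOpen {s : ℂ | 0 < s.re} := isOpen_lt continuous_const Complex.continuous_re
  have h1 : DifferentiableOn ℂ G₁ {s : ℂ | 0 < s.re} := fun s hs =>
    (hG.deriv₁ s hs).differentiableAt.differentiableWithinAt
  have h2 : DifferentiableOn ℂ G₂ {s : ℂ | 0 < s.re} :=
    (h1.deriv hopen).congr fun s hs => (hG.deriv₁ s hs).deriv.symm
  exact h2.div h1 fun s hs => hG.ne_zero hc (le_of_lt hs)

theorem periodic_quot (hG : IsLevelParam Ω U φ₀ c G G₁ G₂) (ht : 0 ≤ t) :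
    G₂ (t + (2 * Real.pi : ℝ) * Complex.I) / G₁ (t + (2 * Real.pi : ℝ) * Complex.I) =
      G₂ (t + (0 : ℝ) * Complex.I) / G₁ (t + (0 : ℝ) * Complex.I) := by
  have h0 := re_nonneg_of ht 0
  have h1 := hG.periodic₁ _ h0
  have h2 := hG.periodic₂ _ h0
  push_cast at h1 h2 ⊢
  simp only [zero_mul, add_zero] at h1 h2 ⊢
  rw [h1, h2]

theorem norm_periodic (hG : IsLevelParam Ω U φ₀ c G G₁ G₂) (ht : 0 ≤ t) :
    Function.Periodic (fun θ : ℝ => ‖G₁ (t + θ * Complex.I)‖) (2 * Real.pi) := by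
  intro θ
  have := hG.periodic₁ _ (re_nonneg_of ht θ)
  simp only
  rw [← this]
  congr 2
  push_cast
  ring

/-- The logarithmic derivative of `G₁` is `q = G₂ / G₁`. Moving vertically multiplies it by `i`, and
`Re (i q) = -Im q`. -/
theorem hasDerivAt_norm_vertical (hG : IsLevelParam Ω U φ₀ c G G₁ G₂) (hc : 0 < c) (ht : 0 ≤ t)
    (θ : ℝ) :
    HasDerivAt (fun θ : ℝ => ‖G₁ (t + θ * Complex.I)‖)
      (-(‖G₁ (t + θ * Complex.I)‖ * (G₂ (t + θ * Complex.I) / G₁ (t + θ * Complex.I)).im)) θ := by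
  have h1 := hasDerivAt_vertical hG.cont₁ hG.cont₂ hG.deriv₁ ht θ
  refine (h1.norm_complex (hG.ne_zero hc (re_nonneg_of ht θ))).congr_deriv ?_
  rw [mul_div_assoc, Complex.I_mul_re, mul_neg]

theorem hasDerivAt_norm_horizontal (hG : IsLevelParam Ω U φ₀ c G G₁ G₂) (hc : 0 < c) (ht : 0 < t)
    (θ : ℝ) :
    HasDerivAt (fun t : ℝ => ‖G₁ (t + θ * Complex.I)‖)
      (‖G₁ (t + θ * Complex.I)‖ * (G₂ (t + θ * Complex.I) / G₁ (t + θ * Complex.I)).re) t :=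
  (hasDerivAt_horizontal (hG.deriv₁ _ (by simpa using ht))).norm_complex
    (hG.ne_zero hc (re_nonneg_of ht.le θ))

theorem hasDerivAt_quot_horizontal (hG : IsLevelParam Ω U φ₀ c G G₁ G₂) (hc : 0 < c) (ht : 0 < t)
    (θ : ℝ) :
    HasDerivAt (fun t : ℝ => G₂ (t + θ * Complex.I) / G₁ (t + θ * Complex.I))
      (_root_.deriv (fun s => G₂ s / G₁ s) (t + θ * Complex.I)) t := by
  have hs : (t + θ * Complex.I : ℂ) ∈ {s : ℂ | 0 < s.re} := by simpa using ht
  exact hasDerivAt_horizontal ((hG.differentiableOn_quot hc).differentiableAt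
    ((isOpen_lt continuous_const Complex.continuous_re).mem_nhds hs)).hasDerivAt

theorem hasDerivAt_quot_vertical (hG : IsLevelParam Ω U φ₀ c G G₁ G₂) (hc : 0 < c) (ht : 0 < t)
    (θ : ℝ) :
    HasDerivAt (fun θ : ℝ => G₂ (t + θ * Complex.I) / G₁ (t + θ * Complex.I))
      (Complex.I * _root_.deriv (fun s => G₂ s / G₁ s) (t + θ * Complex.I)) θ := by
  have hs : (t + θ * Complex.I : ℂ) ∈ {s : ℂ | 0 < s.re} := by simpa using ht
  have h1 := ((hG.differentiableOn_quot hc).differentiableAt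
    ((isOpen_lt continuous_const Complex.continuous_re).mem_nhds hs)).hasDerivAt
  have h2 : HasDerivAt (fun θ : ℝ => (t : ℂ) + θ * Complex.I) Complex.I θ := by
    have := ((Complex.ofRealCLM.hasDerivAt (x := θ)).mul_const Complex.I).const_add (t : ℂ)
    exact this.congr_deriv (by simp)
  exact h1.scomp θ h2

theorem continuousOn_deriv_quot (hG : IsLevelParam Ω U φ₀ c G G₁ G₂) (hc : 0 < c) :
    ContinuousOn (_root_.deriv fun s => G₂ s / G₁ s) {s : ℂ | 0 < s.re} :=
  ((hG.differentiableOn_quot hc).deriv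
    (isOpen_lt continuous_const Complex.continuous_re)).continuousOn

theorem hasDerivAt_length (hG : IsLevelParam Ω U φ₀ c G G₁ G₂) (hc : 0 < c) (ht : 0 < t) :
    HasDerivAt (fun t : ℝ => ∫ θ in (0 : ℝ)..2 * Real.pi, ‖G₁ (t + θ * Complex.I)‖)
      (∫ θ in (0 : ℝ)..2 * Real.pi, ‖G₁ (t + θ * Complex.I)‖ *
        (G₂ (t + θ * Complex.I) / G₁ (t + θ * Complex.I)).re) t :=
  hasDerivAt_integral_vertical (f := fun s => ‖G₁ s‖) (f' := fun s => ‖G₁ s‖ * (G₂ s / G₁ s).re)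
    hG.cont₁.norm
    ((hG.cont₁.norm.mul (Complex.continuous_re.comp_continuousOn (hG.continuousOn_quot hc))).mono
      fun s (hs : 0 < s.re) => hs.le)
    (fun _ θ ht => hG.hasDerivAt_norm_horizontal hc ht θ) 0 (2 * Real.pi) ht

/-- Direct differentiation gives the integrand `‖G₁‖ ((Re q)² + Re q')`. The `θ`-derivative of `‖G₁‖
Im q` is `‖G₁‖ (Re q' - (Im q)²)` and integrates to zero over a period; subtracting it removes `q'`
and leaves `‖G₁‖ ‖q‖²`. -/
theorem hasDerivAt_deriv_length (hG : IsLevelParam Ω U φ₀ c G G₁ G₂) (hc : 0 < c) (ht : 0 < t) :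
    HasDerivAt (fun t : ℝ => ∫ θ in (0 : ℝ)..2 * Real.pi, ‖G₁ (t + θ * Complex.I)‖ *
        (G₂ (t + θ * Complex.I) / G₁ (t + θ * Complex.I)).re)
      (∫ θ in (0 : ℝ)..2 * Real.pi, ‖G₁ (t + θ * Complex.I)‖ *
        ‖G₂ (t + θ * Complex.I) / G₁ (t + θ * Complex.I)‖ ^ 2) t := by
  set q : ℂ → ℂ := fun s => G₂ s / G₁ s with hq
  set q' : ℂ → ℂ := _root_.deriv q with hq'
  have hn : ContinuousOn (fun s => ‖G₁ s‖) {s : ℂ | 0 ≤ s.re} := hG.cont₁.norm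
  have hqc : ContinuousOn q {s : ℂ | 0 ≤ s.re} := hG.continuousOn_quot hc
  have hsub : {s : ℂ | 0 < s.re} ⊆ {s : ℂ | 0 ≤ s.re} := fun s (hs : 0 < s.re) => hs.le
  have hre : ContinuousOn (fun s => (q s).re) {s : ℂ | 0 ≤ s.re} :=
    Complex.continuous_re.comp_continuousOn hqc
  have hq'c : ContinuousOn (fun s => (q' s).re) {s : ℂ | 0 < s.re} :=
    Complex.continuous_re.comp_continuousOn (hG.continuousOn_deriv_quot hc)
  have h1 := hasDerivAt_integral_vertical (f := fun s => ‖G₁ s‖ * (q s).re)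
    (f' := fun s => ‖G₁ s‖ * (q s).re * (q s).re + ‖G₁ s‖ * (q' s).re) (hn.mul hre)
    ((((hn.mul hre).mul hre).mono hsub).add ((hn.mono hsub).mul hq'c))
    (fun t θ ht => (hG.hasDerivAt_norm_horizontal hc ht θ).mul
      (Complex.reCLM.hasFDerivAt.comp_hasDerivAt t (hG.hasDerivAt_quot_horizontal hc ht θ)))
    0 (2 * Real.pi) ht
  refine h1.congr_deriv ?_
  have hv : ∀ {f : ℂ → ℝ}, ContinuousOn f {s : ℂ | 0 < s.re} →
      Continuous fun θ : ℝ => f (t + θ * Complex.I) := fun hf =>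
    hf.comp_continuous (by fun_prop) fun θ => by simpa using ht
  have him : ContinuousOn (fun s => (q s).im) {s : ℂ | 0 < s.re} :=
    (Complex.continuous_im.comp_continuousOn hqc).mono hsub
  have h2 : ∫ θ in (0 : ℝ)..2 * Real.pi, (-(‖G₁ (t + θ * Complex.I)‖ * (q (t + θ * Complex.I)).im) *
      (q (t + θ * Complex.I)).im + ‖G₁ (t + θ * Complex.I)‖ *
        (Complex.I * q' (t + θ * Complex.I)).im) = 0 := by
    refine (intervalIntegral.integral_eq_sub_of_hasDerivAt
      (f := fun θ : ℝ => ‖G₁ (t + θ * Complex.I)‖ * (q (t + θ * Complex.I)).im)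
      (fun θ _ => (hG.hasDerivAt_norm_vertical hc ht.le θ).mul
        (Complex.imCLM.hasFDerivAt.comp_hasDerivAt θ (hG.hasDerivAt_quot_vertical hc ht θ)))
      ?_).trans ?_
    rotate_left
    · have e1 := hG.periodic_quot ht.le
      have e2 := hG.norm_periodic ht.le 0
      simp only [zero_add] at e2
      exact sub_eq_zero.2 (congrArg₂ (· * ·) e2 (congrArg Complex.im e1))
    · refine Continuous.intervalIntegrable ?_ _ _
      simp only [Complex.imCLM_apply, Complex.I_mul_im]
      exact hv ((((hn.mono hsub).mul him).neg.mul him).add ((hn.mono hsub).mul hq'c))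
  rw [← sub_eq_zero, ← intervalIntegral.integral_sub]
  · refine Eq.trans ?_ h2
    refine intervalIntegral.integral_congr fun θ _ => ?_
    simp only [Complex.I_mul_im, ← Complex.normSq_eq_norm_sq, Complex.normSq_apply]
    ring
  · exact (hv ((((hn.mul hre).mul hre).mono hsub).add ((hn.mono hsub).mul hq'c))).intervalIntegrable
      _ _
  · exact (hv ((hn.mul (hqc.norm.pow 2)).mono hsub)).intervalIntegrable _ _

theorem hasDerivAt_integral_log (hG : IsLevelParam Ω U φ₀ c G G₁ G₂) (hc : 0 < c) (ht : 0 < t) :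
    HasDerivAt (fun t : ℝ => ∫ θ in (0 : ℝ)..2 * Real.pi, Real.log ‖G₁ (t + θ * Complex.I)‖)
      (∫ θ in (0 : ℝ)..2 * Real.pi, (G₂ (t + θ * Complex.I) / G₁ (t + θ * Complex.I)).re) t := by
  refine hasDerivAt_integral_vertical (f := fun s => Real.log ‖G₁ s‖)
    (f' := fun s => (G₂ s / G₁ s).re)
    (hG.cont₁.norm.log fun s hs => norm_ne_zero_iff.2 (hG.ne_zero hc hs))
    ((Complex.continuous_re.comp_continuousOn (hG.continuousOn_quot hc)).mono
      fun s (hs : 0 < s.re) => hs.le)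
    (fun t θ ht => ?_) 0 (2 * Real.pi) ht
  have h0 : ‖G₁ (t + θ * Complex.I)‖ ≠ 0 :=
    norm_ne_zero_iff.2 (hG.ne_zero hc (re_nonneg_of ht.le θ))
  exact ((hG.hasDerivAt_norm_horizontal hc ht θ).log h0).congr_deriv (mul_div_cancel_left₀ _ h0)

/-- By Cauchy–Riemann, `Re q'` is the `θ`-derivative of `Im q`, which is periodic. So the mean of
the harmonic function `log ‖G₁‖` is affine in `t`, and it drops out of the second derivative of the
entropy. -/
theorem hasDerivAt_deriv_integral_log (hG : IsLevelParam Ω U φ₀ c G G₁ G₂) (hc : 0 < c)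
    (ht : 0 < t) :
    HasDerivAt (fun t : ℝ => ∫ θ in (0 : ℝ)..2 * Real.pi,
      (G₂ (t + θ * Complex.I) / G₁ (t + θ * Complex.I)).re) 0 t := by
  have hq'c : ContinuousOn (fun s => (_root_.deriv (fun s => G₂ s / G₁ s) s).re) {s : ℂ | 0 < s.re} :=
    Complex.continuous_re.comp_continuousOn (hG.continuousOn_deriv_quot hc)
  have h1 := hasDerivAt_integral_vertical (f := fun s => (G₂ s / G₁ s).re)
    (Complex.continuous_re.comp_continuousOn (hG.continuousOn_quot hc)) hq'c
    (fun t θ ht => Complex.reCLM.hasFDerivAt.comp_hasDerivAt t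
      (hG.hasDerivAt_quot_horizontal hc ht θ)) 0 (2 * Real.pi) ht
  refine h1.congr_deriv ?_
  rw [intervalIntegral.integral_eq_sub_of_hasDerivAt
      (f := fun θ : ℝ => (G₂ (t + θ * Complex.I) / G₁ (t + θ * Complex.I)).im)
      (fun θ _ => (Complex.imCLM.hasFDerivAt.comp_hasDerivAt θ
        (hG.hasDerivAt_quot_vertical hc ht θ)).congr_deriv (by simp))]
  · rw [hG.periodic_quot ht.le, sub_self]
  · exact (hq'c.comp_continuous (by fun_prop) fun θ => by simpa using ht).intervalIntegrable _ _

end IsLevelParam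

/-! ### From the parameter `t` to the potential `φ`. -/

/-- Second-order calculus on `(-∞, b]` after the affine substitution `x = b - c t`. -/
theorem contDiffOn_and_iteratedDerivWithin_Iic {f g g₁ g₂ : ℝ → ℝ} {b c : ℝ} (hc : 0 < c)
    (hg : ∀ t, 0 ≤ t → HasDerivWithinAt g (g₁ t) (Set.Ici 0) t)
    (hg₁ : ∀ t, 0 ≤ t → HasDerivWithinAt g₁ (g₂ t) (Set.Ici 0) t)
    (hg₂ : ContinuousOn g₂ (Set.Ici 0)) (hf : ∀ t, 0 ≤ t → f (b - c * t) = g t) :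
    ContDiffOn ℝ 2 f (Set.Iic b) ∧
      (∀ t, 0 ≤ t → iteratedDerivWithin 2 f (Set.Iic b) (b - c * t) = g₂ t / c ^ 2) ∧
      ((∀ t, 0 ≤ t → 0 ≤ g₂ t) → ConvexOn ℝ (Set.Iic b) f) := by
  set τ : ℝ → ℝ := fun x => (b - x) / c with hτ
  have hτ0 : ∀ x ∈ Set.Iic b, 0 ≤ τ x := fun x hx => div_nonneg (sub_nonneg.2 hx) hc.le
  have hτm : Set.MapsTo τ (Set.Iic b) (Set.Ici 0) := hτ0
  have hτx : ∀ x, b - c * τ x = x := fun x => by simp only [hτ]; field_simp; ring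
  have hτt : ∀ t, τ (b - c * t) = t := fun t => by simp only [hτ]; field_simp; ring
  have hτd : ∀ x s, HasDerivWithinAt τ (-1 / c) s x := fun x s =>
    ((hasDerivWithinAt_id x s).const_sub b).div_const c
  have hfe : Set.EqOn f (fun x => g (τ x)) (Set.Iic b) := fun x hx => by
    simp only
    rw [← hf _ (hτ0 x hx), hτx]
  have hd : ∀ x ∈ Set.Iic b, HasDerivWithinAt f (g₁ (τ x) * (-1 / c)) (Set.Iic b) x := fun x hx =>
    ((hg _ (hτ0 x hx)).comp x (hτd x _) hτm).congr hfe (hfe hx)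
  have hd₁ : ∀ x ∈ Set.Iic b, HasDerivWithinAt (fun x => g₁ (τ x) * (-1 / c))
      (g₂ (τ x) / c ^ 2) (Set.Iic b) x := fun x hx =>
    (((hg₁ _ (hτ0 x hx)).comp x (hτd x _) hτm).mul_const (-1 / c)).congr_deriv (by ring)
  have hu : UniqueDiffOn ℝ (Set.Iic b) := uniqueDiffOn_Iic b
  have e₁ : Set.EqOn (derivWithin f (Set.Iic b)) (fun x => g₁ (τ x) * (-1 / c)) (Set.Iic b) :=
    fun x hx => (hd x hx).derivWithin (hu x hx)
  have e₂ : Set.EqOn (derivWithin (derivWithin f (Set.Iic b)) (Set.Iic b))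
      (fun x => g₂ (τ x) / c ^ 2) (Set.Iic b) := fun x hx => by
    rw [derivWithin_congr e₁ (e₁ hx)]
    exact (hd₁ x hx).derivWithin (hu x hx)
  refine ⟨?_, ?_, ?_⟩
  · rw [show (2 : WithTop ℕ∞) = 1 + 1 from one_add_one_eq_two.symm,
      contDiffOn_succ_iff_derivWithin hu]
    refine ⟨fun x hx => (hd x hx).differentiableWithinAt, by simp, ?_⟩
    rw [contDiffOn_one_iff_derivWithin hu]
    refine ⟨fun x hx => ((hd₁ x hx).congr e₁ (e₁ hx)).differentiableWithinAt, ?_⟩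
    refine ContinuousOn.congr ?_ e₂
    exact (hg₂.comp (fun x _ => (hτd x _).continuousWithinAt) hτm).div_const _
  · intro t ht
    have hx : b - c * t ∈ Set.Iic b := sub_le_self _ (mul_nonneg hc.le ht)
    rw [iteratedDerivWithin_succ, iteratedDerivWithin_one]
    refine (e₂ hx).trans ?_
    simp only [hτt]
  · intro h0
    have hi : interior (Set.Iic b) ⊆ Set.Iic b := interior_subset
    refine convexOn_of_hasDerivWithinAt2_nonneg (convex_Iic b)
      (fun x hx => (hd x hx).continuousWithinAt) (fun x hx => (hd x (hi hx)).mono hi)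
      (fun x hx => (hd₁ x (hi hx)).mono hi) fun x hx => ?_
    have := h0 _ (hτ0 x (hi hx))
    positivity

/-! ### Field strength, normal and curvature in isothermal coordinates. -/

namespace IsLevelParam

variable {Ω : Set ℂ} {U : ℂ → ℝ} {φ₀ c t : ℝ} {G G₁ G₂ : ℂ → ℂ}

theorem norm_pos (hG : IsLevelParam Ω U φ₀ c G G₁ G₂) (hc : 0 < c) (ht : 0 ≤ t) (θ : ℝ) :
    0 < ‖G₁ (t + θ * Complex.I)‖ :=
  norm_pos_iff.2 (hG.ne_zero hc (re_nonneg_of ht θ))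

theorem fieldStrength_eq (hG : IsLevelParam Ω U φ₀ c G G₁ G₂) (hc : 0 < c) {s : ℂ}
    (hs : 0 ≤ s.re) : fieldStrength Ω U (G s) = c / ‖G₁ s‖ := by
  rw [fieldStrength_eq_norm, eq_div_iff (norm_ne_zero_iff.2 (hG.ne_zero hc hs)), ← norm_mul,
    hG.grad s hs, norm_neg, Complex.norm_real, Real.norm_eq_abs, abs_of_pos hc]

theorem levelNormal_eq_div (hG : IsLevelParam Ω U φ₀ c G G₁ G₂) (hc : 0 < c) {s : ℂ}
    (hs : 0 ≤ s.re) : levelNormal Ω U (G s) = (‖G₁ s‖⁻¹ : ℝ) • G₁ s := by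
  have h0 := hG.ne_zero hc hs
  have hn : ‖G₁ s‖ ≠ 0 := norm_ne_zero_iff.2 h0
  have hc' : (c : ℂ) ≠ 0 := by exact_mod_cast hc.ne'
  have hF : complexGradient Ω U (G s) = -c / G₁ s := by
    rw [eq_div_iff h0]; exact hG.grad s hs
  have hcn : (starRingEnd ℂ) (G₁ s) ≠ 0 := (map_ne_zero _).2 h0
  have hm : (‖G₁ s‖ : ℂ) * ‖G₁ s‖ = (starRingEnd ℂ) (G₁ s) * G₁ s := by
    rw [mul_comm ((starRingEnd ℂ) (G₁ s)), Complex.mul_conj, Complex.normSq_eq_norm_sq]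
    push_cast
    ring
  have hn' : (‖G₁ s‖ : ℂ) ≠ 0 := by exact_mod_cast hn
  rw [levelNormal_eq, ← fieldStrength_eq_norm, hG.fieldStrength_eq hc hs, hF]
  simp only [map_div₀, map_neg, Complex.conj_ofReal, Complex.real_smul]
  push_cast
  field_simp
  linear_combination hm

/-- The normal is the direction `G₁ / ‖G₁‖`, so it only rotates, at the rate `Im (i q) = Re q`. -/
theorem hasDerivAt_levelNormal (hG : IsLevelParam Ω U φ₀ c G G₁ G₂) (hc : 0 < c) (ht : 0 ≤ t)
    (θ : ℝ) :
    HasDerivAt (fun θ : ℝ => levelNormal Ω U (G (t + θ * Complex.I)))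
      (((G₂ (t + θ * Complex.I) / G₁ (t + θ * Complex.I)).re : ℝ) •
        (Complex.I * levelNormal Ω U (G (t + θ * Complex.I)))) θ := by
  have hn := hG.norm_pos hc ht θ
  have h0 := hG.ne_zero hc (re_nonneg_of ht θ)
  have h1 := hasDerivAt_vertical hG.cont₁ hG.cont₂ hG.deriv₁ ht θ
  have h2 := ((hG.hasDerivAt_norm_vertical hc ht θ).inv hn.ne').smul h1
  have h3 : HasDerivAt (fun θ : ℝ => levelNormal Ω U (G (t + θ * Complex.I))) _ θ :=
    h2.congr_of_eventuallyEq (Filter.Eventually.of_forall fun θ =>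
      hG.levelNormal_eq_div hc (re_nonneg_of ht θ))
  refine h3.congr_deriv ?_
  rw [hG.levelNormal_eq_div hc (re_nonneg_of ht θ)]
  set s : ℂ := t + θ * Complex.I
  change (‖G₁ s‖⁻¹ : ℝ) • (Complex.I * G₂ s) +
    (- -(‖G₁ s‖ * (G₂ s / G₁ s).im) / ‖G₁ s‖ ^ 2) • G₁ s = _
  generalize hqd : G₂ s / G₁ s = q
  rw [(div_eq_iff h0).1 hqd]
  have hn' : (‖G₁ s‖ : ℂ) ≠ 0 := by exact_mod_cast hn.ne'
  have hq := Complex.re_add_im q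
  simp only [Complex.real_smul]
  push_cast
  field_simp
  linear_combination (-Complex.I) * hq + (q.im : ℂ) * Complex.I_mul_I

end IsLevelParam

namespace IsExteriorDirichlet

variable {Ω : Set ℂ} {γ : ℝ → ℂ} {U : ℂ → ℝ} {Φ φ₀ c t : ℝ} {G G₁ G₂ : ℂ → ℂ}

theorem differentiableOn_levelNormal (h : IsExteriorDirichlet Ω γ U Φ φ₀) :
    DifferentiableOn ℝ (levelNormal Ω U) (closure Ω) := by
  have h1 : DifferentiableOn ℝ (complexGradient Ω U) (closure Ω) :=
    h.contDiffOn_complexGradient.differentiableOn one_ne_zero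
  have h2 : DifferentiableOn ℝ (fun z => ‖complexGradient Ω U z‖) (closure Ω) := fun z hz =>
    (h1 z hz).norm ℝ (h.complexGradient_ne_zero hz)
  have h3 : DifferentiableOn ℝ (fun z => starRingEnd ℂ (complexGradient Ω U z)) (closure Ω) :=
    Complex.conjCLE.differentiable.comp_differentiableOn h1
  refine ((h2.inv fun z hz => norm_ne_zero_iff.2 (h.complexGradient_ne_zero hz)).smul h3).neg.congr
    fun z _ => levelNormal_eq z

theorem levelCurvature_eq (h : IsExteriorDirichlet Ω γ U Φ φ₀)
    (hG : IsLevelParam Ω U φ₀ c G G₁ G₂) (hc : 0 < c) (ht : 0 ≤ t) (θ : ℝ) :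
    levelCurvature Ω U (G (t + θ * Complex.I)) =
      (G₂ (t + θ * Complex.I) / G₁ (t + θ * Complex.I)).re / ‖G₁ (t + θ * Complex.I)‖ := by
  have hs := IsLevelParam.re_nonneg_of ht θ
  have hn := hG.norm_pos hc ht θ
  have h1 := (h.differentiableOn_levelNormal _ (hG.mem _ hs)).hasFDerivWithinAt.comp_hasDerivAt θ
    (hasDerivAt_vertical hG.cont hG.cont₁ hG.deriv ht θ)
    (Filter.Eventually.of_forall fun θ => hG.mem _ (IsLevelParam.re_nonneg_of ht θ))
  have h2 := h1.unique (hG.hasDerivAt_levelNormal hc ht θ)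
  have hN := hG.levelNormal_eq_div hc hs
  rw [levelCurvature]
  set s : ℂ := t + θ * Complex.I
  set N := levelNormal Ω U (G s)
  have e1 : Complex.I * N = (‖G₁ s‖⁻¹ : ℝ) • (Complex.I * G₁ s) := by
    rw [hN, mul_smul_comm]
  have e2 : ‖Complex.I * N‖ = 1 := by
    rw [hN, norm_mul, Complex.norm_I, one_mul, norm_smul, Real.norm_eq_abs,
      abs_of_pos (inv_pos.2 hn), inv_mul_cancel₀ hn.ne']
  -- The vertical derivative of `G` is `i G₁ = ‖G₁‖ (i N)`; dividing the rotation rate in `θ` by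
  -- this speed gives the rate per arc length.
  have e3 : fderivWithin ℝ (levelNormal Ω U) (closure Ω) (G s) (Complex.I * N) =
      ((G₂ s / G₁ s).re / ‖G₁ s‖) • (Complex.I * N) := by
    conv_lhs => rw [e1]
    rw [map_smul, h2, smul_smul]
    congr 1
    ring
  rw [e3, real_inner_smul_right, real_inner_self_eq_norm_sq, e2]
  ring

theorem hausdorffMeasure_levelCurve (hG : IsLevelParam Ω U φ₀ c G G₁ G₂) (hc : 0 < c) (ht : 0 ≤ t)
    (hinj : Set.InjOn (fun θ : ℝ => G (t + θ * Complex.I)) (Set.Ico 0 (2 * Real.pi))) :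
    μH[1] (levelCurve Ω U (φ₀ - c * t)) =
      ENNReal.ofReal (∫ θ in (0 : ℝ)..2 * Real.pi, ‖G₁ (t + θ * Complex.I)‖) := by
  rw [hG.levelCurve_eq hc ht, hausdorffMeasure_image_Ico
    (hasDerivAt_vertical hG.cont hG.cont₁ hG.deriv ht)
    (continuous_const.mul (continuous_vertical hG.cont₁ ht)) (by positivity) hinj]
  simp

end IsExteriorDirichlet

/-! ### Variance, entropy and the final assembly. -/

/-- The weighted variance of a continuous function is nonnegative and vanishes only for real
constants. -/
theorem weighted_variance {n : ℝ → ℝ} {q : ℝ → ℂ} (hn : Continuous n) (hq : Continuous q)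
    (hpos : ∀ x, 0 < n x) {a b : ℝ} (hab : a < b) :
    0 ≤ (∫ x in a..b, n x * ‖q x‖ ^ 2) / (∫ x in a..b, n x) -
        ((∫ x in a..b, n x * (q x).re) / ∫ x in a..b, n x) ^ 2 ∧
      ((∫ x in a..b, n x * ‖q x‖ ^ 2) / (∫ x in a..b, n x) -
        ((∫ x in a..b, n x * (q x).re) / ∫ x in a..b, n x) ^ 2 = 0 ↔
        ∃ r : ℝ, ∀ x ∈ Set.Icc a b, q x = r) := by
  have hre : Continuous fun x => (q x).re := Complex.continuous_re.comp hq
  set L := ∫ x in a..b, n x with hL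
  have hL0 : 0 < L := intervalIntegral.intervalIntegral_pos_of_pos (hn.intervalIntegrable a b)
    hpos hab
  set m := (∫ x in a..b, n x * (q x).re) / L with hm
  have hc : Continuous fun x => n x * ‖q x - m‖ ^ 2 := by fun_prop
  -- Since `m` is the weighted mean of `Re q` and is real, expanding `‖q - m‖²` leaves exactly this
  -- difference; the imaginary part of `q` is penalized in full.
  have hid : (∫ x in a..b, n x * ‖q x‖ ^ 2) / L - m ^ 2 =
      (∫ x in a..b, n x * ‖q x - m‖ ^ 2) / L := by
    have h1 : ∀ x, n x * ‖q x - m‖ ^ 2 =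
        n x * ‖q x‖ ^ 2 - 2 * m * (n x * (q x).re) + m ^ 2 * n x := by
      intro x
      rw [← Complex.normSq_eq_norm_sq, ← Complex.normSq_eq_norm_sq, Complex.normSq_apply,
        Complex.normSq_apply]
      simp only [Complex.sub_re, Complex.sub_im, Complex.ofReal_re, Complex.ofReal_im]
      ring
    have h2 : Continuous fun x => n x * ‖q x‖ ^ 2 := by fun_prop
    have h3 : Continuous fun x => 2 * m * (n x * (q x).re) := by fun_prop
    have h4 : Continuous fun x => m ^ 2 * n x := by fun_prop
    simp_rw [h1]
    have h23 : Continuous fun x => n x * ‖q x‖ ^ 2 - 2 * m * (n x * (q x).re) := by fun_prop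
    rw [intervalIntegral.integral_add (h23.intervalIntegrable a b)
      (h4.intervalIntegrable a b), intervalIntegral.integral_sub (h2.intervalIntegrable a b)
      (h3.intervalIntegrable a b), intervalIntegral.integral_const_mul,
      intervalIntegral.integral_const_mul, ← hL]
    have h5 : ∫ x in a..b, n x * (q x).re = m * L := by
      rw [hm]; field_simp
    rw [h5]
    field_simp
    ring
  have hnn : ∀ x, 0 ≤ n x * ‖q x - m‖ ^ 2 := fun x => mul_nonneg (hpos x).le (sq_nonneg _)
  constructor
  · rw [hid]
    exact div_nonneg (intervalIntegral.integral_nonneg hab.le fun x _ => hnn x) hL0.le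
  · constructor
    · intro h0
      refine ⟨m, fun x hx => ?_⟩
      by_contra hne
      have : 0 < ∫ x in a..b, n x * ‖q x - m‖ ^ 2 :=
        intervalIntegral.integral_pos hab hc.continuousOn (fun x _ => hnn x)
          ⟨x, hx, mul_pos (hpos x) (pow_pos (norm_pos_iff.2 (sub_ne_zero.2 hne)) 2)⟩
      rw [hid] at h0
      exact (div_pos this hL0).ne' h0
    · rintro ⟨r, hr⟩
      have h1 : ∫ x in a..b, n x * ‖q x‖ ^ 2 = L * r ^ 2 := by
        rw [hL, ← intervalIntegral.integral_mul_const]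
        refine intervalIntegral.integral_congr fun x hx => ?_
        rw [Set.uIcc_of_le hab.le] at hx
        rw [hr x hx, Complex.norm_real, Real.norm_eq_abs, sq_abs]
      have h2 : ∫ x in a..b, n x * (q x).re = L * r := by
        rw [hL, ← intervalIntegral.integral_mul_const]
        refine intervalIntegral.integral_congr fun x hx => ?_
        rw [Set.uIcc_of_le hab.le] at hx
        rw [hr x hx, Complex.ofReal_re]
      rw [h1, hm, h2]
      field_simp
      ring

namespace IsExteriorDirichlet

variable {Ω : Set ℂ} {γ : ℝ → ℂ} {U : ℂ → ℝ} {Φ φ₀ t : ℝ} {G G₁ G₂ : ℂ → ℂ}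

theorem entropyDensity_eq (h : IsExteriorDirichlet Ω γ U Φ φ₀)
    (hG : IsLevelParam Ω U φ₀ (Φ / (2 * Real.pi)) G G₁ G₂) (ht : 0 ≤ t) {φ : ℝ}
    (hL : 0 < levelLength Ω U φ) (θ : ℝ) :
    entropyDensity Ω U Φ φ (G (t + θ * Complex.I)) =
      (2 * Real.pi * ‖G₁ (t + θ * Complex.I)‖)⁻¹ * (Real.log (levelLength Ω U φ) -
        Real.log (2 * Real.pi) - Real.log ‖G₁ (t + θ * Complex.I)‖) := by
  have hn := hG.norm_pos h.const_pos ht θ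
  have hΦ := h.flux_pos
  have hpi := Real.pi_pos
  rw [entropyDensity, hG.fieldStrength_eq h.const_pos (IsLevelParam.re_nonneg_of ht θ)]
  rw [sub_sub, ← Real.log_mul (by positivity) hn.ne', ← Real.log_div hL.ne' (by positivity)]
  congr 1
  · field_simp
  · congr 1
    field_simp

/-- The factor `E / Φ = 1 / (2π ‖G₁‖)` cancels the arc-length element `‖G₁‖ dθ`, so the entropy is
an average over the uniform measure `dθ / 2π`. -/
theorem entropy_eq (h : IsExteriorDirichlet Ω γ U Φ φ₀)
    (hG : IsLevelParam Ω U φ₀ (Φ / (2 * Real.pi)) G G₁ G₂) (ht : 0 ≤ t)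
    (hinj : Set.InjOn (fun θ : ℝ => G (t + θ * Complex.I)) (Set.Ico 0 (2 * Real.pi)))
    {φ : ℝ} (hφ : φ = φ₀ - Φ / (2 * Real.pi) * t) (hL : 0 < levelLength Ω U φ) :
    MeasureTheory.IntegrableOn (entropyDensity Ω U Φ φ) (levelCurve Ω U φ) μH[1] ∧
      levelEntropy Ω U Φ φ = Real.log (levelLength Ω U φ) - Real.log (2 * Real.pi) -
        (∫ θ in (0 : ℝ)..2 * Real.pi, Real.log ‖G₁ (t + θ * Complex.I)‖) / (2 * Real.pi) := by
  have hpi := Real.pi_pos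
  have hn := hG.norm_pos h.const_pos ht
  have hnc : Continuous fun θ : ℝ => ‖G₁ (t + θ * Complex.I)‖ :=
    continuous_vertical hG.cont₁.norm ht
  have hlog : Continuous fun θ : ℝ => Real.log ‖G₁ (t + θ * Complex.I)‖ :=
    hnc.log fun θ => (hn θ).ne'
  have hcont : Continuous fun θ : ℝ => entropyDensity Ω U Φ φ (G (t + θ * Complex.I)) := by
    simp_rw [h.entropyDensity_eq hG ht hL]
    exact ((continuous_const.mul hnc).inv₀ fun θ => (mul_pos (by positivity) (hn θ)).ne').mul
      (continuous_const.sub hlog)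
  have h1 := integral_image_hausdorffMeasure (hasDerivAt_vertical hG.cont hG.cont₁ hG.deriv ht)
    (continuous_const.mul (continuous_vertical hG.cont₁ ht)) (a := 0) (b := 2 * Real.pi)
    (by positivity) hinj hcont
  have hcurve : levelCurve Ω U φ =
      (fun θ : ℝ => G (t + θ * Complex.I)) '' Set.Ico 0 (2 * Real.pi) := by
    rw [hφ, hG.levelCurve_eq h.const_pos ht]
  rw [← hcurve] at h1
  refine ⟨h1.1, h1.2.trans ?_⟩
  have h2 : ∀ θ : ℝ, ‖Complex.I * G₁ (t + θ * Complex.I)‖ *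
      entropyDensity Ω U Φ φ (G (t + θ * Complex.I)) =
      (Real.log (levelLength Ω U φ) - Real.log (2 * Real.pi) -
        Real.log ‖G₁ (t + θ * Complex.I)‖) / (2 * Real.pi) := by
    intro θ
    have := hn θ
    rw [h.entropyDensity_eq hG ht hL, norm_mul, Complex.norm_I, one_mul]
    field_simp
  simp_rw [h2]
  rw [intervalIntegral.integral_div, intervalIntegral.integral_sub
    (continuous_const.intervalIntegrable _ _) (hlog.intervalIntegrable _ _),
    intervalIntegral.integral_const, smul_eq_mul, sub_zero, sub_div,
    mul_div_cancel_left₀ _ (by positivity)]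

/-- `Im q` vanishes exactly when `‖G₁‖ = c / E` is constant along the curve, and then `Re q = κ
‖G₁‖` is constant exactly when `κ` is. -/
theorem constant_iff (h : IsExteriorDirichlet Ω γ U Φ φ₀)
    (hG : IsLevelParam Ω U φ₀ (Φ / (2 * Real.pi)) G G₁ G₂) (ht : 0 ≤ t) :
    (∃ r : ℝ, ∀ θ ∈ Set.Icc 0 (2 * Real.pi),
        G₂ (t + θ * Complex.I) / G₁ (t + θ * Complex.I) = r) ↔
      (∃ e, ∀ z ∈ levelCurve Ω U (φ₀ - Φ / (2 * Real.pi) * t), fieldStrength Ω U z = e) ∧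
      (∃ k, ∀ z ∈ levelCurve Ω U (φ₀ - Φ / (2 * Real.pi) * t), levelCurvature Ω U z = k) := by
  have hc := h.const_pos
  have hn := hG.norm_pos hc ht
  have hE := fun θ : ℝ => hG.fieldStrength_eq hc (IsLevelParam.re_nonneg_of ht θ)
  have hκ := h.levelCurvature_eq hG hc ht
  have hd := hG.hasDerivAt_norm_vertical hc ht
  rw [hG.levelCurve_eq hc ht]
  simp only [Set.forall_mem_image]
  constructor
  · rintro ⟨r, hr⟩
    have hconst : ∀ θ ∈ Set.Icc 0 (2 * Real.pi), ‖G₁ (t + θ * Complex.I)‖ =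
        ‖G₁ (t + (0 : ℝ) * Complex.I)‖ :=
      constant_of_has_deriv_right_zero
        (continuous_vertical hG.cont₁.norm ht).continuousOn fun θ hθ => by
          refine ((hd θ).congr_deriv ?_).hasDerivWithinAt
          rw [hr θ (Set.Ico_subset_Icc_self hθ)]
          simp
    refine ⟨⟨Φ / (2 * Real.pi) / ‖G₁ (t + (0 : ℝ) * Complex.I)‖, fun θ hθ => ?_⟩, ⟨r / ‖G₁ (t + (0 : ℝ) * Complex.I)‖, fun θ hθ => ?_⟩⟩
    · exact (hE θ).trans (congrArg _ (hconst θ (Set.Ico_subset_Icc_self hθ)))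
    · rw [hκ, hr θ (Set.Ico_subset_Icc_self hθ), hconst θ (Set.Ico_subset_Icc_self hθ),
        Complex.ofReal_re]
  · rintro ⟨⟨e, he⟩, k, hk⟩
    have hnorm : ∀ θ : ℝ, ‖G₁ (t + θ * Complex.I)‖ = Φ / (2 * Real.pi) / e := by
      intro θ
      obtain ⟨θ', hθ', e1⟩ := (hG.norm_periodic ht).exists_mem_Ico₀ (by positivity) θ
      have h1 := he hθ'
      rw [hE] at h1
      refine e1.trans ?_
      have := hn θ'
      rw [← h1, div_div_cancel₀ hc.ne']
    have him : ∀ θ : ℝ, (G₂ (t + θ * Complex.I) / G₁ (t + θ * Complex.I)).im = 0 := by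
      intro θ
      have h1 := hd θ
      have h2 : (fun θ : ℝ => ‖G₁ (t + θ * Complex.I)‖) = fun _ => Φ / (2 * Real.pi) / e :=
        funext hnorm
      rw [h2] at h1
      have h3 := h1.unique (hasDerivAt_const θ _)
      exact (mul_eq_zero.1 (neg_eq_zero.1 h3)).resolve_left (hn θ).ne'
    have hmem : ∀ θ ∈ Set.Ico 0 (2 * Real.pi), G₂ (t + θ * Complex.I) / G₁ (t + θ * Complex.I) =
        ((k * (Φ / (2 * Real.pi) / e) : ℝ) : ℂ) := by
      intro θ hθ
      have h1 := hk hθ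
      rw [hκ, div_eq_iff (hn θ).ne', hnorm] at h1
      apply Complex.ext
      · rw [h1, Complex.ofReal_re]
      · rw [him, Complex.ofReal_im]
    refine ⟨k * (Φ / (2 * Real.pi) / e), fun θ hθ => ?_⟩
    -- The endpoint `2π` is outside the half-open parameter interval and is reached by periodicity.
    rcases hθ.2.eq_or_lt with rfl | hlt
    · rw [hG.periodic_quot ht]
      exact hmem 0 ⟨le_rfl, by positivity⟩
    · exact hmem θ ⟨hθ.1, hlt⟩

end IsExteriorDirichlet

theorem mainTheorem4 (Ω : Set ℂ) (γ : ℝ → ℂ) (U : ℂ → ℝ) (Φ φ₀ : ℝ)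
    (hU : IsExteriorDirichlet Ω γ U Φ φ₀) :
    (∀ φ ≤ φ₀, 0 < μH[1] (levelCurve Ω U φ) ∧ μH[1] (levelCurve Ω U φ) < ⊤) ∧
    ConvexOn ℝ (Set.Iic φ₀) (fun φ => Real.log (levelLength Ω U φ)) ∧
    ContDiffOn ℝ 2 (fun φ => Real.log (levelLength Ω U φ)) (Set.Iic φ₀) ∧
    (∀ φ ≤ φ₀, MeasureTheory.IntegrableOn (entropyDensity Ω U Φ φ) (levelCurve Ω U φ) μH[1]) ∧
    ContDiffOn ℝ 2 (levelEntropy Ω U Φ) (Set.Iic φ₀) ∧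
    ∀ φ ≤ φ₀,
      iteratedDerivWithin 2 (levelEntropy Ω U Φ) (Set.Iic φ₀) φ =
        iteratedDerivWithin 2 (fun φ => Real.log (levelLength Ω U φ)) (Set.Iic φ₀) φ ∧
      0 ≤ iteratedDerivWithin 2 (levelEntropy Ω U Φ) (Set.Iic φ₀) φ ∧
      (iteratedDerivWithin 2 (levelEntropy Ω U Φ) (Set.Iic φ₀) φ = 0 ↔
        (∃ c, ∀ z ∈ levelCurve Ω U φ, fieldStrength Ω U z = c) ∧
        (∃ k, ∀ z ∈ levelCurve Ω U φ, levelCurvature Ω U z = k)) := by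
  obtain ⟨G, G₁, G₂, hG, hinj⟩ := hU.exists_levelParam_injOn
  have hc := hU.const_pos
  have hpi := Real.two_pi_pos
  set L : ℝ → ℝ := fun t => ∫ θ in (0 : ℝ)..2 * Real.pi, ‖G₁ (t + θ * Complex.I)‖ with hL
  set L₁ : ℝ → ℝ := fun t => ∫ θ in (0 : ℝ)..2 * Real.pi, ‖G₁ (t + θ * Complex.I)‖ *
    (G₂ (t + θ * Complex.I) / G₁ (t + θ * Complex.I)).re with hL₁
  set L₂ : ℝ → ℝ := fun t => ∫ θ in (0 : ℝ)..2 * Real.pi, ‖G₁ (t + θ * Complex.I)‖ *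
    ‖G₂ (t + θ * Complex.I) / G₁ (t + θ * Complex.I)‖ ^ 2 with hL₂
  set M : ℝ → ℝ := fun t => ∫ θ in (0 : ℝ)..2 * Real.pi, Real.log ‖G₁ (t + θ * Complex.I)‖ with hM
  set M₁ : ℝ → ℝ := fun t => ∫ θ in (0 : ℝ)..2 * Real.pi,
    (G₂ (t + θ * Complex.I) / G₁ (t + θ * Complex.I)).re with hM₁
  have hqc := hG.continuousOn_quot hc
  have hrec : ContinuousOn (fun s => (G₂ s / G₁ s).re) {s : ℂ | 0 ≤ s.re} :=
    Complex.continuous_re.comp_continuousOn hqc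
  have hLc : ContinuousOn L (Set.Ici 0) := continuousOn_integral_vertical hG.cont₁.norm _ _
  have hL₁c : ContinuousOn L₁ (Set.Ici 0) :=
    continuousOn_integral_vertical (hG.cont₁.norm.mul hrec) _ _
  have hL₂c : ContinuousOn L₂ (Set.Ici 0) :=
    continuousOn_integral_vertical (hG.cont₁.norm.mul (hqc.norm.pow 2)) _ _
  have hMc : ContinuousOn M (Set.Ici 0) := continuousOn_integral_vertical
    (hG.cont₁.norm.log fun s hs => norm_ne_zero_iff.2 (hG.ne_zero hc hs)) _ _
  have hM₁c : ContinuousOn M₁ (Set.Ici 0) := continuousOn_integral_vertical hrec _ _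
  have hLd : ∀ t, 0 ≤ t → HasDerivWithinAt L (L₁ t) (Set.Ici 0) t := fun t ht =>
    hasDerivWithinAt_Ici_of_hasDerivAt_Ioi hLc hL₁c (fun t ht => hG.hasDerivAt_length hc ht) ht
  have hL₁d : ∀ t, 0 ≤ t → HasDerivWithinAt L₁ (L₂ t) (Set.Ici 0) t := fun t ht =>
    hasDerivWithinAt_Ici_of_hasDerivAt_Ioi hL₁c hL₂c
      (fun t ht => hG.hasDerivAt_deriv_length hc ht) ht
  have hMd : ∀ t, 0 ≤ t → HasDerivWithinAt M (M₁ t) (Set.Ici 0) t := fun t ht =>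
    hasDerivWithinAt_Ici_of_hasDerivAt_Ioi hMc hM₁c
      (fun t ht => hG.hasDerivAt_integral_log hc ht) ht
  have hM₁d : ∀ t, 0 ≤ t → HasDerivWithinAt M₁ 0 (Set.Ici 0) t := fun t ht =>
    hasDerivWithinAt_Ici_of_hasDerivAt_Ioi (f' := fun _ => 0) hM₁c continuousOn_const
      (fun t ht => hG.hasDerivAt_deriv_integral_log hc ht) ht
  have hLpos : ∀ t, 0 ≤ t → 0 < L t := fun t ht =>
    intervalIntegral.intervalIntegral_pos_of_pos
      ((continuous_vertical hG.cont₁.norm ht).intervalIntegrable _ _) (hG.norm_pos hc ht) hpi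
  have hmeas : ∀ t, 0 ≤ t →
      μH[1] (levelCurve Ω U (φ₀ - Φ / (2 * Real.pi) * t)) = ENNReal.ofReal (L t) := fun t ht =>
    IsExteriorDirichlet.hausdorffMeasure_levelCurve hG hc ht (hinj t ht)
  have hlen : ∀ t, 0 ≤ t → levelLength Ω U (φ₀ - Φ / (2 * Real.pi) * t) = L t := fun t ht => by
    rw [levelLength, curveLength, hmeas t ht, ENNReal.toReal_ofReal (hLpos t ht).le]
  have hent := fun t (ht : 0 ≤ t) => hU.entropy_eq hG ht (hinj t ht) rfl
    ((hLpos t ht).trans_eq (hlen t ht).symm)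
  have hparam : ∀ φ ≤ φ₀, ∃ t, 0 ≤ t ∧ φ = φ₀ - Φ / (2 * Real.pi) * t := fun φ hφ =>
    ⟨(φ₀ - φ) / (Φ / (2 * Real.pi)), div_nonneg (sub_nonneg.2 hφ) hc.le, by
      rw [mul_div_cancel₀ _ hc.ne']; ring⟩
  -- The second `t`-derivative of `log L`, in the form of a weighted variance.
  set D : ℝ → ℝ := fun t => L₂ t / L t - (L₁ t / L t) ^ 2 with hD
  have hDc : ContinuousOn D (Set.Ici 0) :=
    (hL₂c.div hLc fun t ht => (hLpos t ht).ne').sub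
      ((hL₁c.div hLc fun t ht => (hLpos t ht).ne').pow 2)
  have hlogd : ∀ t, 0 ≤ t → HasDerivWithinAt (fun t => Real.log (L t)) (L₁ t / L t)
      (Set.Ici 0) t := fun t ht => (hLd t ht).log (hLpos t ht).ne'
  have hquotd : ∀ t, 0 ≤ t → HasDerivWithinAt (fun t => L₁ t / L t) (D t) (Set.Ici 0) t := by
    intro t ht
    have h0 := (hLpos t ht).ne'
    refine ((hL₁d t ht).div (hLd t ht) h0).congr_deriv ?_
    simp only [hD]
    field_simp
  have hvar := fun t (ht : 0 ≤ t) => weighted_variance (continuous_vertical hG.cont₁.norm ht)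
    (continuous_vertical hqc ht) (hG.norm_pos hc ht) hpi
  obtain ⟨hlogC, hlogD, hlogConv⟩ := contDiffOn_and_iteratedDerivWithin_Iic
    (f := fun φ => Real.log (levelLength Ω U φ)) (b := φ₀) hc hlogd hquotd hDc
    (fun t ht => by rw [hlen t ht])
  -- The entropy differs from `log L` by a constant and a multiple of `M`. As `M₁` has zero
  -- derivative, the same `D` serves as its second derivative.
  obtain ⟨hentC, hentD, -⟩ := contDiffOn_and_iteratedDerivWithin_Iic
    (f := levelEntropy Ω U Φ) (b := φ₀) hc
    (g := fun t => Real.log (L t) - Real.log (2 * Real.pi) - M t / (2 * Real.pi))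
    (g₁ := fun t => L₁ t / L t - M₁ t / (2 * Real.pi)) (g₂ := D)
    (fun t ht => ((hlogd t ht).sub_const _).sub ((hMd t ht).div_const _))
    (fun t ht => ((hquotd t ht).sub ((hM₁d t ht).div_const _)).congr_deriv (by simp)) hDc
    (fun t ht => by rw [(hent t ht).2, hlen t ht])
  refine ⟨?_, hlogConv fun t ht => (hvar t ht).1, hlogC, ?_, hentC, ?_⟩
  · intro φ hφ
    obtain ⟨t, ht, rfl⟩ := hparam φ hφ
    rw [hmeas t ht]
    exact ⟨ENNReal.ofReal_pos.2 (hLpos t ht), ENNReal.ofReal_lt_top⟩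
  · intro φ hφ
    obtain ⟨t, ht, rfl⟩ := hparam φ hφ
    exact (hent t ht).1
  · intro φ hφ
    obtain ⟨t, ht, rfl⟩ := hparam φ hφ
    rw [hentD t ht, hlogD t ht]
    refine ⟨rfl, div_nonneg (hvar t ht).1 (by positivity), ?_⟩
    rw [div_eq_zero_iff, or_iff_left (pow_ne_zero 2 hc.ne'), ← hU.constant_iff hG ht]
    exact (hvar t ht).2
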